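/- **Setting.** Let $k\ge 1$ be an integer, $M=2^k$, $0<\mu<1$, $0<p_a\le 1$, $0<\epsilon<1$. For each blocklength $n$ there are $K=K(n)$ users, of which $K_a=K_a(n)\le K$ are active, with $K/n\to\mu$ and $K_a/K\to p_a$ as $n\to\infty$ (so $K=\mu n$, $K_a=p_aK$ up to rounding). User $j$ has an individual codebook $\{\mathbf c^j_1,\dots,\mathbf c^j_M\}\subset\mathbb C^n$ with $\|\mathbf c^j_m\|_2^2\le nP$, where $P=k\varepsilon/n$ and $\varepsilon$ is the energy-per-bit. If $\mathcal K_a$ is the set of active users, the receiver observes $$\mathbf y=\sum_{j\in\mathcal K_a}h_j\mathbf c^j_{W_j}+\mathbf z,$$ with independent messages $W_j$ uniform on $[M]$, $h_j\sim\mathcal{CN}(0,1)$ i.i.d., and $\mathbf z$ with i.i.d. $\mathcal{CN}(0,1)$ entries, all independent. No CSI: the decoder sees only $\mathbf y$ (it knows neither $\mathcal K_a$ nor the $h_j$), declares exactly $K_a$ users active and outputs a message $\hat W_j$ for each of these, and an error symbol for every other user. The per-user probability of error is $P_e=\mathbb E\big[\frac1{K_a}\sum_{j\in\mathcal K_a}1[\hat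 W_j\ne W_j]\big]$. An $(n,M,\epsilon,\varepsilon,K,K_a)$ code is such a system with $P_e\le\epsilon$, in either of the following two senses: (a) encoders and decoder may depend on a common random seed, independent of everything else, and $P_e\le\epsilon$ for every $\mathcal K_a$ with $|\mathcal K_a|=K_a$; (b) encoders and decoder are deterministic, and $P_e\le\epsilon$ on average over $\mathcal K_a$ uniformly distributed over the $K_a$-subsets of users. Let $$\varepsilon^*=\limsup_{n\to\infty}\,\inf\{\varepsilon:\text{ an }(n,M,\epsilon,\varepsilon,K,K_a)\text{ code exists}\}.$$ **Notation.** Let $S=p_a\mu k$, $h(x)=-x\ln x-(1-x)\ln(1-x)$, $\xi(\varsigma,\zeta)=\varsigma\ln\varsigma-\zeta\ln\zeta+\zeta-\varsigma$ ($0\ln0=0$), and for $\theta\in(0,1]$ $$\delta_{1,\theta}^*=\frac{p_a\mu}{1-p_a\mu}h(\theta),$$ $$V_\theta=\exp\Big\{-\Big(\delta_{1,\theta}^*+\tfrac{1-p_a\mu+\theta p_a\mu}{1-p_a\mu}h\big(\tfrac{\theta p_a\mu}{1-p_a\mu+\theta p_a\mu}\big)+\tfrac{\theta p_a\mu\ln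 M}{1-p_a\mu}+\tfrac{\mu(1-p_a+\theta p_a)}{1-p_a\mu}h\big(\tfrac{\theta p_a}{1-p_a+\theta p_a}\big)\Big)\Big\},$$ $$c_\theta=\frac{2V_\theta}{1-V_\theta},\qquad q_\theta=\frac{p_a\mu}{1-p_a\mu+\theta p_a\mu}h(\theta),$$ $$\delta_{2,\theta}^*=q_\theta(1+c_\theta)+\sqrt{q_\theta^2c_\theta(2+c_\theta)+2q_\theta(1+c_\theta)},\qquad \delta_3^*=\inf\{x:0<x<1,\,-\ln(1-x)-x>0\},$$ $$W_\theta=\frac{1-V_\theta}{V_\theta}(1+\delta_{2,\theta}^*),\qquad P'_{tot,a}(\theta)=\frac{W_\theta}{(1-\delta_3^*)\,\xi(1-\theta,1)},\qquad \varepsilon^*_{no\text{-}CSI}=\sup_{\theta\in(\epsilon,1]}\frac{P'_{tot,a}(\theta)}{S}.$$ **Claim.** If $\varepsilon>\varepsilon^*_{no\text{-}CSI}$, there are $\epsilon_n$ with $\limsup_{n\to\infty}\epsilon_n\le\epsilon$ such that for every $n$ an $(n,M,\epsilon_n,\varepsilon,K,K_a)$ code exists, both in sense (a) and in sense (b). Hence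 $\varepsilon^*\le\varepsilon^*_{no\text{-}CSI}$, in both senses. -/

import Mathlib

open MeasureTheory ProbabilityTheory Filter Topology
open scoped BigOperators NNReal

noncomputable section

/-- The circularly symmetric complex Gaussian law `CN(0,1)`: independent real and imaginary parts,
each real Gaussian with mean `0` and variance `1/2`. -/
def complexGaussian : Measure ℂ :=
  ((gaussianReal 0 (1 / 2 : ℝ≥0)).prod (gaussianReal 0 (1 / 2 : ℝ≥0))).map
    Complex.measurableEquivRealProd.symm

instance : IsProbabilityMeasure complexGaussian :=
  Measure.isProbabilityMeasure_map Complex.measurableEquivRealProd.symm.measurable.aemeasurable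

/-- A (possibly randomized) random access code of blocklength `n` for `K` users, of which `Ka` are
active, each with an individual codebook of `M` codewords under the power constraint `P`.
The randomization is a seed that is independent of the messages, the fading and the noise.
The decoder sees only the channel output (and the seed): neither the fading coefficients nor the
set of active users. It declares exactly `Ka` users active and outputs a message for each of them;
`none` is the error symbol of the other users. -/
structure RandomAccessCode (n M K Ka : ℕ) (P : ℝ) where
  Seed : Type
  [mSeed : MeasurableSpace Seed]
  law : Measure Seed
  [isProb : IsProbabilityMeasure law]
  enc : Seed → Fin K → Fin M → Fin n → ℂ
  dec : Seed → (Fin n → ℂ) → Fin K → Option (Fin M)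
  enc_meas : ∀ j m i, Measurable fun s => enc s j m i
  dec_meas : ∀ j v, MeasurableSet {p : Seed × (Fin n → ℂ) | dec p.1 p.2 j = v}
  power : ∀ s j m, ∑ i, ‖enc s j m i‖ ^ 2 ≤ n * P
  card_dec : ∀ s y, (Finset.univ.filter fun j => (dec s y j).isSome).card = Ka

attribute [instance] RandomAccessCode.mSeed RandomAccessCode.isProb

namespace RandomAccessCode

variable {n M K Ka : ℕ} {P : ℝ}

/-- The channel output when the users in `A` are active, the messages are `w`, the seed is `s`,
the fading coefficients are `h` and the noise is `z`. -/
def output (c : RandomAccessCode n M K Ka P) (A : Finset (Fin K)) (w : Fin K → Fin M)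
    (s : c.Seed) (h : Fin K → ℂ) (z : Fin n → ℂ) : Fin n → ℂ :=
  fun i => ∑ j ∈ A, h j * c.enc s j (w j) i + z i

/-- The per-user probability of error when `A` is the set of active users: the messages are
independent and uniform, and the fading coefficients and the noise entries are i.i.d. `CN(0,1)`. -/
def pupe (c : RandomAccessCode n M K Ka P) (A : Finset (Fin K)) : ℝ :=
  𝔼 w : Fin K → Fin M,
    ∫ ω : c.Seed × (Fin K → ℂ) × (Fin n → ℂ),
      (1 / (Ka : ℝ)) * ((A.filter fun j =>
        c.dec ω.1 (c.output A w ω.1 ω.2.1 ω.2.2) j ≠ some (w j)).card : ℝ)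
      ∂(c.law.prod ((Measure.pi fun _ : Fin K => complexGaussian).prod
        (Measure.pi fun _ : Fin n => complexGaussian)))

end RandomAccessCode

/-- There is a (possibly randomized) code for payload `k` bits (`M = 2 ^ k`) with energy-per-bit
`e = n P / k` whose per-user probability of error is at most `ε` for every set of `Ka` active
users. -/
def HasCode (n k K Ka : ℕ) (ε e : ℝ) : Prop :=
  ∃ c : RandomAccessCode n (2 ^ k) K Ka (k * e / n),
    ∀ A : Finset (Fin K), A.card = Ka → c.pupe A ≤ ε

/-- The same for a deterministic code, when the set of active users is uniformly distributed over
all sets of `Ka` users. -/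
def HasDetCode (n k K Ka : ℕ) (ε e : ℝ) : Prop :=
  ∃ c : RandomAccessCode n (2 ^ k) K Ka (k * e / n), Subsingleton c.Seed ∧
    (𝔼 A ∈ (Finset.univ : Finset (Fin K)).powersetCard Ka, c.pupe A) ≤ ε

/-- The asymptotic minimum energy-per-bit at target error `ε` for the class of codes
`Code n k K Ka ε e`, where `K n` users and `Ka n` active users are present at blocklength `n`.
It is the upper limit, so that an upper bound on it is the stronger claim. -/
def minEnergyPerBit (Code : ℕ → ℕ → ℕ → ℕ → ℝ → ℝ → Prop) (k : ℕ) (K Ka : ℕ → ℕ) (ε : ℝ) : EReal :=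
  limsup (fun n : ℕ => ⨅ e ∈ {e : ℝ | Code n k (K n) (Ka n) ε e}, (e : EReal)) atTop

/-! The explicit quantities of the bound; `μ` is the user density, `p` the fraction of active users,
`k` the payload in bits. `Real.binEntropy` is the binary entropy in nats. -/

namespace NoCSI

/-- `ξ(s, t) = s ln s - t ln t + t - s`. -/
def xi (s t : ℝ) : ℝ := s * Real.log s - t * Real.log t + t - s

def delta1 (μ p θ : ℝ) : ℝ := p * μ / (1 - p * μ) * Real.binEntropy θ

def V (μ p : ℝ) (k : ℕ) (θ : ℝ) : ℝ :=
  Real.exp (-(delta1 μ p θ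
    + (1 - p * μ + θ * p * μ) / (1 - p * μ)
        * Real.binEntropy (θ * p * μ / (1 - p * μ + θ * p * μ))
    + θ * p * μ * Real.log ((2 : ℝ) ^ k) / (1 - p * μ)
    + μ * (1 - p + θ * p) / (1 - p * μ) * Real.binEntropy (θ * p / (1 - p + θ * p))))

def c (μ p : ℝ) (k : ℕ) (θ : ℝ) : ℝ := 2 * V μ p k θ / (1 - V μ p k θ)

def q (μ p θ : ℝ) : ℝ := p * μ / (1 - p * μ + θ * p * μ) * Real.binEntropy θ

def delta2 (μ p : ℝ) (k : ℕ) (θ : ℝ) : ℝ :=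
  q μ p θ * (1 + c μ p k θ)
    + √(q μ p θ ^ 2 * c μ p k θ * (2 + c μ p k θ) + 2 * q μ p θ * (1 + c μ p k θ))

def delta3 : ℝ := sInf {x : ℝ | 0 < x ∧ x < 1 ∧ -Real.log (1 - x) - x > 0}

def W (μ p : ℝ) (k : ℕ) (θ : ℝ) : ℝ :=
  (1 - V μ p k θ) / V μ p k θ * (1 + delta2 μ p k θ)

def Ptot (μ p : ℝ) (k : ℕ) (θ : ℝ) : ℝ := W μ p k θ / ((1 - delta3) * xi (1 - θ) 1)

/-- `sup_{θ ∈ (ε, 1]} P'_{tot,a}(θ) / S` with the spectral efficiency `S = p μ k`, as an extended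
real number. -/
def energyThreshold (μ p : ℝ) (k : ℕ) (ε : ℝ) : EReal :=
  ⨆ θ ∈ Set.Ioc ε 1, ((Ptot μ p k θ / (p * μ * k) : ℝ) : EReal)

end NoCSI

end

/-! ### Complex Gaussian vectors and their Laplace transforms -/

open scoped ENNReal InnerProductSpace

/-! The codebooks are i.i.d. Gaussian with power slightly below the constraint, and the decoder
picks the list of `Ka` user-message pairs whose codewords span the subspace closest to the output. A
span does not change when its generators are rescaled, so the fading is never needed. Let S be the
set of missed active users, t = |S| = θ Ka and m = n - Ka; let T be the correctly decoded codewords,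
I the transmitted list and D the decoded one. Since D is at least as close to the output as I, for
any threshold V either I fails to bring the squared distance below V times that of T, or D brings it
to at most V times that of T (`gaussianCode_section_le`).

The second event is caused by codewords that are independent of the output. Given the codewords in
D, the output is isotropic Gaussian modulo the span of T, which gives probability at most V^m exp((m
+ t) h(t / (m + t))) (`measure_distSq_ratio_le`). There are at most C(Ka, t) C(K - Ka + t, t) M^t
pairs (S, D), and `NoCSI.V` is the value of V at which the union bound balances
(`sum_confusion_le`).

The first event has a Chernoff bound that depends on S only through t and the fading energy of S
(`measure_ratio_le_distSq`). Charging every S the least possible energy is avoided, since few sets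
have low energy. They are counted by a generating function: the terms of degree t in L of ∏ (1 + L
exp(-β |h_j|²)) carry the weights exp(-β · energy), so for typical fading the sets of energy about x
Ka number at most about exp(Ka · `countExponent`) (`sum_exp_neg_le_of_typicalFading`). As |h|² is
exponential, ξ(1 - θ, 1) is the energy carried by the weakest fraction θ of the users, and below it
the count exponent can be made negative (`exists_countExponent_neg`).

For energies above ξ there remains a deterministic inequality between the count exponent and the
Chernoff exponent, for a suitable tilt (`exists_countExponent_le_chernoffExponent`). There δ₂ enters
as the root of a quadratic equation; three bounds on the count (uniform, Jensen, kink) are played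
against two choices of the Chernoff parameter.

Strictly above the threshold the inequality is an open condition, so by compactness finitely many
tilts serve all (θ, x), uniformly near the limiting parameters (`exists_finset_tiltControls`). Hence
finitely many laws of large numbers for the fading suffice. Continuity of P'_tot at ε allows a
target ε' < ε, which leaves room for the vanishing error terms; a good fixed seed gives the
deterministic code. -/

theorem charFun_complexGaussian (t : ℂ) :
    charFun complexGaussian t = Complex.exp (-(‖t‖ ^ 2 / 4 : ℝ)) := by
  have hm : Measurable fun x : ℂ => Complex.exp (↑(inner ℝ x t) * Complex.I) := by fun_prop
  rw [charFun_apply, complexGaussian, integral_map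
    Complex.measurableEquivRealProd.symm.measurable.aemeasurable hm.aestronglyMeasurable]
  have h1 : ∀ x : ℝ × ℝ, Complex.exp (↑(inner ℝ (Complex.measurableEquivRealProd.symm x) t)
      * Complex.I) = Complex.exp (t.re * x.1 * Complex.I) * Complex.exp (t.im * x.2 * Complex.I) := by
    intro x
    rw [← Complex.exp_add]
    congr 1
    simp only [Complex.inner, Complex.measurableEquivRealProd_symm_apply, Complex.mul_re,
      Complex.conj_re, Complex.conj_im]
    push_cast
    ring
  simp_rw [h1]
  rw [integral_prod_mul (fun x : ℝ => Complex.exp (t.re * x * Complex.I))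
    (fun x : ℝ => Complex.exp (t.im * x * Complex.I)), ← charFun_apply_real, ← charFun_apply_real,
    charFun_gaussianReal, charFun_gaussianReal, ← Complex.exp_add, Complex.sq_norm,
    Complex.normSq_apply]
  congr 1
  push_cast
  ring

/-- The standard circularly symmetric complex Gaussian law on `ℂ^ι`. -/
noncomputable def stdComplexGaussian (ι : Type*) [Fintype ι] : Measure (EuclideanSpace ℂ ι) :=
  (Measure.pi fun _ : ι => complexGaussian).map (WithLp.toLp 2)

section
variable {ι κ : Type*} [Fintype ι] [Fintype κ]

instance : IsProbabilityMeasure (stdComplexGaussian ι) :=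
  Measure.isProbabilityMeasure_map (by fun_prop)

theorem charFun_stdComplexGaussian (t : EuclideanSpace ℂ ι) :
    charFun (stdComplexGaussian ι) t = Complex.exp (-(‖t‖ ^ 2 / 4 : ℝ)) := by
  rw [stdComplexGaussian, charFun_pi]
  simp_rw [charFun_complexGaussian]
  rw [← Complex.exp_sum, EuclideanSpace.norm_sq_eq]
  congr 1
  push_cast
  rw [Finset.sum_neg_distrib, Finset.sum_div]

theorem real_inner_euclidean (x y : EuclideanSpace ℂ ι) :
    inner ℝ x y = (inner ℂ x y).re := by
  simp [PiLp.inner_apply, Complex.inner, mul_comm]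

/-- Unitary invariance: the characteristic function depends on the norm only. -/
theorem map_repr_stdComplexGaussian [DecidableEq ι]
    (b : OrthonormalBasis ι ℂ (EuclideanSpace ℂ κ)) :
    (stdComplexGaussian κ).map b.repr = stdComplexGaussian ι := by
  have : IsProbabilityMeasure ((stdComplexGaussian κ).map b.repr) :=
    Measure.isProbabilityMeasure_map b.repr.continuous.measurable.aemeasurable
  apply Measure.ext_of_charFun
  ext t
  rw [charFun_stdComplexGaussian, charFun_apply, integral_map
    b.repr.continuous.measurable.aemeasurable
    (Continuous.aestronglyMeasurable (by fun_prop))]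
  have : ∀ x, (inner ℝ (b.repr x) t : ℝ) = inner ℝ x (b.repr.symm t) := by
    intro x
    rw [real_inner_euclidean, real_inner_euclidean, ← b.repr.inner_map_map x,
      LinearIsometryEquiv.apply_symm_apply]
  simp_rw [this]
  rw [← charFun_apply, charFun_stdComplexGaussian, LinearIsometryEquiv.norm_map]

theorem integral_comp_repr_stdComplexGaussian [DecidableEq ι]
    (b : OrthonormalBasis ι ℂ (EuclideanSpace ℂ κ)) (f : ι → ℂ → ℝ) (hf : ∀ i, Measurable (f i)) :
    ∫ z, ∏ i, f i (inner ℂ (b i) z) ∂(stdComplexGaussian κ) =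
      ∏ i, ∫ z, f i z ∂complexGaussian := by
  have h1 : ∀ z, ∏ i, f i (inner ℂ (b i) z) =
      (fun y : EuclideanSpace ℂ ι => ∏ i, f i (y i)) (b.repr z) := by
    intro z; simp [b.repr_apply_apply]
  simp_rw [h1]
  have hm : Measurable (fun y : EuclideanSpace ℂ ι => ∏ i, f i (y i)) :=
    Finset.measurable_prod _ fun i _ => (hf i).comp (by fun_prop)
  rw [← integral_map (f := fun y : EuclideanSpace ℂ ι => ∏ i, f i (y i))
    b.repr.continuous.measurable.aemeasurable hm.aestronglyMeasurable,
    map_repr_stdComplexGaussian, stdComplexGaussian,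
    integral_map (by fun_prop) hm.aestronglyMeasurable]
  exact integral_fintype_prod_eq_prod (μ := fun _ => complexGaussian) (fun i => f i)

end

theorem integral_exp_neg_mul_sq_gaussianReal (s a : ℝ) (hs : -1 < s) :
    ∫ x, Real.exp (-s * (x + a) ^ 2) ∂(gaussianReal 0 (1 / 2)) =
      √(1 / (1 + s)) * Real.exp (-s * a ^ 2 / (1 + s)) := by
  have h1 : (0 : ℝ) < 1 + s := by linarith
  rw [integral_gaussianReal_eq_integral_smul (by norm_num)]
  have h2 : ∀ x : ℝ, gaussianPDFReal 0 (1 / 2) x • Real.exp (-s * (x + a) ^ 2) =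
      ((√Real.pi)⁻¹ * Real.exp (-s * a ^ 2 / (1 + s))) *
        Real.exp (-(1 + s) * (x + s * a / (1 + s)) ^ 2) := by
    intro x
    simp only [gaussianPDFReal, smul_eq_mul]
    rw [mul_assoc _ (Real.exp _), mul_assoc _ (Real.exp _), ← Real.exp_add, ← Real.exp_add]
    congr 2
    · rw [show 2 * Real.pi * ((1 / 2 : ℝ≥0) : ℝ) = Real.pi by push_cast; ring]
    · push_cast; field_simp; ring
  simp_rw [h2]
  rw [integral_const_mul, integral_add_right_eq_self (fun x : ℝ => Real.exp (-(1 + s) * x ^ 2)),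
    integral_gaussian, Real.sqrt_div Real.pi_pos.le, Real.sqrt_div zero_le_one]
  have := Real.sqrt_pos.2 Real.pi_pos
  have := Real.sqrt_pos.2 h1
  simp
  field_simp

theorem integral_exp_neg_mul_sq_complexGaussian (s : ℝ) (a : ℂ) (hs : -1 < s) :
    ∫ z, Real.exp (-s * ‖z + a‖ ^ 2) ∂complexGaussian =
      (1 + s)⁻¹ * Real.exp (-s * ‖a‖ ^ 2 / (1 + s)) := by
  have hm : Measurable fun z : ℂ => Real.exp (-s * ‖z + a‖ ^ 2) := by fun_prop
  rw [complexGaussian, integral_map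
    Complex.measurableEquivRealProd.symm.measurable.aemeasurable hm.aestronglyMeasurable]
  have h1 : ∀ x : ℝ × ℝ, Real.exp (-s * ‖Complex.measurableEquivRealProd.symm x + a‖ ^ 2) =
      Real.exp (-s * (x.1 + a.re) ^ 2) * Real.exp (-s * (x.2 + a.im) ^ 2) := by
    intro x
    rw [← Real.exp_add, Complex.sq_norm, Complex.normSq_apply]
    simp only [Complex.measurableEquivRealProd_symm_apply, Complex.add_re, Complex.add_im]
    congr 1
    ring
  simp_rw [h1]
  have h0 : (0 : ℝ) < 1 + s := by linarith
  rw [integral_prod_mul (fun x : ℝ => Real.exp (-s * (x + a.re) ^ 2))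
    (fun x : ℝ => Real.exp (-s * (x + a.im) ^ 2)), integral_exp_neg_mul_sq_gaussianReal _ _ hs,
    integral_exp_neg_mul_sq_gaussianReal _ _ hs, mul_mul_mul_comm, ← Real.exp_add,
    Real.mul_self_sqrt (by positivity), Complex.sq_norm, Complex.normSq_apply, one_div]
  congr 2
  ring

/-! ### Squared distance to a subspace -/

section
variable {𝕜 F : Type*} [RCLike 𝕜] [NormedAddCommGroup F] [InnerProductSpace 𝕜 F]
  [FiniteDimensional 𝕜 F]

/-- The squared distance from a point to a subspace. -/
noncomputable def Submodule.distSq (U : Submodule 𝕜 F) (y : F) : ℝ := ‖Uᗮ.starProjection y‖ ^ 2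

theorem Submodule.distSq_add_of_mem (U : Submodule 𝕜 F) (y : F) {u : F} (hu : u ∈ U) :
    U.distSq (y + u) = U.distSq y := by
  have : Uᗮ.starProjection u = 0 := by
    rw [Submodule.starProjection_apply_eq_zero_iff, Submodule.orthogonal_orthogonal]; exact hu
  simp [distSq, map_add, this]

theorem Submodule.distSq_smul (U : Submodule 𝕜 F) (c : 𝕜) (y : F) :
    U.distSq (c • y) = ‖c‖ ^ 2 * U.distSq y := by
  simp [distSq, norm_smul, mul_pow]

theorem Submodule.distSq_eq_sum {ι : Type*} [Fintype ι] (U : Submodule 𝕜 F)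
    (b : OrthonormalBasis ι 𝕜 F) (p : ι → Prop) [DecidablePred p] (h1 : ∀ i, p i → b i ∈ Uᗮ)
    (h2 : ∀ i, ¬ p i → b i ∈ U) (y : F) :
    U.distSq y = ∑ i, if p i then ‖inner 𝕜 (b i) y‖ ^ 2 else 0 := by
  rw [distSq, ← b.sum_sq_norm_inner_right]
  refine Finset.sum_congr rfl fun i _ => ?_
  rw [← Submodule.inner_starProjection_left_eq_right]
  split_ifs with h
  · rw [Submodule.starProjection_eq_self_iff.2 (h1 i h)]
  · rw [(Submodule.starProjection_apply_eq_zero_iff _).2]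
    · simp
    · rw [Submodule.orthogonal_orthogonal]; exact h2 i h

/-- In a basis adapted to a flag the two distances are sums of squared coordinates over nested index
sets, so their joint Laplace transform factors. -/
theorem Submodule.exists_adapted_orthonormalBasis {U₁ U₂ : Submodule 𝕜 F} (h : U₁ ≤ U₂) :
    ∃ b : OrthonormalBasis (Fin (Module.finrank 𝕜 U₁) ⊕
        Fin (Module.finrank 𝕜 U₂ - Module.finrank 𝕜 U₁) ⊕
        Fin (Module.finrank 𝕜 F - Module.finrank 𝕜 U₂)) 𝕜 F,
      (∀ i, b (.inl i) ∈ U₁) ∧ (∀ i, b (.inr (.inl i)) ∈ U₁ᗮ) ∧ (∀ i, b (.inr (.inl i)) ∈ U₂) ∧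
      ∀ i, b (.inr (.inr i)) ∈ U₂ᗮ := by
  have e2 := Submodule.finrank_add_inf_finrank_orthogonal h
  have e3 := Submodule.finrank_add_finrank_orthogonal U₂
  have d2 : Module.finrank 𝕜 ↥(U₁ᗮ ⊓ U₂) = Module.finrank 𝕜 U₂ - Module.finrank 𝕜 U₁ := by omega
  have d3 : Module.finrank 𝕜 ↥U₂ᗮ = Module.finrank 𝕜 F - Module.finrank 𝕜 U₂ := by omega
  let b1 := stdOrthonormalBasis 𝕜 U₁
  let b2 := (stdOrthonormalBasis 𝕜 ↥(U₁ᗮ ⊓ U₂)).reindex (finCongr d2)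
  let b3 := (stdOrthonormalBasis 𝕜 ↥U₂ᗮ).reindex (finCongr d3)
  let v : Fin (Module.finrank 𝕜 U₁) ⊕ Fin (Module.finrank 𝕜 U₂ - Module.finrank 𝕜 U₁) ⊕
        Fin (Module.finrank 𝕜 F - Module.finrank 𝕜 U₂) → F :=
    Sum.elim (fun i => (b1 i : F)) (Sum.elim (fun i => (b2 i : F)) (fun i => (b3 i : F)))
  have hv : Orthonormal 𝕜 v := by
    refine ⟨?_, ?_⟩
    · rintro (i | i | i)
      · exact b1.orthonormal.1 i
      · exact b2.orthonormal.1 i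
      · exact b3.orthonormal.1 i
    · have o12 : ∀ i j, inner 𝕜 (b1 i : F) (b2 j : F) = 0 := fun i j =>
        (b2 j).2.1 _ (b1 i).2
      have o13 : ∀ i j, inner 𝕜 (b1 i : F) (b3 j : F) = 0 := fun i j =>
        (b3 j).2 _ (h (b1 i).2)
      have o23 : ∀ i j, inner 𝕜 (b2 i : F) (b3 j : F) = 0 := fun i j =>
        (b3 j).2 _ (b2 i).2.2
      rintro (i | i | i) (j | j | j) hij
      · exact b1.orthonormal.2 (by simpa using hij)
      · exact o12 _ _
      · exact o13 _ _
      · exact inner_eq_zero_symm.1 (o12 _ _)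
      · exact b2.orthonormal.2 (by simpa using hij)
      · exact o23 _ _
      · exact inner_eq_zero_symm.1 (o13 _ _)
      · exact inner_eq_zero_symm.1 (o23 _ _)
      · exact b3.orthonormal.2 (by simpa using hij)
  have hcard : Fintype.card (Fin (Module.finrank 𝕜 U₁) ⊕
      Fin (Module.finrank 𝕜 U₂ - Module.finrank 𝕜 U₁) ⊕
      Fin (Module.finrank 𝕜 F - Module.finrank 𝕜 U₂)) = Module.finrank 𝕜 F := by
    simp; omega
  have hspan : ⊤ ≤ Submodule.span 𝕜 (Set.range v) :=
    (hv.linearIndependent.span_eq_top_of_card_eq_finrank' hcard).ge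
  refine ⟨OrthonormalBasis.mk hv hspan, ?_, ?_, ?_, ?_⟩
  · intro i; simp [v]
  · intro i; rw [OrthonormalBasis.coe_mk]; exact (b2 i).2.1
  · intro i; rw [OrthonormalBasis.coe_mk]; exact (b2 i).2.2
  · intro i; rw [OrthonormalBasis.coe_mk]; exact (b3 i).2

end

/-- The distance to `U₂` and the excess of the distance to `U₁` over it involve disjoint blocks of
independent coordinates, and the shift by `u ∈ U₂` affects the second block only. Every Chernoff
bound on distances below is an instance of this formula. -/
theorem integral_exp_distSq {n : ℕ} {U₁ U₂ : Submodule ℂ (EuclideanSpace ℂ (Fin n))} (h : U₁ ≤ U₂)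
    {u : EuclideanSpace ℂ (Fin n)} (hu : u ∈ U₂) (l₁ l₂ : ℝ) (h₁ : -1 < l₁) (h₂ : -1 < l₂) :
    ∫ z, Real.exp (-l₂ * U₂.distSq (z + u) - l₁ * (U₁.distSq (z + u) - U₂.distSq (z + u)))
      ∂(stdComplexGaussian (Fin n)) =
    ((1 + l₂)⁻¹) ^ (n - Module.finrank ℂ U₂) *
      ((1 + l₁)⁻¹) ^ (Module.finrank ℂ U₂ - Module.finrank ℂ U₁) *
      Real.exp (-l₁ * U₁.distSq u / (1 + l₁)) := by
  obtain ⟨b, g1, g2, g2', g3⟩ := Submodule.exists_adapted_orthonormalBasis h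
  have E1 : ∀ y, U₁.distSq y = ∑ i, ‖inner ℂ (b (.inr (.inl i))) y‖ ^ 2 +
      ∑ i, ‖inner ℂ (b (.inr (.inr i))) y‖ ^ 2 := by
    intro y
    rw [U₁.distSq_eq_sum b (fun i => i.isRight)
      (by rintro (i|i|i) <;> simp [g2, Submodule.orthogonal_le h (g3 _)])
      (by rintro (i|i|i) <;> simp [g1]) y]
    simp
  have E2 : ∀ y, U₂.distSq y = ∑ i, ‖inner ℂ (b (.inr (.inr i))) y‖ ^ 2 := by
    intro y
    rw [U₂.distSq_eq_sum b (fun i => i.elim (fun _ => false) (fun j => j.isRight))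
      (by rintro (i|i|i) <;> simp [g3]) (by rintro (i|i|i) <;> simp [h (g1 _), g2']) y]
    simp
  have hu0 : ∀ i, inner ℂ (b (.inr (.inr i))) u = 0 := fun i =>
    inner_eq_zero_symm.1 (g3 i u hu)
  let f : (Fin (Module.finrank ℂ U₁) ⊕ Fin (Module.finrank ℂ U₂ - Module.finrank ℂ U₁) ⊕
        Fin (Module.finrank ℂ (EuclideanSpace ℂ (Fin n)) - Module.finrank ℂ U₂)) → ℂ → ℝ :=
    Sum.elim (fun _ _ => 1) (Sum.elim
      (fun i z => Real.exp (-l₁ * ‖z + inner ℂ (b (.inr (.inl i))) u‖ ^ 2))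
      (fun i z => Real.exp (-l₂ * ‖z + inner ℂ (b (.inr (.inr i))) u‖ ^ 2)))
  have hf : ∀ i, Measurable (f i) := by
    rintro (i|i|i) <;> simp only [f, Sum.elim_inl, Sum.elim_inr] <;> fun_prop
  have key : ∀ z, Real.exp (-l₂ * U₂.distSq (z + u) -
      l₁ * (U₁.distSq (z + u) - U₂.distSq (z + u))) = ∏ i, f i (inner ℂ (b i) z) := by
    intro z
    rw [E1, E2]
    simp only [f, Fintype.prod_sum_type, Sum.elim_inl, Sum.elim_inr, Finset.prod_const_one,
      one_mul, ← Real.exp_sum, ← Real.exp_add, ← Finset.mul_sum, inner_add_right]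
    congr 1
    ring
  simp_rw [key]
  rw [integral_comp_repr_stdComplexGaussian b f hf]
  simp only [f, Fintype.prod_sum_type, Sum.elim_inl, Sum.elim_inr,
    integral_exp_neg_mul_sq_complexGaussian _ _ h₁, integral_exp_neg_mul_sq_complexGaussian _ _ h₂,
    Finset.prod_mul_distrib, hu0]
  simp only [integral_const, probReal_univ, one_smul, Finset.prod_const_one, Finset.prod_const,
    norm_zero, Finset.card_univ, Fintype.card_fin, ← Real.exp_sum, ne_eq, OfNat.ofNat_ne_zero,
    not_false_eq_true, zero_pow, mul_zero, zero_div, Real.exp_zero, mul_one, one_mul,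
    finrank_euclideanSpace]
  rw [E1 u]
  simp only [hu0, norm_zero, ← Finset.mul_sum, ← Finset.sum_div]
  simp
  ring

/-! ### Markov's inequality and conditioning on part of the codebook -/

/-- Markov's inequality for `exp X`. Integrability comes for free: the integral of a non-integrable
function is 0, which contradicts `0 < B`. -/
theorem measure_nonneg_le_of_integral_exp {α : Type*} [MeasurableSpace α] {μ : Measure α}
    {X : α → ℝ} {B : ℝ} (hB : 0 < B) (h : ∫ x, Real.exp (X x) ∂μ = B) :
    μ {x | 0 ≤ X x} ≤ ENNReal.ofReal B := by
  have hi : Integrable (fun x => Real.exp (X x)) μ := by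
    by_contra hc
    rw [integral_undef hc] at h
    exact hB.ne h
  rw [← h, ofReal_integral_eq_lintegral_ofReal hi (ae_of_all _ fun x => (Real.exp_pos _).le)]
  refine le_trans (measure_mono ?_) (le_trans (le_of_eq (one_mul _).symm)
    (mul_meas_ge_le_lintegral₀ hi.aestronglyMeasurable.aemeasurable.ennreal_ofReal 1))
  intro x hx
  simp only [Set.mem_ofPred_eq] at hx ⊢
  rw [← ENNReal.ofReal_one]
  exact ENNReal.ofReal_le_ofReal (Real.one_le_exp hx)

theorem lintegral_exp_eq_of_integral_exp {α : Type*} [MeasurableSpace α] {μ : Measure α}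
    {X : α → ℝ} {B : ℝ} (hB : 0 < B) (h : ∫ x, Real.exp (X x) ∂μ = B) :
    ∫⁻ x, ENNReal.ofReal (Real.exp (X x)) ∂μ = ENNReal.ofReal B := by
  have hi : Integrable (fun x => Real.exp (X x)) μ := by
    by_contra hc
    rw [integral_undef hc] at h
    exact hB.ne h
  rw [← h, ofReal_integral_eq_lintegral_ofReal hi (ae_of_all _ fun x => (Real.exp_pos _).le)]

/-- Replacing the coordinates outside `p` by an independent copy preserves a product measure. -/
theorem measurePreserving_pi_mix {ι E : Type*} [Fintype ι] [MeasurableSpace E] (μ : Measure E)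
    [IsProbabilityMeasure μ] (p : ι → Prop) [DecidablePred p] :
    MeasurePreserving (fun q : (ι → E) × (ι → E) => fun i => if p i then q.1 i else q.2 i)
      ((Measure.pi fun _ => μ).prod (Measure.pi fun _ => μ)) (Measure.pi fun _ => μ) := by
  have hm : Measurable (fun q : (ι → E) × (ι → E) => fun i => if p i then q.1 i else q.2 i) := by
    refine measurable_pi_lambda _ fun i => ?_
    split_ifs <;> fun_prop
  refine ⟨hm, (Measure.pi_eq fun s hs => ?_).symm⟩
  rw [Measure.map_apply hm (MeasurableSet.univ_pi hs)]
  have : (fun q : (ι → E) × (ι → E) => fun i => if p i then q.1 i else q.2 i) ⁻¹' (Set.univ.pi s) =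
      (Set.univ.pi fun i => if p i then s i else Set.univ) ×ˢ
        (Set.univ.pi fun i => if p i then Set.univ else s i) := by
    ext q
    simp only [Set.mem_preimage, Set.mem_univ_pi, Set.mem_prod, ← forall_and]
    refine forall_congr' fun i => ?_
    split_ifs <;> simp
  rw [this, Measure.prod_prod, Measure.pi_pi, Measure.pi_pi, ← Finset.prod_mul_distrib]
  refine Finset.prod_congr rfl fun i _ => ?_
  split_ifs <;> simp

/-- This expresses conditioning on the coordinates in `p`: with `g` held fixed, only the others are
random. -/
theorem lintegral_pi_mix {ι E : Type*} [Fintype ι] [MeasurableSpace E] (μ : Measure E)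
    [IsProbabilityMeasure μ] (p : ι → Prop) [DecidablePred p] {F : (ι → E) → ℝ≥0∞}
    (hF : Measurable F) :
    ∫⁻ g, F g ∂(Measure.pi fun _ => μ) =
      ∫⁻ g, ∫⁻ g', F (fun i => if p i then g i else g' i) ∂(Measure.pi fun _ => μ)
        ∂(Measure.pi fun _ => μ) := by
  have hp := measurePreserving_pi_mix μ p
  rw [← hp.lintegral_comp hF]
  exact lintegral_prod _ (hF.comp hp.measurable).aemeasurable

theorem ae_pi_of_mix {ι E : Type*} [Fintype ι] [MeasurableSpace E] (μ : Measure E)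
    [IsProbabilityMeasure μ] (p : ι → Prop) [DecidablePred p] {P : (ι → E) → Prop}
    (hP : MeasurableSet {g | P g})
    (h : ∀ g : ι → E, ∀ᵐ g' : ι → E ∂(Measure.pi fun _ => μ), P (fun i => if p i then g i else g' i)) :
    ∀ᵐ g ∂(Measure.pi fun _ => μ), P g := by
  have hp := measurePreserving_pi_mix μ p
  have h2 : ∀ᵐ q ∂((Measure.pi fun _ : ι => μ).prod (Measure.pi fun _ => μ)),
      q ∈ (fun q : (ι → E) × (ι → E) => fun i => if p i then q.1 i else q.2 i) ⁻¹' {g | P g} :=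
    (Measure.ae_prod_mem_iff_ae_ae_mem (hp.measurable hP)).2 (ae_of_all _ h)
  rw [← hp.map_eq, ae_map_iff hp.measurable.aemeasurable hP]
  exact h2

/-! ### Spans of random codewords -/

section
variable {ι : Type*} [Fintype ι] {κ : Type*} [Fintype κ]

/-- Comparison of characteristic functions. Signal plus noise is again an isotropic Gaussian vector.
-/
theorem map_sum_smul_stdComplexGaussian (a : ι → ℂ) (c c' : ℝ)
    (hc : c ^ 2 = ∑ i, ‖a i‖ ^ 2 + c' ^ 2) :
    ((Measure.pi fun _ : ι => stdComplexGaussian κ).prod (stdComplexGaussian κ)).map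
      (fun p => ∑ i, a i • p.1 i + (c' : ℂ) • p.2) =
    (stdComplexGaussian κ).map fun z => (c : ℂ) • z := by
  have m1 : Measurable (fun p : (ι → EuclideanSpace ℂ κ) × EuclideanSpace ℂ κ =>
      ∑ i, a i • p.1 i + (c' : ℂ) • p.2) := by fun_prop
  have m2 : Measurable (fun z : EuclideanSpace ℂ κ => (c : ℂ) • z) := by fun_prop
  have := Measure.isProbabilityMeasure_map (μ := (Measure.pi fun _ : ι =>
    stdComplexGaussian κ).prod (stdComplexGaussian κ)) m1.aemeasurable
  have := Measure.isProbabilityMeasure_map (μ := stdComplexGaussian κ) m2.aemeasurable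
  have hin : ∀ (α : ℂ) (x t : EuclideanSpace ℂ κ),
      (inner ℝ (α • x) t : ℝ) = inner ℝ x ((starRingEnd ℂ α) • t) := by
    intro α x t
    rw [real_inner_euclidean, real_inner_euclidean, inner_smul_left, inner_smul_right]
  apply Measure.ext_of_charFun
  ext t
  rw [charFun_apply, charFun_apply, integral_map m1.aemeasurable
    (Continuous.aestronglyMeasurable (by fun_prop)), integral_map m2.aemeasurable
    (Continuous.aestronglyMeasurable (by fun_prop))]
  simp_rw [inner_add_left, sum_inner, hin, Complex.ofReal_add, add_mul, Complex.exp_add,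
    Complex.ofReal_sum, Finset.sum_mul, Complex.exp_sum]
  rw [integral_prod_mul (fun x : ι → EuclideanSpace ℂ κ => ∏ i, Complex.exp
      (((inner ℝ (x i) ((starRingEnd ℂ) (a i) • t) : ℝ) : ℂ) * Complex.I))
    (fun z : EuclideanSpace ℂ κ => Complex.exp
      (((inner ℝ z ((starRingEnd ℂ) (c' : ℂ) • t) : ℝ) : ℂ) * Complex.I)),
    integral_fintype_prod_eq_prod (μ := fun _ : ι => stdComplexGaussian κ)
      (fun i (z : EuclideanSpace ℂ κ) => Complex.exp
      (((inner ℝ z ((starRingEnd ℂ) (a i) • t) : ℝ) : ℂ) * Complex.I))]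
  simp_rw [← charFun_apply, charFun_stdComplexGaussian]
  rw [← Complex.exp_sum, ← Complex.exp_add]
  congr 1
  simp only [norm_smul, mul_pow, RCLike.norm_conj, Complex.norm_real, Real.norm_eq_abs, sq_abs]
  rw [hc]
  push_cast
  rw [Finset.sum_neg_distrib, ← Finset.sum_div, ← Finset.sum_mul]
  ring

/-- The span of the vectors of a family with index in `J`. -/
noncomputable def subspan {n : ℕ} (J : Finset ι) (g : ι → EuclideanSpace ℂ (Fin n)) :
    Submodule ℂ (EuclideanSpace ℂ (Fin n)) := Submodule.span ℂ (g '' J)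

variable {n : ℕ}

theorem subspan_mono {T J : Finset ι} (h : T ⊆ J) (g : ι → EuclideanSpace ℂ (Fin n)) :
    subspan T g ≤ subspan J g :=
  Submodule.span_mono (Set.image_mono (by exact_mod_cast h))
end

section
variable {ι : Type*} {n : ℕ}

theorem subspan_congr {J : Finset ι} {g g' : ι → EuclideanSpace ℂ (Fin n)}
    (h : ∀ i ∈ J, g i = g' i) : subspan J g = subspan J g' := by
  unfold subspan
  congr 1
  exact Set.image_congr h

theorem mem_subspan {J : Finset ι} (g : ι → EuclideanSpace ℂ (Fin n)) {i : ι} (h : i ∈ J) :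
    g i ∈ subspan J g :=
  Submodule.subset_span ⟨i, by exact_mod_cast h, rfl⟩

theorem mem_subspan_iff {J : Finset ι} (g : ι → EuclideanSpace ℂ (Fin n))
    (y : EuclideanSpace ℂ (Fin n)) : y ∈ subspan J g ↔ ∃ α : ι → ℂ, ∑ i ∈ J, α i • g i = y := by
  constructor
  · intro h
    rw [subspan, Submodule.mem_span_image_finset_iff_exists_fun] at h
    classical
    obtain ⟨c, rfl⟩ := h
    refine ⟨fun i => if hi : i ∈ J then c ⟨i, hi⟩ else 0, ?_⟩
    rw [← Finset.sum_coe_sort]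
    exact Finset.sum_congr rfl fun i _ => by simp
  · rintro ⟨α, rfl⟩
    exact Submodule.sum_mem _ fun i hi => Submodule.smul_mem _ _ (mem_subspan g hi)

theorem finrank_subspan_le (J : Finset ι) (g : ι → EuclideanSpace ℂ (Fin n)) :
    Module.finrank ℂ (subspan J g) ≤ J.card := by
  classical
  unfold subspan
  rw [← Finset.coe_image]
  exact (finrank_span_finset_le_card _).trans Finset.card_image_le

theorem finrank_subspan_eq {J : Finset ι} {g : ι → EuclideanSpace ℂ (Fin n)}
    (h : LinearIndepOn ℂ g (J : Set ι)) : Module.finrank ℂ (subspan J g) = J.card := by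
  classical
  have h2 := finrank_span_eq_card (R := ℂ) (b := fun i : (J : Set ι) => g i) h
  rw [subspan, Set.image_eq_range, h2]
  simp

theorem finrank_subspan_sub_le [DecidableEq ι] {T J : Finset ι} (hTJ : T ⊆ J)
    (g : ι → EuclideanSpace ℂ (Fin n)) :
    Module.finrank ℂ (subspan J g) - Module.finrank ℂ (subspan T g) ≤ J.card - T.card := by
  have h1 : subspan J g ≤ subspan T g ⊔ subspan (J \ T) g := by
    unfold subspan
    rw [Submodule.span_le]
    rintro _ ⟨i, hi, rfl⟩
    by_cases hT : i ∈ T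
    · exact Submodule.mem_sup_left (mem_subspan g hT)
    · exact Submodule.mem_sup_right (mem_subspan g (Finset.mem_sdiff.2 ⟨by exact_mod_cast hi, hT⟩))
  have h2 := Submodule.finrank_mono h1
  have h3 := Submodule.finrank_add_le_finrank_add_finrank (subspan T g) (subspan (J \ T) g)
  have h4 := finrank_subspan_le (J \ T) g
  rw [Finset.card_sdiff_of_subset hTJ] at h4
  omega

theorem Submodule.distSq_le_norm_sub_sq {F : Type*} [NormedAddCommGroup F] [InnerProductSpace ℂ F]
    [FiniteDimensional ℂ F] (U : Submodule ℂ F) (y : F) {u : F} (hu : u ∈ U) :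
    U.distSq y ≤ ‖y - u‖ ^ 2 := by
  rw [← U.distSq_add_of_mem y (U.neg_mem hu), ← sub_eq_add_neg, distSq]
  have := Uᗮ.norm_starProjection_apply_le (y - u)
  gcongr

theorem Submodule.exists_distSq_eq {F : Type*} [NormedAddCommGroup F] [InnerProductSpace ℂ F]
    [FiniteDimensional ℂ F] (U : Submodule ℂ F) (y : F) :
    ∃ u ∈ U, U.distSq y = ‖y - u‖ ^ 2 := by
  refine ⟨U.starProjection y, Submodule.starProjection_apply_mem _ _, ?_⟩
  rw [distSq, ← U.starProjection_add_starProjection_orthogonal y]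
  simp

theorem Submodule.distSq_eq_zero_iff {F : Type*} [NormedAddCommGroup F] [InnerProductSpace ℂ F]
    [FiniteDimensional ℂ F] (U : Submodule ℂ F) (y : F) : U.distSq y = 0 ↔ y ∈ U := by
  rw [distSq, sq_eq_zero_iff, norm_eq_zero, Submodule.starProjection_apply_eq_zero_iff,
    Submodule.orthogonal_orthogonal]

/-- The distance jumps where the rank of the family drops, so continuity is not available. It is
upper semicontinuous, as an infimum over coefficient vectors of continuous functions; the strict
sublevel sets are therefore open. -/
theorem measurable_distSq_subspan [Fintype ι] (J : Finset ι) :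
    Measurable fun p : (ι → EuclideanSpace ℂ (Fin n)) × EuclideanSpace ℂ (Fin n) =>
      (subspan J p.1).distSq p.2 := by
  refine measurable_of_Iio fun r => IsOpen.measurableSet ?_
  have : (fun p : (ι → EuclideanSpace ℂ (Fin n)) × EuclideanSpace ℂ (Fin n) =>
      (subspan J p.1).distSq p.2) ⁻¹' Set.Iio r =
      ⋃ α : ι → ℂ, {p | ‖p.2 - ∑ i ∈ J, α i • p.1 i‖ ^ 2 < r} := by
    ext p
    simp only [Set.mem_preimage, Set.mem_Iio, Set.mem_iUnion, Set.mem_ofPred_eq]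
    constructor
    · intro h
      obtain ⟨u, hu, hd⟩ := (subspan J p.1).exists_distSq_eq p.2
      obtain ⟨α, rfl⟩ := (mem_subspan_iff _ _).1 hu
      exact ⟨α, hd ▸ h⟩
    · rintro ⟨α, h⟩
      exact ((subspan J p.1).distSq_le_norm_sub_sq p.2
        ((mem_subspan_iff _ _).2 ⟨α, rfl⟩)).trans_lt h
  rw [this]
  exact isOpen_iUnion fun α => isOpen_lt (by fun_prop) continuous_const

theorem Measurable.distSq_subspan_family {α : Type*} [MeasurableSpace α] [Fintype ι] (J : Finset ι)
    {f : α → ι → EuclideanSpace ℂ (Fin n)} {y : α → EuclideanSpace ℂ (Fin n)}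
    (hf : Measurable f) (hy : Measurable y) :
    Measurable fun x => (subspan J (f x)).distSq (y x) :=
  (measurable_distSq_subspan J).comp (f := fun x => (f x, y x)) (hf.prodMk hy)

theorem Submodule.measurable_distSq (U : Submodule ℂ (EuclideanSpace ℂ (Fin n))) :
    Measurable U.distSq :=
  ((Uᗮ.starProjection.continuous.norm).pow 2).measurable

/-- The Laplace transform of the squared distance at `k` bounds the probability, and it tends to 0
as `k → ∞` because the codimension is positive. -/
theorem stdComplexGaussian_submodule_eq_zero (U : Submodule ℂ (EuclideanSpace ℂ (Fin n)))
    (h : Module.finrank ℂ U < n) : stdComplexGaussian (Fin n) {z | U.distSq z = 0} = 0 := by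
  have key : ∀ k : ℕ, stdComplexGaussian (Fin n) {z | U.distSq z = 0} ≤
      ENNReal.ofReal ((1 / ((k : ℝ) + 1))) := by
    intro k
    have h1 := integral_exp_distSq (le_refl U) U.zero_mem 0 (k : ℝ) (by norm_num)
      (by linarith [(Nat.cast_nonneg k : (0 : ℝ) ≤ k)])
    have h2 := measure_nonneg_le_of_integral_exp (by positivity) h1
    refine (measure_mono ?_).trans (h2.trans (ENNReal.ofReal_le_ofReal ?_))
    · intro z hz
      simp only [Set.mem_ofPred_eq] at hz ⊢
      simp [hz]
    · have h3 : ((1 + (k : ℝ))⁻¹) ^ (n - Module.finrank ℂ U) ≤ (1 + (k : ℝ))⁻¹ :=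
        pow_le_of_le_one (by positivity)
          (inv_le_one_of_one_le₀ (by linarith [(Nat.cast_nonneg k : (0 : ℝ) ≤ k)])) (by omega)
      rw [one_div, add_comm (k : ℝ)]
      simpa using h3
  have h3 : Tendsto (fun k : ℕ => ENNReal.ofReal (1 / ((k : ℝ) + 1))) atTop (𝓝 0) := by
    rw [← ENNReal.ofReal_zero]
    exact ENNReal.tendsto_ofReal tendsto_one_div_add_atTop_nhds_zero_nat
  exact le_antisymm (ge_of_tendsto' h3 key) bot_le

/-- Given the other vectors, each one almost surely avoids their span, whose dimension is less than
`n`. -/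
theorem ae_linearIndepOn [Fintype ι] [DecidableEq ι] (I : Finset ι) (hI : I.card ≤ n) :
    ∀ᵐ g ∂(Measure.pi fun _ : ι => stdComplexGaussian (Fin n)), LinearIndepOn ℂ g (I : Set ι) := by
  have key : ∀ j ∈ I, ∀ᵐ g ∂(Measure.pi fun _ : ι => stdComplexGaussian (Fin n)),
      g j ∉ subspan (I.erase j) g := by
    intro j hj
    have hm : MeasurableSet {g : ι → EuclideanSpace ℂ (Fin n) |
        (subspan (I.erase j) g).distSq (g j) ≠ 0} := by
      have : Measurable fun g : ι → EuclideanSpace ℂ (Fin n) =>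
        (subspan (I.erase j) g).distSq (g j) :=
        (measurable_distSq_subspan (I.erase j)).comp
          (f := fun g : ι → EuclideanSpace ℂ (Fin n) => (g, g j)) (by fun_prop)
      exact (this (measurableSet_singleton 0)).compl
    have : ∀ᵐ g ∂(Measure.pi fun _ : ι => stdComplexGaussian (Fin n)),
        (subspan (I.erase j) g).distSq (g j) ≠ 0 := by
      refine ae_pi_of_mix _ (fun i => i ≠ j) hm fun g => ?_
      have hU : ∀ g' : ι → EuclideanSpace ℂ (Fin n),
          subspan (I.erase j) (fun i => if i ≠ j then g i else g' i) = subspan (I.erase j) g := by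
        intro g'
        refine subspan_congr fun i hi => ?_
        simp [Finset.ne_of_mem_erase hi]
      simp only [hU]
      have he := measurePreserving_eval (fun _ : ι => stdComplexGaussian (Fin n)) j
      have hz : ∀ᵐ z ∂(stdComplexGaussian (Fin n)), (subspan (I.erase j) g).distSq z ≠ 0 := by
        rw [ae_iff]
        simp only [ne_eq, not_not]
        refine stdComplexGaussian_submodule_eq_zero _ ?_
        have := finrank_subspan_le (I.erase j) g
        have := Finset.card_erase_lt_of_mem hj
        omega
      have := he.quasiMeasurePreserving.ae hz
      simpa using this
    filter_upwards [this] with g hg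
    rwa [Ne, Submodule.distSq_eq_zero_iff] at hg
  have h2 := (ae_ball_iff I.countable_toSet).2 key
  filter_upwards [h2] with g hg
  rw [linearIndepOn_iff_notMem_span]
  intro i hi hc
  refine hg i hi ?_
  have : ((I.erase i : Finset ι) : Set ι) = (I : Set ι) \ {i} := by simp
  rwa [subspan, this]

end

/-! ### Chernoff bounds for the ratio of two distances -/

section
variable {n : ℕ}

theorem stdComplexGaussian_distSq_ratio_le {U₁ U₂ : Submodule ℂ (EuclideanSpace ℂ (Fin n))}
    (h : U₁ ≤ U₂) {m t : ℕ} (hm : 0 < m) (ht : 0 < t) (h2 : Module.finrank ℂ U₂ + m ≤ n)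
    (h12 : Module.finrank ℂ U₂ - Module.finrank ℂ U₁ ≤ t) {V : ℝ} (hV0 : 0 < V) (hV1 : V < 1) :
    stdComplexGaussian (Fin n) {z | U₂.distSq z ≤ V * U₁.distSq z} ≤
      ENNReal.ofReal ((V * ((m + t) / m)) ^ m * ((m + t : ℝ) / t) ^ t) := by
  have hm' : (0 : ℝ) < m := by exact_mod_cast hm
  have ht' : (0 : ℝ) < t := by exact_mod_cast ht
  -- Chernoff parameter for `V · d₁ - d₂ ≥ 0`. With `l V = m / (m + t)` the two factors are the
  -- inverses of `t / (m + t) + l` and `t / (m + t)`; dropping the first summand `t / (m + t)` gives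
  -- the bound. A rank deficiency only helps here.
  set l : ℝ := m / (m + t) / V with hl
  have hlV : l * V = m / (m + t) := by rw [hl]; field_simp
  have hl0 : 0 < l := by positivity
  have e1 : 1 + -(l * V) = t / (m + t) := by rw [hlV]; field_simp; ring
  have e1p : 0 < 1 + -(l * V) := by rw [e1]; positivity
  have e2 : 1 + l * (1 - V) = t / (m + t) + l := by linear_combination e1
  have e2p : 0 ≤ l * (1 - V) := mul_nonneg hl0.le (by linarith)
  have key := integral_exp_distSq h U₂.zero_mem (-(l * V)) (l * (1 - V)) (by linarith)
    (by linarith)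
  simp only [add_zero] at key
  have hz : U₁.distSq 0 = 0 := by simp [Submodule.distSq]
  rw [hz] at key
  simp only [mul_zero, zero_div, Real.exp_zero, mul_one] at key
  have key2 := measure_nonneg_le_of_integral_exp (by positivity) key
  refine (measure_mono ?_).trans (key2.trans (ENNReal.ofReal_le_ofReal ?_))
  · intro z hz
    simp only [Set.mem_ofPred_eq] at hz ⊢
    have := mul_nonneg hl0.le (sub_nonneg.2 hz)
    linarith
  · have h3 : (1 + l * (1 - V))⁻¹ ≤ V * ((m + t) / m) := by
      rw [e2]
      calc (t / (m + t) + l)⁻¹ ≤ l⁻¹ := inv_anti₀ hl0 (by linarith [show 0 < t / (m + t : ℝ) by positivity])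
        _ = _ := by rw [hl]; field_simp
    have h4 : (1 + l * (1 - V))⁻¹ ≤ 1 := inv_le_one_of_one_le₀ (by linarith)
    have h5 : (1 + -(l * V))⁻¹ = (m + t) / t := by rw [e1, inv_div]
    rw [h5]
    have h6 : (1 : ℝ) ≤ (m + t) / t := by rw [le_div_iff₀ ht']; linarith
    have h7 : 0 ≤ (1 + l * (1 - V))⁻¹ := by positivity
    gcongr ?_ * ?_
    · exact (pow_le_pow_of_le_one h7 h4 (by omega : m ≤ n - Module.finrank ℂ U₂)).trans
        (pow_le_pow_left₀ h7 h3 _)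
    · exact pow_le_pow_right₀ h6 h12

variable {ι : Type*} [Fintype ι]

theorem map_sum_smul_pi_stdComplexGaussian (a : ι → ℂ) (c : ℝ) (hc : c ^ 2 = ∑ i, ‖a i‖ ^ 2) :
    (Measure.pi fun _ : ι => stdComplexGaussian (Fin n)).map (fun g => ∑ i, a i • g i) =
    (stdComplexGaussian (Fin n)).map fun z => (c : ℂ) • z := by
  have hf := (measurePreserving_fst (μ := Measure.pi fun _ : ι => stdComplexGaussian (Fin n))
      (ν := stdComplexGaussian (Fin n))).map_eq
  rw [← map_sum_smul_stdComplexGaussian a c 0 (by simpa using hc)]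
  conv_lhs => rw [← hf]
  rw [Measure.map_map (by fun_prop) measurable_fst]
  congr 1
  ext p
  simp

/-- Many codewords that do not take part in the channel output are unlikely to explain it. -/
theorem measure_distSq_ratio_le [DecidableEq ι] {T J : Finset ι} (hTJ : T ⊆ J) {m t : ℕ} (hm : 0 < m)
    (ht : 0 < t) (hJ : J.card + m ≤ n) (hJT : J.card ≤ T.card + t) (a : ι → ℂ)
    (ha : ∀ i ∈ J, i ∉ T → a i = 0) {V : ℝ} (hV0 : 0 < V) (hV1 : V < 1) :
    ((Measure.pi fun _ : ι => stdComplexGaussian (Fin n)).prod (stdComplexGaussian (Fin n)))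
      {p | (subspan J p.1).distSq (∑ i, a i • p.1 i + p.2) ≤
        V * (subspan T p.1).distSq (∑ i, a i • p.1 i + p.2)} ≤
      ENNReal.ofReal ((V * ((m + t) / m)) ^ m * ((m + t : ℝ) / t) ^ t) := by
  set B := ENNReal.ofReal ((V * ((m + t) / m)) ^ m * ((m + t : ℝ) / t) ^ t)
  have hY : Measurable fun p : (ι → EuclideanSpace ℂ (Fin n)) × EuclideanSpace ℂ (Fin n) =>
      ∑ i, a i • p.1 i + p.2 := by fun_prop
  have mJ : Measurable fun p : (ι → EuclideanSpace ℂ (Fin n)) × EuclideanSpace ℂ (Fin n) =>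
      (subspan J p.1).distSq (∑ i, a i • p.1 i + p.2) := 
    measurable_fst.distSq_subspan_family J hY
  have mT : Measurable fun p : (ι → EuclideanSpace ℂ (Fin n)) × EuclideanSpace ℂ (Fin n) =>
      (subspan T p.1).distSq (∑ i, a i • p.1 i + p.2) := 
    measurable_fst.distSq_subspan_family T hY
  have hE : MeasurableSet {p : (ι → EuclideanSpace ℂ (Fin n)) × EuclideanSpace ℂ (Fin n) |
      (subspan J p.1).distSq (∑ i, a i • p.1 i + p.2) ≤
        V * (subspan T p.1).distSq (∑ i, a i • p.1 i + p.2)} :=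
    measurableSet_le mJ (mT.const_mul V)
  rw [Measure.prod_apply hE, lintegral_pi_mix _ (fun i => i ∈ J) (measurable_measure_prodMk_left hE)]
  refine le_trans (lintegral_mono (g := fun _ => B) fun g => ?_) (by simp)
  let mix : (ι → EuclideanSpace ℂ (Fin n)) → ι → EuclideanSpace ℂ (Fin n) :=
    fun g' i => if i ∈ J then g i else g' i
  have hmix : Measurable mix := by
    refine measurable_pi_lambda _ fun i => ?_
    simp only [mix]
    split_ifs <;> fun_prop
  have hJm : ∀ g', subspan J (mix g') = subspan J g := fun g' =>
    subspan_congr fun i hi => by simp [mix, hi]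
  have hTm : ∀ g', subspan T (mix g') = subspan T g := fun g' =>
    subspan_congr fun i hi => by simp [mix, hTJ hi]
  set u : EuclideanSpace ℂ (Fin n) := ∑ i ∈ T, a i • g i
  have hu : u ∈ subspan T g := (mem_subspan_iff _ _).2 ⟨a, rfl⟩
  -- The codewords in `J` are now fixed. Those in `T` contribute `u`, which neither distance sees,
  -- and the other ones in `J` have coefficient 0. What is left of the output is isotropic Gaussian,
  -- and its scale `c` cancels in the ratio.
  let a' : ι → ℂ := fun i => if i ∈ J then 0 else a i
  have hsum : ∀ g', ∑ i, a i • mix g' i = ∑ i, a' i • g' i + u := by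
    intro g'
    rw [show u = ∑ i, if i ∈ T then a i • g i else 0 by simp [u], ← Finset.sum_add_distrib]
    refine Finset.sum_congr rfl fun i _ => ?_
    by_cases h1 : i ∈ J
    · by_cases h2 : i ∈ T
      · simp [mix, a', h1, h2]
      · simp [mix, a', h1, h2, ha i h1 h2]
    · have h2 : i ∉ T := fun h => h1 (hTJ h)
      simp [mix, a', h1, h2]
  set c : ℝ := √(∑ i, ‖a' i‖ ^ 2 + 1 ^ 2) with hc
  have hcp : 0 < c := Real.sqrt_pos.2 (by positivity)
  have hc2 : c ^ 2 = ∑ i, ‖a' i‖ ^ 2 + 1 ^ 2 := Real.sq_sqrt (by positivity)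
  have hS : MeasurableSet {y : EuclideanSpace ℂ (Fin n) |
      (subspan J g).distSq y ≤ V * (subspan T g).distSq y} :=
    measurableSet_le (Submodule.measurable_distSq _) ((Submodule.measurable_distSq _).const_mul V)
  have hE' : MeasurableSet ((fun p : (ι → EuclideanSpace ℂ (Fin n)) × EuclideanSpace ℂ (Fin n) =>
      ∑ i, a' i • p.1 i + ((1 : ℝ) : ℂ) • p.2) ⁻¹' {y : EuclideanSpace ℂ (Fin n) |
      (subspan J g).distSq y ≤ V * (subspan T g).distSq y}) := by
    refine (Measurable.add ?_ ?_) hS <;> fun_prop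
  calc _ = ∫⁻ g', stdComplexGaussian (Fin n) (Prod.mk g' ⁻¹'
        ((fun p : (ι → EuclideanSpace ℂ (Fin n)) × EuclideanSpace ℂ (Fin n) =>
        ∑ i, a' i • p.1 i + ((1 : ℝ) : ℂ) • p.2) ⁻¹' {y : EuclideanSpace ℂ (Fin n) |
          (subspan J g).distSq y ≤ V * (subspan T g).distSq y}))
        ∂(Measure.pi fun _ : ι => stdComplexGaussian (Fin n)) := by
        refine lintegral_congr fun g' => ?_
        congr 1
        ext z
        simp only [Set.mem_preimage, Set.mem_ofPred_eq]
        change (subspan J (mix g')).distSq (∑ i, a i • mix g' i + z) ≤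
          V * (subspan T (mix g')).distSq (∑ i, a i • mix g' i + z) ↔ _
        rw [hJm, hTm, hsum, add_right_comm, Submodule.distSq_add_of_mem _ _ (subspan_mono hTJ g hu),
          Submodule.distSq_add_of_mem _ _ hu]
        simp
    _ = _ := (Measure.prod_apply hE').symm
    _ ≤ B := by
        rw [← Measure.map_apply (by fun_prop) hS, map_sum_smul_stdComplexGaussian a' c 1 hc2,
          Measure.map_apply (by fun_prop) hS]
        refine le_trans (measure_mono ?_) (stdComplexGaussian_distSq_ratio_le (subspan_mono hTJ g)
          hm ht ((Nat.add_le_add_right (finrank_subspan_le J g) m).trans hJ)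
          ((finrank_subspan_sub_le hTJ g).trans (by omega)) hV0 hV1)
        intro z hz
        simp only [Set.mem_preimage, Set.mem_ofPred_eq, Submodule.distSq_smul, Complex.norm_real,
          Real.norm_eq_abs, sq_abs] at hz ⊢
        rw [mul_left_comm] at hz
        exact le_of_mul_le_mul_left hz (by positivity)

/-- The span of the transmitted codewords is unlikely to be much further from the channel output
than it is without the codewords outside `T`. -/
theorem measure_ratio_le_distSq [DecidableEq ι] {T I : Finset ι} (hTI : T ⊆ I) {m t : ℕ} (hm : 0 < m)
    (hI : I.card + m = n) (hIT : I.card = T.card + t) (a : ι → ℂ)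
    (ha : ∀ i ∉ I, a i = 0) {V s : ℝ} (hV0 : 0 < V) (hV1 : V < 1) (hs0 : 0 ≤ s)
    (hs1 : s * (1 - V) < 1) :
    ((Measure.pi fun _ : ι => stdComplexGaussian (Fin n)).prod (stdComplexGaussian (Fin n)))
      {p | V * (subspan T p.1).distSq (∑ i, a i • p.1 i + p.2) ≤
        (subspan I p.1).distSq (∑ i, a i • p.1 i + p.2)} ≤
      ENNReal.ofReal (((1 - s * (1 - V))⁻¹) ^ m * ((1 + s * V)⁻¹) ^ t *
        ((1 + s * V / (1 + s * V) * ∑ i ∈ I \ T, ‖a i‖ ^ 2)⁻¹) ^ (m + t)) := by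
  have hsV : 0 ≤ s * V := by positivity
  have hY : Measurable fun p : (ι → EuclideanSpace ℂ (Fin n)) × EuclideanSpace ℂ (Fin n) =>
      ∑ i, a i • p.1 i + p.2 := by fun_prop
  have mI : Measurable fun p : (ι → EuclideanSpace ℂ (Fin n)) × EuclideanSpace ℂ (Fin n) =>
      (subspan I p.1).distSq (∑ i, a i • p.1 i + p.2) := 
    measurable_fst.distSq_subspan_family I hY
  have mT : Measurable fun p : (ι → EuclideanSpace ℂ (Fin n)) × EuclideanSpace ℂ (Fin n) =>
      (subspan T p.1).distSq (∑ i, a i • p.1 i + p.2) := 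
    measurable_fst.distSq_subspan_family T hY
  have hE : MeasurableSet {p : (ι → EuclideanSpace ℂ (Fin n)) × EuclideanSpace ℂ (Fin n) |
      V * (subspan T p.1).distSq (∑ i, a i • p.1 i + p.2) ≤
        (subspan I p.1).distSq (∑ i, a i • p.1 i + p.2)} :=
    measurableSet_le (mT.const_mul V) mI
  rw [Measure.prod_apply hE]
  set C : ℝ := ((1 - s * (1 - V))⁻¹) ^ m * ((1 + s * V)⁻¹) ^ t with hC
  have hCp : 0 < C := by
    have : 0 < 1 - s * (1 - V) := by linarith
    positivity
  set l : ℝ := s * V / (1 + s * V) with hl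
  have hl0 : 0 ≤ l := by positivity
  let F : (ι → EuclideanSpace ℂ (Fin n)) → ℝ≥0∞ := fun g =>
    ENNReal.ofReal (C * Real.exp (-l * (subspan T g).distSq (∑ i, a i • g i)))
  have hF : Measurable F := by
    have : Measurable fun g : ι → EuclideanSpace ℂ (Fin n) =>
        (subspan T g).distSq (∑ i, a i • g i) :=
      (measurable_distSq_subspan T).comp (f := fun g : ι → EuclideanSpace ℂ (Fin n) =>
        (g, ∑ i, a i • g i)) (by fun_prop)
    fun_prop
  -- Average over the noise for a fixed codebook. The exact rank matters, since the factor `(1 - s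
  -- (1 - V))⁻¹` is at least 1.
  have step1 : ∀ᵐ g ∂(Measure.pi fun _ : ι => stdComplexGaussian (Fin n)),
      stdComplexGaussian (Fin n) (Prod.mk g ⁻¹' {p | V * (subspan T p.1).distSq
        (∑ i, a i • p.1 i + p.2) ≤ (subspan I p.1).distSq (∑ i, a i • p.1 i + p.2)}) ≤ F g := by
    filter_upwards [ae_linearIndepOn (n := n) I (by omega)] with g hg
    have hIr := finrank_subspan_eq hg
    have hTr := finrank_subspan_eq (hg.mono (by exact_mod_cast hTI : (T : Set ι) ⊆ I))
    have hu : ∑ i, a i • g i ∈ subspan I g := (mem_subspan_iff _ _).2 ⟨a, by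
      refine Finset.sum_subset (Finset.subset_univ _) fun i _ hi => by simp [ha i hi]⟩
    have key := integral_exp_distSq (subspan_mono hTI g) hu (s * V) (-(s * (1 - V)))
      (by linarith) (by linarith)
    rw [hIr, hTr, show n - I.card = m by omega, show I.card - T.card = t by omega,
      ← sub_eq_add_neg, ← hC] at key
    have key2 := measure_nonneg_le_of_integral_exp (by positivity) key
    refine (measure_mono ?_).trans (key2.trans_eq ?_)
    · intro z hz
      simp only [Set.mem_preimage, Set.mem_ofPred_eq] at hz ⊢
      rw [add_comm z]
      have := mul_nonneg hs0 (sub_nonneg.2 hz)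
      linarith
    · simp only [F]
      congr 4
      rw [hl]; ring
  refine (lintegral_mono_ae step1).trans ?_
  -- Then average over the codewords outside `T`. Given those in `T`, the rest of the signal is
  -- isotropic with variance `S2`, and its distance to the span of `T` has at least `m + t` complex
  -- degrees of freedom.
  rw [lintegral_pi_mix _ (fun i => i ∈ T) hF]
  refine le_trans (lintegral_mono (g := fun _ => ENNReal.ofReal (C *
    ((1 + l * ∑ i ∈ I \ T, ‖a i‖ ^ 2)⁻¹) ^ (m + t))) fun g => ?_) (by simp)
  set u : EuclideanSpace ℂ (Fin n) := ∑ i ∈ T, a i • g i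
  have hu : u ∈ subspan T g := (mem_subspan_iff _ _).2 ⟨a, rfl⟩
  let a' : ι → ℂ := fun i => if i ∈ T then 0 else a i
  have hsum : ∀ g' : ι → EuclideanSpace ℂ (Fin n), ∑ i, a i • (if i ∈ T then g i else g' i) =
      ∑ i, a' i • g' i + u := by
    intro g'
    rw [show u = ∑ i, if i ∈ T then a i • g i else 0 by simp [u], ← Finset.sum_add_distrib]
    refine Finset.sum_congr rfl fun i _ => ?_
    by_cases h2 : i ∈ T <;> simp [a', h2]
  have hTm : ∀ g' : ι → EuclideanSpace ℂ (Fin n),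
      subspan T (fun i => if i ∈ T then g i else g' i) = subspan T g := fun g' =>
    subspan_congr fun i hi => by simp [hi]
  simp only [F, hTm, hsum, Submodule.distSq_add_of_mem _ _ hu]
  set S2 := ∑ i ∈ I \ T, ‖a i‖ ^ 2 with hS2
  have hS20 : 0 ≤ S2 := by positivity
  have ha2 : ∑ i, ‖a' i‖ ^ 2 = S2 := by
    rw [hS2, ← Finset.sum_subset (Finset.subset_univ (I \ T))]
    · refine Finset.sum_congr rfl fun i hi => ?_
      simp [a', (Finset.mem_sdiff.1 hi).2]
    · intro i _ hi
      by_cases h2 : i ∈ T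
      · simp [a', h2]
      · have : i ∉ I := fun h => hi (Finset.mem_sdiff.2 ⟨h, h2⟩)
        simp [a', h2, ha i this]
  set c : ℝ := √S2
  have hc2 : c ^ 2 = S2 := Real.sq_sqrt hS20
  have hG : Measurable fun y : EuclideanSpace ℂ (Fin n) =>
      ENNReal.ofReal (C * Real.exp (-l * (subspan T g).distSq y)) := by
    have := Submodule.measurable_distSq (subspan T g)
    fun_prop
  rw [← lintegral_map (f := fun y => ENNReal.ofReal (C * Real.exp (-l * (subspan T g).distSq y)))
    (g := fun g' : ι → EuclideanSpace ℂ (Fin n) => ∑ i, a' i • g' i) hG (by fun_prop),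
    map_sum_smul_pi_stdComplexGaussian a' c (hc2.trans ha2.symm), lintegral_map hG (by fun_prop)]
  simp only [Submodule.distSq_smul, Complex.norm_real, Real.norm_eq_abs, sq_abs, hc2]
  have key := integral_exp_distSq (le_top : subspan T g ≤ ⊤) (Submodule.zero_mem _) (l * S2) 0
    (by nlinarith [mul_nonneg hl0 hS20]) (by norm_num)
  have htop : ∀ z : EuclideanSpace ℂ (Fin n),
      (⊤ : Submodule ℂ (EuclideanSpace ℂ (Fin n))).distSq z = 0 := fun z =>
    (Submodule.distSq_eq_zero_iff _ _).2 Submodule.mem_top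
  have hz : (subspan T g).distSq 0 = 0 := (Submodule.distSq_eq_zero_iff _ _).2 (Submodule.zero_mem _)
  simp only [add_zero, htop, sub_zero, mul_zero, zero_sub, hz, zero_div, Real.exp_zero, mul_one,
    inv_one, one_pow, one_mul, finrank_top, finrank_euclideanSpace, Fintype.card_fin] at key
  have hls : 0 ≤ l * S2 := mul_nonneg hl0 hS20
  have key2 := lintegral_exp_eq_of_integral_exp (by positivity) key
  simp_rw [ENNReal.ofReal_mul hCp.le]
  rw [lintegral_const_mul' _ _ ENNReal.ofReal_ne_top]
  gcongr
  calc _ = _ := lintegral_congr fun z => by congr 2; ring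
    _ = _ := key2
    _ ≤ _ := ENNReal.ofReal_le_ofReal (pow_le_pow_of_le_one (by positivity)
        (inv_le_one_of_one_le₀ (by linarith)) (by have := finrank_subspan_le T g; omega))

end

/-! ### Measurable minimization, error probability and derandomization -/

/-- Among the minimizers the one with the smallest code number is taken, which makes the choice
measurable. -/
theorem exists_measurable_argmin {α C : Type*} [MeasurableSpace α] [Finite C] [Nonempty C]
    (f : C → α → ℝ) (hf : ∀ c, Measurable (f c)) :
    ∃ d : α → C, (∀ x c, f (d x) x ≤ f c x) ∧ ∀ c, MeasurableSet {x | d x = c} := by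
  classical
  obtain ⟨_⟩ := nonempty_fintype C
  have : Encodable C := Fintype.toEncodable C
  let p : α → ℕ → Prop := fun x N => ∃ c, Encodable.encode c = N ∧ ∀ c', f c x ≤ f c' x
  have hp : ∀ x, ∃ N, p x N := by
    intro x
    obtain ⟨c, hc⟩ := Finite.exists_min fun c => f c x
    exact ⟨_, c, rfl, hc⟩
  have hpm : ∀ N, MeasurableSet {x | p x N} := by
    intro N
    simp only [p]
    have : {x | ∃ c, Encodable.encode c = N ∧ ∀ c', f c x ≤ f c' x} =
        ⋃ c, ⋂ c', {x | Encodable.encode c = N ∧ f c x ≤ f c' x} := by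
      ext x
      simp only [Set.mem_ofPred_eq, Set.mem_iUnion, Set.mem_iInter, forall_and, forall_const]
    rw [this]
    refine MeasurableSet.iUnion fun c => MeasurableSet.iInter fun c' => ?_
    exact (MeasurableSet.const _).inter (measurableSet_le (hf c) (hf c'))
  have hfind := measurable_find hp hpm
  refine ⟨fun x => Classical.choose (Nat.find_spec (hp x)),
    fun x => (Classical.choose_spec (Nat.find_spec (hp x))).2, fun c => ?_⟩
  have : {x | Classical.choose (Nat.find_spec (hp x)) = c} =
      (fun x => Nat.find (hp x)) ⁻¹' {Encodable.encode c} := by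
    ext x
    have h1 := (Classical.choose_spec (Nat.find_spec (hp x))).1
    simp only [Set.mem_ofPred_eq, Set.mem_preimage, Set.mem_singleton_iff]
    exact ⟨fun h => by rw [← h]; exact h1.symm,
      fun h => Encodable.encode_injective (h1.trans h)⟩
  rw [this]
  exact hfind (measurableSet_singleton _)

namespace RandomAccessCode

variable {n M K Ka : ℕ} {P : ℝ}

/-- The law of the seed, the fading coefficients and the noise. -/
noncomputable def jointLaw (c : RandomAccessCode n M K Ka P) :
    Measure (c.Seed × (Fin K → ℂ) × (Fin n → ℂ)) :=
  c.law.prod ((Measure.pi fun _ : Fin K => complexGaussian).prod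
    (Measure.pi fun _ : Fin n => complexGaussian))

instance (c : RandomAccessCode n M K Ka P) : IsProbabilityMeasure c.jointLaw := by
  unfold jointLaw; infer_instance

/-- The number of active users whose message is not decoded correctly. -/
noncomputable def errorCount (c : RandomAccessCode n M K Ka P) (A : Finset (Fin K))
    (w : Fin K → Fin M) (ω : c.Seed × (Fin K → ℂ) × (Fin n → ℂ)) : ℕ :=
  (A.filter fun j => c.dec ω.1 (c.output A w ω.1 ω.2.1 ω.2.2) j ≠ some (w j)).card

theorem pupe_eq (c : RandomAccessCode n M K Ka P) (A : Finset (Fin K)) :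
    c.pupe A = 𝔼 w : Fin K → Fin M,
      ∫ ω, (1 / (Ka : ℝ)) * (c.errorCount A w ω : ℝ) ∂c.jointLaw := rfl

theorem measurable_output (c : RandomAccessCode n M K Ka P) (A : Finset (Fin K))
    (w : Fin K → Fin M) : Measurable fun ω : c.Seed × (Fin K → ℂ) × (Fin n → ℂ) =>
      c.output A w ω.1 ω.2.1 ω.2.2 := by
  refine measurable_pi_lambda _ fun i => ?_
  unfold output
  have : ∀ j, Measurable fun ω : c.Seed × (Fin K → ℂ) × (Fin n → ℂ) => c.enc ω.1 j (w j) i :=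
    fun j => (c.enc_meas j (w j) i).comp measurable_fst
  refine Measurable.add (Finset.measurable_sum _ fun j _ => Measurable.mul ?_ (this j)) ?_ <;>
    fun_prop

theorem measurable_errorCount (c : RandomAccessCode n M K Ka P) (A : Finset (Fin K))
    (w : Fin K → Fin M) : Measurable (c.errorCount A w) := by
  have : c.errorCount A w = fun ω => ∑ j ∈ A,
      if c.dec ω.1 (c.output A w ω.1 ω.2.1 ω.2.2) j = some (w j) then 0 else 1 := by
    ext ω
    rw [errorCount, Finset.card_filter]
    refine Finset.sum_congr rfl fun j _ => ?_
    split_ifs <;> simp_all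
  rw [this]
  refine Finset.measurable_sum _ fun j _ => Measurable.ite ?_ measurable_const measurable_const
  exact (measurable_fst.prodMk (c.measurable_output A w)) (c.dec_meas j (some (w j)))

theorem errorCount_le (c : RandomAccessCode n M K Ka P) (A : Finset (Fin K)) (w : Fin K → Fin M)
    (ω : c.Seed × (Fin K → ℂ) × (Fin n → ℂ)) : c.errorCount A w ω ≤ A.card :=
  Finset.card_filter_le _ _

theorem integrable_errorCount (c : RandomAccessCode n M K Ka P) (A : Finset (Fin K))
    (w : Fin K → Fin M) :
    Integrable (fun ω => (1 / (Ka : ℝ)) * (c.errorCount A w ω : ℝ)) c.jointLaw := by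
  refine Integrable.const_mul ?_ _
  refine Integrable.of_bound (C := (A.card : ℝ))
    (measurable_from_top.comp (c.measurable_errorCount A w)).aestronglyMeasurable
    (ae_of_all _ fun ω => ?_)
  simpa using c.errorCount_le A w ω

/-- The fraction of wrong users is below `ε'` off the event and at most 1 on it. -/
theorem pupe_le (c : RandomAccessCode n M K Ka P) {A : Finset (Fin K)} (hA : A.card = Ka)
    (hM : 0 < M) {ε' δ : ℝ} (hε : 0 ≤ ε') (hδ : 0 ≤ δ)
    (h : ∀ w, c.jointLaw {ω | ε' * Ka ≤ c.errorCount A w ω} ≤ ENNReal.ofReal δ) :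
    c.pupe A ≤ ε' + δ := by
  have : Nonempty (Fin K → Fin M) := ⟨fun _ => ⟨0, hM⟩⟩
  rw [pupe_eq]
  refine Finset.expect_le Finset.univ_nonempty fun w _ => ?_
  have hS : MeasurableSet {ω | ε' * Ka ≤ c.errorCount A w ω} :=
    measurableSet_le measurable_const (measurable_from_top.comp (c.measurable_errorCount A w))
  calc ∫ ω, (1 / (Ka : ℝ)) * (c.errorCount A w ω : ℝ) ∂c.jointLaw
      ≤ ∫ ω, (ε' + {ω | ε' * Ka ≤ c.errorCount A w ω}.indicator (fun _ => (1 : ℝ)) ω)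
          ∂c.jointLaw := by
        refine integral_mono (c.integrable_errorCount A w)
          ((integrable_const _).add ((integrable_const _).indicator hS)) fun ω => ?_
        have h1 : (c.errorCount A w ω : ℝ) ≤ Ka := by
          exact_mod_cast hA ▸ c.errorCount_le A w ω
        have h0 : (0 : ℝ) ≤ c.errorCount A w ω := Nat.cast_nonneg _
        rcases Nat.eq_zero_or_pos Ka with hK | hK
        · simp [hK]
          linarith
        · have hK' : (0 : ℝ) < Ka := by exact_mod_cast hK
          change 1 / (Ka : ℝ) * _ ≤ ε' + _
          rw [one_div, inv_mul_le_iff₀ hK']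
          by_cases hω : ω ∈ {ω | ε' * Ka ≤ c.errorCount A w ω}
          · rw [Set.indicator_of_mem hω]
            nlinarith
          · rw [Set.indicator_of_notMem hω]
            have : (c.errorCount A w ω : ℝ) < ε' * Ka := not_le.1 hω
            nlinarith
    _ = ε' + c.jointLaw.real {ω | ε' * Ka ≤ c.errorCount A w ω} := by
        rw [integral_add (integrable_const _) ((integrable_const _).indicator hS)]
        simp [integral_indicator hS]
    _ ≤ ε' + δ := by
        gcongr
        exact ENNReal.toReal_le_of_le_ofReal hδ (h w)

theorem pupe_le_one (c : RandomAccessCode n M K Ka P) {A : Finset (Fin K)} (hA : A.card = Ka)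
    (hM : 0 < M) : c.pupe A ≤ 1 := by
  have : Nonempty (Fin K → Fin M) := ⟨fun _ => ⟨0, hM⟩⟩
  rw [pupe_eq]
  refine Finset.expect_le Finset.univ_nonempty fun w _ => ?_
  calc ∫ ω, (1 / (Ka : ℝ)) * (c.errorCount A w ω : ℝ) ∂c.jointLaw ≤ ∫ ω, (1 : ℝ) ∂c.jointLaw := by
        refine integral_mono (c.integrable_errorCount A w) (integrable_const _) fun ω => ?_
        have h1 : (c.errorCount A w ω : ℝ) ≤ Ka := by
          exact_mod_cast hA ▸ c.errorCount_le A w ω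
        change 1 / (Ka : ℝ) * _ ≤ 1
        rw [one_div, ← div_eq_inv_mul]
        exact div_le_one_of_le₀ h1 (Nat.cast_nonneg _)
    _ = 1 := by simp

/-- The code obtained by fixing the seed. -/
noncomputable def fixSeed (c : RandomAccessCode n M K Ka P) (s : c.Seed) :
    RandomAccessCode n M K Ka P where
  Seed := Unit
  law := Measure.dirac ()
  enc _ := c.enc s
  dec _ := c.dec s
  enc_meas _ _ _ := measurable_const
  dec_meas j v := by
    have : Measurable fun p : Unit × (Fin n → ℂ) => (s, p.2) := by fun_prop
    exact this (c.dec_meas j v)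
  power _ := c.power s
  card_dec _ := c.card_dec s

theorem pupe_fixSeed (c : RandomAccessCode n M K Ka P) (s : c.Seed) (A : Finset (Fin K)) :
    (c.fixSeed s).pupe A = 𝔼 w : Fin K → Fin M,
      ∫ x : (Fin K → ℂ) × (Fin n → ℂ), (1 / (Ka : ℝ)) * (c.errorCount A w (s, x) : ℝ)
        ∂((Measure.pi fun _ : Fin K => complexGaussian).prod
          (Measure.pi fun _ : Fin n => complexGaussian)) := by
  rw [pupe_eq]
  refine Finset.expect_congr rfl fun w _ => ?_
  have h := (c.fixSeed s).integrable_errorCount A w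
  rw [jointLaw] at h ⊢
  rw [integral_prod _ h]
  change ∫ _, _ ∂(Measure.dirac ()) = _
  rw [integral_dirac]
  rfl

/-- By Fubini the error is an average over seeds, and some seed does no worse than the average. One
seed serves the average over `𝒜`, not each of its members. -/
theorem exists_fixSeed (c : RandomAccessCode n M K Ka P) (𝒜 : Finset (Finset (Fin K))) {ε : ℝ}
    (h : 𝔼 A ∈ 𝒜, c.pupe A ≤ ε) : ∃ s, 𝔼 A ∈ 𝒜, (c.fixSeed s).pupe A ≤ ε := by
  let G : c.Seed → ℝ := fun s => 𝔼 A ∈ 𝒜, (c.fixSeed s).pupe A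
  have hint : ∀ A w, Integrable (fun s => ∫ x : (Fin K → ℂ) × (Fin n → ℂ),
      (1 / (Ka : ℝ)) * (c.errorCount A w (s, x) : ℝ)
        ∂((Measure.pi fun _ : Fin K => complexGaussian).prod
          (Measure.pi fun _ : Fin n => complexGaussian))) c.law := fun A w =>
    (c.integrable_errorCount A w).integral_prod_left
  have hGi : Integrable G c.law := by
    simp only [G, pupe_fixSeed, Finset.expect_eq_sum_div_card]
    exact (integrable_finsetSum _ fun A _ =>
      (integrable_finsetSum _ fun w _ => hint A w).div_const _).div_const _
  have hG : ∫ s, G s ∂c.law = 𝔼 A ∈ 𝒜, c.pupe A := by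
    simp only [G, pupe_fixSeed, Finset.expect_eq_sum_div_card]
    simp only [pupe_eq, Finset.expect_eq_sum_div_card]
    rw [integral_div, integral_finsetSum _ fun A _ =>
      (integrable_finsetSum _ fun w _ => hint A w).div_const _]
    congr 1
    refine Finset.sum_congr rfl fun A _ => ?_
    rw [integral_div, integral_finsetSum _ fun w _ => hint A w]
    congr 1
    refine Finset.sum_congr rfl fun w _ => ?_
    exact (integral_prod _ (c.integrable_errorCount A w)).symm
  obtain ⟨s, hs⟩ := exists_le_integral hGi
  exact ⟨s, hs.trans (hG.le.trans h)⟩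

end RandomAccessCode

theorem HasCode.hasDetCode {n k K Ka : ℕ} (hK : Ka ≤ K) {ε e : ℝ} (h : HasCode n k K Ka ε e) :
    HasDetCode n k K Ka ε e := by
  obtain ⟨c, hc⟩ := h
  have hne : ((Finset.univ : Finset (Fin K)).powersetCard Ka).Nonempty :=
    Finset.powersetCard_nonempty.2 (by simpa using hK)
  obtain ⟨s, hs⟩ := c.exists_fixSeed ((Finset.univ : Finset (Fin K)).powersetCard Ka) (ε := ε)
    (Finset.expect_le hne fun A hA => hc A (Finset.mem_powersetCard.1 hA).2)
  exact ⟨c.fixSeed s, inferInstanceAs (Subsingleton Unit), hs⟩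

theorem stdComplexGaussian_norm_sq_ge {n : ℕ} {l r : ℝ} (hl : 0 ≤ l) (hl1 : l < 1) :
    stdComplexGaussian (Fin n) {z | r ≤ ‖z‖ ^ 2} ≤
      ENNReal.ofReal (((1 - l)⁻¹) ^ n * Real.exp (-l * r)) := by
  have key := integral_exp_distSq (n := n) (le_refl ⊥) (Submodule.zero_mem ⊥) 0 (-l)
    (by norm_num) (by linarith)
  have hb : ∀ z : EuclideanSpace ℂ (Fin n),
      (⊥ : Submodule ℂ (EuclideanSpace ℂ (Fin n))).distSq z = ‖z‖ ^ 2 := by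
    intro z
    obtain ⟨u, hu, h⟩ := (⊥ : Submodule ℂ (EuclideanSpace ℂ (Fin n))).exists_distSq_eq z
    rw [h, (Submodule.mem_bot ℂ).1 hu, sub_zero]
  simp only [add_zero, hb, neg_neg, zero_mul, sub_zero, finrank_bot, sub_self,
    mul_one, neg_zero, zero_div, Real.exp_zero, ← sub_eq_add_neg] at key
  have key2 : ∫ z, Real.exp (l * ‖z‖ ^ 2 - l * r) ∂(stdComplexGaussian (Fin n)) =
      ((1 - l)⁻¹) ^ n * Real.exp (-l * r) := by
    simp_rw [sub_eq_add_neg (l * _), Real.exp_add]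
    rw [integral_mul_const, key]
    simp
  have h1 : 0 < 1 - l := by linarith
  refine (measure_mono ?_).trans (measure_nonneg_le_of_integral_exp (by positivity) key2)
  intro z hz
  simp only [Set.mem_ofPred_eq] at hz ⊢
  nlinarith

/-! ### Truncated Gaussian codebooks and the projection decoder -/

section
variable {n M K Ka : ℕ}

/-- The Gaussian codeword with variance `P'`, replaced by `0` when it violates the power
constraint `P`. -/
noncomputable def truncatedCodeword (P P' : ℝ)
    (s : Fin K × Fin M → EuclideanSpace ℂ (Fin n)) (i : Fin K × Fin M) :
    EuclideanSpace ℂ (Fin n) :=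
  if P' * ‖s i‖ ^ 2 ≤ n * P then ((√P' : ℝ) : ℂ) • s i else 0

theorem measurable_truncatedCodeword (P P' : ℝ) :
    Measurable (truncatedCodeword P P' (n := n) (K := K) (M := M)) := by
  refine measurable_pi_lambda _ fun i => ?_
  exact Measurable.ite (measurableSet_le (by fun_prop) measurable_const) (by fun_prop)
    measurable_const

/-- The codewords selected by a list of decisions. -/
def decisionIndex (D : Fin K → Option (Fin M)) : Finset (Fin K × Fin M) :=
  Finset.univ.filter fun i => D i.1 = some i.2

theorem mem_decisionIndex {D : Fin K → Option (Fin M)} {i : Fin K × Fin M} :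
    i ∈ decisionIndex D ↔ D i.1 = some i.2 := by simp [decisionIndex]

theorem card_decisionIndex (D : Fin K → Option (Fin M)) :
    (decisionIndex D).card = (Finset.univ.filter fun j => (D j).isSome).card := by
  refine Finset.card_bij (fun i _ => i.1) ?_ ?_ ?_
  · intro i hi
    simp [mem_decisionIndex.1 hi]
  · rintro ⟨i, a⟩ hi ⟨j, b⟩ hj (rfl : i = j)
    have h1 := mem_decisionIndex.1 hi
    have h2 := mem_decisionIndex.1 hj
    simp_all
  · intro j hj
    obtain ⟨v, hv⟩ := Option.isSome_iff_exists.1 (Finset.mem_filter.1 hj).2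
    exact ⟨(j, v), mem_decisionIndex.2 hv, rfl⟩

/-- The possible outputs of the decoder. -/
abbrev DecisionList (K M Ka : ℕ) : Type :=
  {D : Fin K → Option (Fin M) // (Finset.univ.filter fun j => (D j).isSome).card = Ka}

/-- The decisions that report the messages `w` of the users in `S`. -/
def trueDecision (S : Finset (Fin K)) (w : Fin K → Fin M) : Fin K → Option (Fin M) :=
  fun j => if j ∈ S then some (w j) else none

theorem mem_decisionIndex_trueDecision {S : Finset (Fin K)} {w : Fin K → Fin M}
    {i : Fin K × Fin M} : i ∈ decisionIndex (trueDecision S w) ↔ i.1 ∈ S ∧ i.2 = w i.1 := by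
  rw [mem_decisionIndex, trueDecision]
  split_ifs with h <;> simp [h, eq_comm]

theorem card_trueDecision (S : Finset (Fin K)) (w : Fin K → Fin M) :
    (Finset.univ.filter fun j => (trueDecision S w j).isSome).card = S.card := by
  congr 1
  ext j
  by_cases h : j ∈ S <;> simp [trueDecision, h]

theorem nonempty_decisionList (hK : Ka ≤ K) (hM : 0 < M) : Nonempty (DecisionList K M Ka) := by
  obtain ⟨S, hS⟩ := Finset.exists_subset_card_eq (s := (Finset.univ : Finset (Fin K)))
    (by simpa using hK)
  exact ⟨⟨trueDecision S fun _ => ⟨0, hM⟩, (card_trueDecision _ _).trans hS.2⟩⟩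

/-- Truncated Gaussian codebooks with the decoder `d`. -/
noncomputable def gaussianCode {P P' : ℝ} (hP : 0 ≤ P) (hP' : 0 ≤ P')
    (d : (Fin K × Fin M → EuclideanSpace ℂ (Fin n)) × (Fin n → ℂ) → DecisionList K M Ka)
    (hd : ∀ D, MeasurableSet {p | d p = D}) : RandomAccessCode n M K Ka P where
  Seed := Fin K × Fin M → EuclideanSpace ℂ (Fin n)
  law := Measure.pi fun _ => stdComplexGaussian (Fin n)
  enc s j m i := truncatedCodeword P P' s (j, m) i
  dec s y := (d (s, y)).1
  enc_meas j m i :=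
    (by fun_prop : Measurable fun z : EuclideanSpace ℂ (Fin n) => z i).comp
      ((measurable_pi_apply (j, m)).comp (measurable_truncatedCodeword P P'))
  dec_meas j v := by
    have : {p | (d p).1 j = v} = ⋃ D ∈ {D : DecisionList K M Ka | D.1 j = v}, {p | d p = D} := by
      ext p; simp
    change MeasurableSet {p | (d p).1 j = v}
    rw [this]
    exact MeasurableSet.biUnion (Set.to_countable _) fun D _ => hd D
  power s j m := by
    rw [← EuclideanSpace.norm_sq_eq, truncatedCodeword]
    split_ifs with h
    · rw [norm_smul, mul_pow, Complex.norm_real, Real.norm_eq_abs, sq_abs, Real.sq_sqrt hP']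
      exact h
    · simp only [norm_zero, ne_eq, OfNat.ofNat_ne_zero, not_false_eq_true, zero_pow]
      positivity
  card_dec s y := (d (s, y)).2

/-- Minimizing the distance to a span amounts to fitting the fading coefficients by least squares,
so no channel knowledge is used. -/
theorem exists_projection_decoder (hK : Ka ≤ K) (hM : 0 < M) (P P' : ℝ) :
    ∃ d : (Fin K × Fin M → EuclideanSpace ℂ (Fin n)) × (Fin n → ℂ) → DecisionList K M Ka,
      (∀ D, MeasurableSet {p | d p = D}) ∧ ∀ s y (D : DecisionList K M Ka),
        (subspan (decisionIndex (d (s, y)).1) (truncatedCodeword P P' s)).distSq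
          (WithLp.toLp 2 y) ≤
        (subspan (decisionIndex D.1) (truncatedCodeword P P' s)).distSq (WithLp.toLp 2 y) := by
  have := nonempty_decisionList hK hM
  obtain ⟨d, hd1, hd2⟩ := exists_measurable_argmin
    (α := (Fin K × Fin M → EuclideanSpace ℂ (Fin n)) × (Fin n → ℂ)) (C := DecisionList K M Ka)
    (fun D p => (subspan (decisionIndex D.1) (truncatedCodeword P P' p.1)).distSq
      (WithLp.toLp 2 p.2)) (fun D => Measurable.distSq_subspan_family _
        ((measurable_truncatedCodeword P P').comp measurable_fst) (by fun_prop))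
  exact ⟨d, hd2, fun s y D => hd1 (s, y) D⟩

end

/-- Tonelli puts the fading outermost: typical fading is held fixed while codebook and noise are
averaged. This lets the Chernoff parameters depend on the fading. -/
theorem RandomAccessCode.jointLaw_le {n M K Ka : ℕ} {P : ℝ} (c : RandomAccessCode n M K Ka P)
    {E : Set (c.Seed × (Fin K → ℂ) × (Fin n → ℂ))} (hE : MeasurableSet E) {Tr : Set c.Seed}
    (hTr : MeasurableSet Tr) {Typ : Set (Fin K → ℂ)} (hTyp : MeasurableSet Typ) {b : ℝ≥0∞}
    (h : ∀ x ∈ Typ, (c.law.prod (Measure.pi fun _ : Fin n => complexGaussian))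
      {p | p.1 ∉ Tr ∧ (p.1, x, p.2) ∈ E} ≤ b) :
    c.jointLaw E ≤ c.law Tr + (Measure.pi fun _ : Fin K => complexGaussian) Typᶜ + b := by
  set μh := Measure.pi fun _ : Fin K => complexGaussian
  set μz := Measure.pi fun _ : Fin n => complexGaussian
  set R : Set (c.Seed × (Fin K → ℂ) × (Fin n → ℂ)) :=
    E ∩ ((fun ω => ω.1) ⁻¹' Trᶜ ∩ (fun ω => ω.2.1) ⁻¹' Typ) with hR
  have hm1 : Measurable fun ω : c.Seed × (Fin K → ℂ) × (Fin n → ℂ) => ω.1 := measurable_fst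
  have hm2 : Measurable fun ω : c.Seed × (Fin K → ℂ) × (Fin n → ℂ) => ω.2.1 := by fun_prop
  have hRm : MeasurableSet R := hE.inter ((hm1 hTr.compl).inter (hm2 hTyp))
  have hsub : E ⊆ ((fun ω => ω.1) ⁻¹' Tr ∪ (fun ω => ω.2.1) ⁻¹' Typᶜ) ∪ R := by
    intro ω hω
    by_cases h1 : ω.1 ∈ Tr
    · exact Or.inl (Or.inl h1)
    · by_cases h2 : ω.2.1 ∈ Typ
      · exact Or.inr ⟨hω, h1, h2⟩
      · exact Or.inl (Or.inr h2)
  refine (measure_mono hsub).trans ((measure_union_le _ _).trans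
    (add_le_add ((measure_union_le _ _).trans (add_le_add ?_ ?_)) ?_))
  · exact ((measurePreserving_fst (μ := c.law) (ν := μh.prod μz)).measure_preimage
      hTr.nullMeasurableSet).le
  · have := ((measurePreserving_fst (μ := μh) (ν := μz)).comp
      (measurePreserving_snd (μ := c.law) (ν := μh.prod μz))).measure_preimage
      hTyp.compl.nullMeasurableSet
    exact this.le
  · have hR' : MeasurableSet {q : (c.Seed × (Fin K → ℂ)) × (Fin n → ℂ) |
        (q.1.1, q.1.2, q.2) ∈ R} :=
      (by fun_prop : Measurable fun q : (c.Seed × (Fin K → ℂ)) × (Fin n → ℂ) =>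
        (q.1.1, q.1.2, q.2)) hRm
    have hf : Measurable fun q : c.Seed × (Fin K → ℂ) => μz {z | (q.1, q.2, z) ∈ R} :=
      measurable_measure_prodMk_left hR'
    calc c.jointLaw R = ∫⁻ s, ∫⁻ x, μz {z | (s, x, z) ∈ R} ∂μh ∂c.law := by
          rw [jointLaw, Measure.prod_apply hRm]
          refine lintegral_congr fun s => ?_
          rw [Measure.prod_apply (measurable_prodMk_left hRm)]
          rfl
      _ = ∫⁻ x, ∫⁻ s, μz {z | (s, x, z) ∈ R} ∂c.law ∂μh :=
          lintegral_lintegral_swap hf.aemeasurable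
      _ ≤ ∫⁻ _, b ∂μh := by
          refine lintegral_mono fun x => ?_
          by_cases hx : x ∈ Typ
          · refine le_trans (le_of_eq ?_) (h x hx)
            have hS : MeasurableSet {p : c.Seed × (Fin n → ℂ) | p.1 ∉ Tr ∧ (p.1, x, p.2) ∈ E} :=
              ((measurable_fst hTr.compl).inter
                ((by fun_prop : Measurable fun p : c.Seed × (Fin n → ℂ) => (p.1, x, p.2)) hE))
            rw [Measure.prod_apply hS]
            refine lintegral_congr fun s => ?_
            congr 1
            ext z
            simp only [hR, Set.mem_inter_iff, Set.mem_preimage, Set.mem_compl_iff, hx,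
              Set.mem_ofPred_eq]
            tauto
          · have : ∀ s, {z | (s, x, z) ∈ R} = ∅ := by
              intro s
              ext z
              simp only [hR, Set.mem_inter_iff, Set.mem_preimage, hx, Set.mem_ofPred_eq]
              simp
            simp [this]
      _ = b := by simp

/-! ### Union bound over missed users and decoded lists -/

section
variable {n M K Ka : ℕ}

/-- A list that errs exactly on `S` declares `S.card` further users outside `A \ S`, each with some
message. The other decisions are forced. -/
theorem card_decisionList_le (hM : 0 < M) {A S : Finset (Fin K)} (hA : A.card = Ka) (hS : S ⊆ A)
    (w : Fin K → Fin M) :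
    (Finset.univ.filter fun D : DecisionList K M Ka =>
      ∀ j ∈ A, (D.1 j = some (w j) ↔ j ∉ S)).card ≤
      M ^ S.card * (K - Ka + S.card).choose S.card := by
  have hAK : A.card ≤ K := by simpa using A.card_le_univ
  have hSA := Finset.card_le_card hS
  have hcard : ((A \ S)ᶜ).card = K - Ka + S.card := by
    rw [Finset.card_compl, Finset.card_sdiff_of_subset hS, Fintype.card_fin]
    omega
  rw [← hcard, ← Finset.card_powersetCard]
  refine Finset.card_le_mul_card_image_of_maps_to
    (f := fun D : DecisionList K M Ka => (Finset.univ.filter fun j => (D.1 j).isSome) \ (A \ S))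
    ?_ _ ?_
  · intro D hD
    have hD' := (Finset.mem_filter.1 hD).2
    refine Finset.mem_powersetCard.2 ⟨fun j hj => ?_, ?_⟩
    · exact Finset.mem_compl.2 (Finset.mem_sdiff.1 hj).2
    · rw [Finset.card_sdiff_of_subset, D.2, Finset.card_sdiff_of_subset hS]
      · omega
      · intro j hj
        have := (hD' j (Finset.mem_sdiff.1 hj).1).2 (Finset.mem_sdiff.1 hj).2
        simp [this]
  · intro S2 hS2
    have h2 : M ^ S.card = (Finset.univ : Finset (S2 → Fin M)).card := by
      simp [(Finset.mem_powersetCard.1 hS2).2]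
    rw [h2]
    -- The default value is never reached: every user in `S2` is declared active by the lists in
    -- this fibre.
    refine Finset.card_le_card_of_injOn (fun D (j : S2) => (D.1 j).getD ⟨0, hM⟩)
      (fun _ _ => Finset.mem_univ _) ?_
    intro D hD D' hD' hDD
    simp only [Finset.coe_filter, Finset.mem_filter, Finset.mem_univ, true_and,
      Set.mem_ofPred_eq] at hD hD'
    refine Subtype.ext (funext fun j => ?_)
    by_cases hj : j ∈ A \ S
    · rw [(hD.1 j (Finset.mem_sdiff.1 hj).1).2 (Finset.mem_sdiff.1 hj).2,
        (hD'.1 j (Finset.mem_sdiff.1 hj).1).2 (Finset.mem_sdiff.1 hj).2]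
    · by_cases hj2 : j ∈ S2
      · have e1 : (D.1 j).isSome := by
          have := hD.2 ▸ hj2
          simpa [hj] using this
        have e2 : (D'.1 j).isSome := by
          have := hD'.2 ▸ hj2
          simpa [hj] using this
        obtain ⟨v, hv⟩ := Option.isSome_iff_exists.1 e1
        obtain ⟨v', hv'⟩ := Option.isSome_iff_exists.1 e2
        have := congrFun hDD ⟨j, hj2⟩
        simp only [hv, hv', Option.getD_some] at this
        rw [hv, hv', this]
      · have e1 : ¬ (D.1 j).isSome := fun h => hj2 (hD.2 ▸ by simp [h, hj])
        have e2 : ¬ (D'.1 j).isSome := fun h => hj2 (hD'.2 ▸ by simp [h, hj])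
        rw [Option.not_isSome_iff_eq_none.1 e1, Option.not_isSome_iff_eq_none.1 e2]

theorem subspan_smul {ι : Type*} (J : Finset ι) {c : ℂ} (hc : c ≠ 0)
    (g : ι → EuclideanSpace ℂ (Fin n)) : subspan J (fun i => c • g i) = subspan J g := by
  unfold subspan
  refine le_antisymm (Submodule.span_le.2 ?_) (Submodule.span_le.2 ?_)
  · rintro _ ⟨i, hi, rfl⟩
    exact Submodule.smul_mem _ _ (Submodule.subset_span ⟨i, hi, rfl⟩)
  · rintro _ ⟨i, hi, rfl⟩
    have : g i = c⁻¹ • (c • g i) := by rw [smul_smul, inv_mul_cancel₀ hc, one_smul]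
    rw [this]
    exact Submodule.smul_mem _ _ (Submodule.subset_span ⟨i, hi, rfl⟩)

/-- The probability bound for the event that the codewords of the detected users are not needed to
come closer to the channel output. -/
noncomputable def badBound (m t : ℕ) (V s x : ℝ) : ℝ :=
  ((1 - s * (1 - V))⁻¹) ^ m * ((1 + s * V)⁻¹) ^ t * ((1 + s * V / (1 + s * V) * x)⁻¹) ^ (m + t)

/-- The probability bound for the event that a wrong list of codewords explains the channel
output. -/
noncomputable def confusionBound (m t : ℕ) (V : ℝ) : ℝ :=
  (V * ((m + t) / m)) ^ m * ((m + t : ℝ) / t) ^ t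

/-- The coefficients of the codewords in the channel output. -/
noncomputable def channelCoeff (P' : ℝ) (A : Finset (Fin K)) (w : Fin K → Fin M) (h : Fin K → ℂ)
    (i : Fin K × Fin M) : ℂ :=
  if i.1 ∈ A ∧ i.2 = w i.1 then ((√P' : ℝ) : ℂ) * h i.1 else 0

theorem sum_channelCoeff_smul (P' : ℝ) (A : Finset (Fin K)) (w : Fin K → Fin M) (h : Fin K → ℂ)
    (g : Fin K × Fin M → EuclideanSpace ℂ (Fin n)) :
    ∑ i, channelCoeff P' A w h i • g i = ∑ j ∈ A, (((√P' : ℝ) : ℂ) * h j) • g (j, w j) := by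
  rw [Fintype.sum_prod_type, ← Finset.sum_subset (Finset.subset_univ A)]
  · refine Finset.sum_congr rfl fun j hj => ?_
    rw [Finset.sum_eq_single (w j)]
    · simp [channelCoeff, hj]
    · intro m _ hm
      simp [channelCoeff, hm]
    · simp
  · intro j _ hj
    exact Finset.sum_eq_zero fun m _ => by simp [channelCoeff, hj]

theorem sum_norm_channelCoeff_sq {P' : ℝ} (hP' : 0 ≤ P') {A S : Finset (Fin K)} (hS : S ⊆ A)
    (w : Fin K → Fin M) (h : Fin K → ℂ) :
    ∑ i ∈ decisionIndex (trueDecision A w) \ decisionIndex (trueDecision (A \ S) w),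
      ‖channelCoeff P' A w h i‖ ^ 2 = P' * ∑ j ∈ S, ‖h j‖ ^ 2 := by
  rw [Finset.mul_sum]
  symm
  refine Finset.sum_bij (fun j _ => (j, w j)) ?_ ?_ ?_ ?_
  · intro j hj
    simp [mem_decisionIndex_trueDecision, hj, hS hj]
  · intro j _ j' _ h
    exact congrArg Prod.fst h
  · rintro ⟨j, m⟩ hi
    simp only [Finset.mem_sdiff, mem_decisionIndex_trueDecision, not_and] at hi
    have hjS : j ∈ S := by
      by_contra hc
      exact hi.2 ⟨hi.1.1, hc⟩ hi.1.2
    exact ⟨j, hjS, by rw [hi.1.2]⟩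
  · intro j hj
    simp [channelCoeff, hS hj, mul_pow, Real.sq_sqrt hP']

end

section
variable {n M K Ka : ℕ}

/-- The seeds for which some codeword violates the power constraint. -/
def powerViolation (P P' : ℝ) : Set (Fin K × Fin M → EuclideanSpace ℂ (Fin n)) :=
  {s | ∃ i, n * P < P' * ‖s i‖ ^ 2}

theorem measurableSet_powerViolation (P P' : ℝ) :
    MeasurableSet (powerViolation P P' (n := n) (K := K) (M := M)) := by
  have : powerViolation P P' (n := n) (K := K) (M := M) =
      ⋃ i, {s | n * P < P' * ‖s i‖ ^ 2} := by
    ext s; simp [powerViolation]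
  rw [this]
  exact MeasurableSet.iUnion fun i => measurableSet_lt measurable_const (by fun_prop)

theorem measure_powerViolation_le {P P' l : ℝ} (hP' : 0 < P') (hl : 0 ≤ l) (hl1 : l < 1) :
    (Measure.pi fun _ : Fin K × Fin M => stdComplexGaussian (Fin n)) (powerViolation P P') ≤
      ENNReal.ofReal (K * M * (((1 - l)⁻¹) ^ n * Real.exp (-l * (n * P / P')))) := by
  have : powerViolation P P' (n := n) (K := K) (M := M) =
      ⋃ i ∈ (Finset.univ : Finset (Fin K × Fin M)), {s | n * P < P' * ‖s i‖ ^ 2} := by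
    ext s; simp [powerViolation]
  rw [this]
  refine (measure_biUnion_finset_le _ _).trans ((Finset.sum_le_sum (g := fun _ => ENNReal.ofReal
    (((1 - l)⁻¹) ^ n * Real.exp (-l * (n * P / P')))) fun i _ => ?_).trans ?_)
  · have hm : MeasurableSet {z : EuclideanSpace ℂ (Fin n) | n * P / P' ≤ ‖z‖ ^ 2} :=
      measurableSet_le measurable_const (by fun_prop)
    refine le_trans ?_ (stdComplexGaussian_norm_sq_ge hl hl1)
    rw [← (measurePreserving_eval (fun _ : Fin K × Fin M => stdComplexGaussian (Fin n))
      i).measure_preimage hm.nullMeasurableSet]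
    refine measure_mono fun s hs => ?_
    simp only [Set.mem_ofPred_eq, Set.mem_preimage, Function.eval] at hs ⊢
    rw [div_le_iff₀ hP']
    linarith
  · have h1 : 0 < 1 - l := by linarith
    rw [Finset.sum_const, nsmul_eq_mul, Finset.card_univ, Fintype.card_prod, Fintype.card_fin,
      Fintype.card_fin, ← ENNReal.ofReal_natCast, ← ENNReal.ofReal_mul (by positivity)]
    push_cast
    rfl

theorem gaussianCode_output {P P' : ℝ} (hP : 0 ≤ P) (hP' : 0 ≤ P')
    (d : (Fin K × Fin M → EuclideanSpace ℂ (Fin n)) × (Fin n → ℂ) → DecisionList K M Ka)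
    (hd : ∀ D, MeasurableSet {p | d p = D}) (A : Finset (Fin K)) (w : Fin K → Fin M)
    {s : Fin K × Fin M → EuclideanSpace ℂ (Fin n)} (hs : s ∉ powerViolation P P')
    (h : Fin K → ℂ) (z : Fin n → ℂ) :
    WithLp.toLp 2 ((gaussianCode hP hP' d hd).output A w s h z) =
      ∑ i, channelCoeff P' A w h i • s i + WithLp.toLp 2 z := by
  have hc : ∀ i, truncatedCodeword P P' s i = ((√P' : ℝ) : ℂ) • s i := by
    intro i
    rw [truncatedCodeword, if_pos]
    by_contra hcon
    exact hs ⟨i, not_le.1 hcon⟩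
  rw [sum_channelCoeff_smul]
  ext i
  simp only [RandomAccessCode.output, gaussianCode, hc, PiLp.add_apply, PiLp.smul_apply,
    WithLp.ofLp_sum, Finset.sum_apply, WithLp.ofLp_smul, Pi.smul_apply, smul_eq_mul]
  congr 1
  refine Finset.sum_congr rfl fun j _ => ?_
  ring

/-- The true list is a competitor of the decoded one. So if the true list reaches below `V` times
the distance of the correctly decoded part, the decoded list does so too. The sum is the union bound
over the missed set and, in the second case, over the wrong list. -/
theorem gaussianCode_section_le {P P' : ℝ} (hP : 0 ≤ P) (hP' : 0 < P') (hM : 0 < M)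
    {d : (Fin K × Fin M → EuclideanSpace ℂ (Fin n)) × (Fin n → ℂ) → DecisionList K M Ka}
    (hd : ∀ D, MeasurableSet {p | d p = D})
    (hproj : ∀ s y (D : DecisionList K M Ka),
        (subspan (decisionIndex (d (s, y)).1) (truncatedCodeword P P' s)).distSq
          (WithLp.toLp 2 y) ≤
        (subspan (decisionIndex D.1) (truncatedCodeword P P' s)).distSq (WithLp.toLp 2 y))
    {m : ℕ} (hm : 0 < m) (hn : Ka + m = n) (hKa : 0 < Ka) {ε' : ℝ} (hε' : 0 < ε')
    {A : Finset (Fin K)} (hA : A.card = Ka) (w : Fin K → Fin M) (h : Fin K → ℂ)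
    {V : ℕ → ℝ} (hV : ∀ t, 0 < V t ∧ V t < 1) {σ : Finset (Fin K) → ℝ}
    (hσ : ∀ S, 0 ≤ σ S ∧ σ S * (1 - V S.card) < 1) :
    ((Measure.pi fun _ : Fin K × Fin M => stdComplexGaussian (Fin n)).prod
      (Measure.pi fun _ : Fin n => complexGaussian))
      {p | p.1 ∉ powerViolation P P' ∧
        (p.1, h, p.2) ∈ {ω | ε' * Ka ≤ (gaussianCode hP hP'.le d hd).errorCount A w ω}} ≤
      ∑ S ∈ A.powerset.filter (fun S => ε' * Ka ≤ S.card),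
        (ENNReal.ofReal (badBound m S.card (V S.card) (σ S) (P' * ∑ j ∈ S, ‖h j‖ ^ 2)) +
          ((M ^ S.card * (K - Ka + S.card).choose S.card : ℕ) : ℝ≥0∞) *
            ENNReal.ofReal (confusionBound m S.card (V S.card))) := by
  set a := channelCoeff (K := K) (M := M) P' A w h with ha
  set Y : (Fin K × Fin M → EuclideanSpace ℂ (Fin n)) × EuclideanSpace ℂ (Fin n) →
    EuclideanSpace ℂ (Fin n) := fun p => ∑ i, a i • p.1 i + p.2 with hY
  set I := decisionIndex (trueDecision A w) with hI
  set T : Finset (Fin K) → Finset (Fin K × Fin M) :=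
    fun S => decisionIndex (trueDecision (A \ S) w) with hT
  set Ds : Finset (Fin K) → Finset (DecisionList K M Ka) := fun S =>
    Finset.univ.filter fun D => ∀ j ∈ A, (D.1 j = some (w j) ↔ j ∉ S) with hDs
  set 𝒮 := A.powerset.filter (fun S => ε' * Ka ≤ S.card) with h𝒮
  let bad : Finset (Fin K) → Set ((Fin K × Fin M → EuclideanSpace ℂ (Fin n)) ×
    EuclideanSpace ℂ (Fin n)) := fun S => {p | V S.card * (subspan (T S) p.1).distSq (Y p) ≤
      (subspan I p.1).distSq (Y p)}
  let conf : Finset (Fin K) → DecisionList K M Ka → Set ((Fin K × Fin M →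
    EuclideanSpace ℂ (Fin n)) × EuclideanSpace ℂ (Fin n)) := fun S D =>
      {p | (subspan (decisionIndex D.1) p.1).distSq (Y p) ≤
        V S.card * (subspan (T S) p.1).distSq (Y p)}
  let E := ⋃ S ∈ 𝒮, (bad S ∪ ⋃ D ∈ Ds S, conf S D)
  have hcP : ((√P' : ℝ) : ℂ) ≠ 0 := by
    simpa using (Real.sqrt_pos.2 hP').ne'
  have hsub : {p : (Fin K × Fin M → EuclideanSpace ℂ (Fin n)) × (Fin n → ℂ) |
      p.1 ∉ powerViolation P P' ∧
        (p.1, h, p.2) ∈ {ω | ε' * Ka ≤ (gaussianCode hP hP'.le d hd).errorCount A w ω}} ⊆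
      Prod.map id (WithLp.toLp 2) ⁻¹' E := by
    rintro ⟨s, z⟩ ⟨hs, herr⟩
    simp only at hs
    set y := (gaussianCode hP hP'.le d hd).output A w s h z with hy
    have hyY : WithLp.toLp 2 y = Y (s, WithLp.toLp 2 z) :=
      gaussianCode_output hP hP'.le d hd A w hs h z
    set D := d (s, y) with hD
    set S := A.filter fun j => D.1 j ≠ some (w j) with hSdef
    have hScard : (gaussianCode hP hP'.le d hd).errorCount A w (s, h, z) = S.card := rfl
    have hSm : S ∈ 𝒮 := by
      refine Finset.mem_filter.2 ⟨Finset.mem_powerset.2 (Finset.filter_subset _ _), ?_⟩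
      rw [← hScard]
      exact herr
    have hDm : D ∈ Ds S := by
      refine Finset.mem_filter.2 ⟨Finset.mem_univ _, fun j hj => ?_⟩
      simp [hSdef, hj]
    have hcw : truncatedCodeword P P' s = fun i => ((√P' : ℝ) : ℂ) • s i := by
      ext1 i
      rw [truncatedCodeword, if_pos]
      by_contra hcon
      exact hs ⟨i, not_le.1 hcon⟩
    -- Off the power violation all codewords carry the same factor `√P'`, which drops out of the
    -- spans.
    have hle := hproj s y ⟨trueDecision A w, (card_trueDecision A w).trans hA⟩
    rw [hcw, subspan_smul _ hcP, subspan_smul _ hcP, hyY] at hle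
    change (s, WithLp.toLp 2 z) ∈ E
    simp only [E, Set.mem_iUnion]
    refine ⟨S, hSm, ?_⟩
    by_cases hb : (s, WithLp.toLp 2 z) ∈ bad S
    · exact Or.inl hb
    · refine Or.inr ?_
      simp only [Set.mem_iUnion]
      exact ⟨D, hDm, hle.trans (not_le.1 hb).le⟩
  have hmp : MeasurePreserving (Prod.map id (WithLp.toLp 2) :
      (Fin K × Fin M → EuclideanSpace ℂ (Fin n)) × (Fin n → ℂ) → _)
      ((Measure.pi fun _ : Fin K × Fin M => stdComplexGaussian (Fin n)).prod
        (Measure.pi fun _ : Fin n => complexGaussian))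
      ((Measure.pi fun _ : Fin K × Fin M => stdComplexGaussian (Fin n)).prod
        (stdComplexGaussian (Fin n))) :=
    (MeasurePreserving.id _).prod ⟨by fun_prop, rfl⟩
  refine (measure_mono hsub).trans ((Measure.le_map_apply hmp.measurable.aemeasurable _).trans ?_)
  rw [hmp.map_eq]
  refine (measure_biUnion_finset_le _ _).trans (Finset.sum_le_sum fun S hS => ?_)
  have hSA : S ⊆ A := Finset.mem_powerset.1 (Finset.mem_filter.1 hS).1
  have hS0 : 0 < S.card := by
    have h1 := (Finset.mem_filter.1 hS).2
    have h2 : 0 < ε' * Ka := by positivity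
    exact_mod_cast h2.trans_le h1
  have hScA := Finset.card_le_card hSA
  have hIc : I.card = Ka := by rw [hI, card_decisionIndex, card_trueDecision, hA]
  have hTc : (T S).card = Ka - S.card := by
    simp only [hT]
    rw [card_decisionIndex, card_trueDecision, Finset.card_sdiff_of_subset hSA, hA]
  refine (measure_union_le _ _).trans (add_le_add ?_ ?_)
  · have hTI : T S ⊆ I := by
      intro i hi
      rw [mem_decisionIndex_trueDecision] at hi ⊢
      exact ⟨(Finset.mem_sdiff.1 hi.1).1, hi.2⟩
    have key := measure_ratio_le_distSq hTI hm (by omega : I.card + m = n)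
      (by omega : I.card = (T S).card + S.card) a (fun i hi => by
        rw [mem_decisionIndex_trueDecision] at hi
        rw [ha, channelCoeff, if_neg hi]) (hV S.card).1 (hV S.card).2 (hσ S).1 (hσ S).2
    rw [sum_norm_channelCoeff_sq hP'.le hSA] at key
    exact key
  · calc _ ≤ ∑ D ∈ Ds S, _ := measure_biUnion_finset_le _ _
      _ ≤ ∑ D ∈ Ds S, ENNReal.ofReal (confusionBound m S.card (V S.card)) := by
          refine Finset.sum_le_sum fun D hD => ?_
          have hD' := (Finset.mem_filter.1 hD).2
          have hDc : (decisionIndex D.1).card = Ka := by rw [card_decisionIndex, D.2]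
          have hTD : T S ⊆ decisionIndex D.1 := by
            intro i hi
            rw [mem_decisionIndex_trueDecision] at hi
            rw [mem_decisionIndex, hi.2]
            exact (hD' _ (Finset.mem_sdiff.1 hi.1).1).2 (Finset.mem_sdiff.1 hi.1).2
          refine measure_distSq_ratio_le hTD hm hS0 (by omega) (by omega) a (fun i hi hiT => ?_)
            (hV S.card).1 (hV S.card).2
          rw [ha, channelCoeff, if_neg]
          rintro ⟨h1, h2⟩
          rw [mem_decisionIndex, h2] at hi
          refine hiT ?_
          rw [mem_decisionIndex_trueDecision]
          exact ⟨Finset.mem_sdiff.2 ⟨h1, (hD' _ h1).1 hi⟩, h2⟩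
      _ ≤ _ := by
          rw [Finset.sum_const, nsmul_eq_mul]
          gcongr
          exact card_decisionList_le hM hA hSA w

theorem badBound_nonneg {m t : ℕ} {V s x : ℝ} (hV : 0 < V) (hs : 0 ≤ s) (hs1 : s * (1 - V) < 1)
    (hx : 0 ≤ x) : 0 ≤ badBound m t V s x := by
  have : 0 < 1 - s * (1 - V) := by linarith
  unfold badBound
  positivity

theorem confusionBound_nonneg {m t : ℕ} {V : ℝ} (hV : 0 < V) : 0 ≤ confusionBound m t V := by
  unfold confusionBound
  positivity

/-- The random coding bound. -/
theorem exists_code_pupe_le (hK : Ka ≤ K) (hM : 0 < M) {P P' : ℝ} (hP : 0 ≤ P) (hP' : 0 < P')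
    {m : ℕ} (hm : 0 < m) (hn : Ka + m = n) (hKa : 0 < Ka) {ε' : ℝ} (hε' : 0 < ε')
    {V : ℕ → ℝ} (hV : ∀ t, 0 < V t ∧ V t < 1) {l : ℝ} (hl : 0 ≤ l) (hl1 : l < 1)
    {δ₁ δ₂ δ₃ δ₄ : ℝ} (h1 : K * M * (((1 - l)⁻¹) ^ n * Real.exp (-l * (n * P / P'))) ≤ δ₁)
    (hδ₂ : 0 ≤ δ₂) (hδ₃ : 0 ≤ δ₃)
    (h23 : ∀ A : Finset (Fin K), A.card = Ka → ∃ Typ : Set (Fin K → ℂ), MeasurableSet Typ ∧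
      (Measure.pi fun _ : Fin K => complexGaussian) Typᶜ ≤ ENNReal.ofReal δ₂ ∧
      ∀ h ∈ Typ, ∃ σ : Finset (Fin K) → ℝ, (∀ S, 0 ≤ σ S ∧ σ S * (1 - V S.card) < 1) ∧
        ∑ S ∈ A.powerset.filter (fun S => ε' * Ka ≤ S.card),
          badBound m S.card (V S.card) (σ S) (P' * ∑ j ∈ S, ‖h j‖ ^ 2) ≤ δ₃)
    (h4 : ∀ A : Finset (Fin K), A.card = Ka →
      ∑ S ∈ A.powerset.filter (fun S => ε' * Ka ≤ S.card),
        (M : ℝ) ^ S.card * ((K - Ka + S.card).choose S.card : ℝ) *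
          confusionBound m S.card (V S.card) ≤ δ₄) :
    ∃ c : RandomAccessCode n M K Ka P, ∀ A : Finset (Fin K), A.card = Ka →
      c.pupe A ≤ ε' + (δ₁ + δ₂ + (δ₃ + δ₄)) := by
  obtain ⟨d, hd, hproj⟩ := exists_projection_decoder (n := n) hK hM P P'
  refine ⟨gaussianCode hP hP'.le d hd, fun A hA => ?_⟩
  obtain ⟨Typ, hTm, hT2, hT3⟩ := h23 A hA
  have hp1 : (0 : ℝ) < 1 - l := by linarith
  have hδ₁ : 0 ≤ δ₁ := le_trans (by positivity) h1
  have hδ₄ : 0 ≤ δ₄ := (Finset.sum_nonneg fun S _ =>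
    mul_nonneg (by positivity) (confusionBound_nonneg (hV _).1)).trans (h4 A hA)
  refine RandomAccessCode.pupe_le _ hA hM hε'.le (by positivity) fun w => ?_
  have hE : MeasurableSet {ω | ε' * Ka ≤ (gaussianCode hP hP'.le d hd).errorCount A w ω} :=
    measurableSet_le measurable_const
      (measurable_from_top.comp (RandomAccessCode.measurable_errorCount _ A w))
  refine ((gaussianCode hP hP'.le d hd).jointLaw_le hE (measurableSet_powerViolation P P') hTm
    (b := ENNReal.ofReal (δ₃ + δ₄)) fun h hh => ?_).trans ?_
  · obtain ⟨σ, hσ, hb⟩ := hT3 h hh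
    refine (gaussianCode_section_le hP hP' hM hd hproj hm hn hKa hε' hA w h hV hσ).trans ?_
    rw [Finset.sum_add_distrib, ENNReal.ofReal_add hδ₃ hδ₄]
    refine add_le_add ?_ ?_
    · rw [← ENNReal.ofReal_sum_of_nonneg fun S _ => badBound_nonneg (hV _).1 (hσ S).1 (hσ S).2
        (by positivity)]
      exact ENNReal.ofReal_le_ofReal hb
    · refine le_trans (le_of_eq ?_) (ENNReal.ofReal_le_ofReal (h4 A hA))
      rw [ENNReal.ofReal_sum_of_nonneg fun S _ =>
        mul_nonneg (by positivity) (confusionBound_nonneg (hV _).1)]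
      refine Finset.sum_congr rfl fun S _ => ?_
      rw [ENNReal.ofReal_mul (by positivity), ← ENNReal.ofReal_natCast]
      push_cast
      rfl
  · rw [ENNReal.ofReal_add (p := δ₁ + δ₂) (by positivity) (by positivity),
      ENNReal.ofReal_add hδ₁ hδ₂]
    exact add_le_add (add_le_add ((measure_powerViolation_le hP' hl hl1).trans
      (ENNReal.ofReal_le_ofReal h1)) hT2) le_rfl

end

/-! ### The law of the fading energy and the log-partition function -/

/-- Polar coordinates and the substitution `x = r ^ 2`: the energy of a fading coefficient is
standard exponential. -/
theorem lintegral_normSq_complexGaussian {f : ℝ → ℝ≥0∞} (hf : Measurable f) :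
    ∫⁻ z, f (‖z‖ ^ 2) ∂complexGaussian =
      ∫⁻ x in Set.Ioi 0, ENNReal.ofReal (Real.exp (-x)) * f x := by
  have hm : Measurable fun z : ℂ => f (‖z‖ ^ 2) := hf.comp (by fun_prop)
  have hd : Measurable fun x : ℝ => gaussianPDF 0 (1 / 2) x := measurable_gaussianPDF _ _
  have hg : gaussianReal 0 (1 / 2) = volume.withDensity (gaussianPDF 0 (1 / 2)) :=
    gaussianReal_of_var_ne_zero 0 (by norm_num)
  have hp : ∀ x y : ℝ, gaussianPDF 0 (1 / 2) x * gaussianPDF 0 (1 / 2) y =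
      ENNReal.ofReal (Real.pi⁻¹ * Real.exp (-(x ^ 2 + y ^ 2))) := by
    intro x y
    rw [gaussianPDF, gaussianPDF, ← ENNReal.ofReal_mul (gaussianPDFReal_nonneg _ _ _)]
    simp only [gaussianPDFReal]
    rw [show 2 * Real.pi * ((1 / 2 : ℝ≥0) : ℝ) = Real.pi by push_cast; ring, mul_mul_mul_comm,
      ← Real.exp_add, ← mul_inv, Real.mul_self_sqrt Real.pi_pos.le]
    congr 3
    push_cast
    ring
  calc ∫⁻ z, f (‖z‖ ^ 2) ∂complexGaussian
      = ∫⁻ p : ℝ × ℝ, f (p.1 ^ 2 + p.2 ^ 2)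
          ∂((gaussianReal 0 (1 / 2)).prod (gaussianReal 0 (1 / 2))) := by
        rw [complexGaussian, lintegral_map hm Complex.measurableEquivRealProd.symm.measurable]
        refine lintegral_congr fun p => ?_
        rw [Complex.sq_norm, Complex.normSq_apply]
        simp only [Complex.measurableEquivRealProd_symm_apply]
        congr 1
        ring
    _ = ∫⁻ p : ℝ × ℝ, ENNReal.ofReal (Real.pi⁻¹ * Real.exp (-(p.1 ^ 2 + p.2 ^ 2))) *
          f (p.1 ^ 2 + p.2 ^ 2) := by
        rw [hg, prod_withDensity hd hd, lintegral_withDensity_eq_lintegral_mul _ (by fun_prop)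
          (g := fun p : ℝ × ℝ => f (p.1 ^ 2 + p.2 ^ 2)) (hf.comp (by fun_prop))]
        refine lintegral_congr fun p => ?_
        simp only [Pi.mul_apply, hp]
    _ = ∫⁻ p in polarCoord.target, ENNReal.ofReal p.1 *
          (ENNReal.ofReal (Real.pi⁻¹ * Real.exp (-(p.1 ^ 2))) * f (p.1 ^ 2)) := by
        rw [← lintegral_comp_polarCoord_symm]
        refine lintegral_congr fun p => ?_
        have : (p.1 * Real.cos p.2) ^ 2 + (p.1 * Real.sin p.2) ^ 2 = p.1 ^ 2 := by
          linear_combination p.1 ^ 2 * Real.sin_sq_add_cos_sq p.2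
        simp only [polarCoord_symm_apply, this, smul_eq_mul]
    _ = ∫⁻ r in Set.Ioi 0, ∫⁻ _ in Set.Ioo (-Real.pi) Real.pi, ENNReal.ofReal r *
          (ENNReal.ofReal (Real.pi⁻¹ * Real.exp (-(r ^ 2))) * f (r ^ 2)) := by
        rw [polarCoord_target, Measure.volume_eq_prod, ← Measure.prod_restrict, lintegral_prod]
        fun_prop
    _ = ∫⁻ r in Set.Ioi (0 : ℝ), ENNReal.ofReal |2 * r| *
          (ENNReal.ofReal (Real.exp (-(r ^ 2))) * f (r ^ 2)) := by
        refine setLIntegral_congr_fun measurableSet_Ioi fun r hr => ?_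
        have hr' : (0 : ℝ) < r := hr
        rw [setLIntegral_const, Real.volume_Ioo, ENNReal.ofReal_mul (by positivity),
          abs_of_pos (by positivity)]
        have : ENNReal.ofReal (2 * r) = ENNReal.ofReal r * ENNReal.ofReal Real.pi⁻¹ *
            ENNReal.ofReal (Real.pi - -Real.pi) := by
          rw [← ENNReal.ofReal_mul hr'.le, ← ENNReal.ofReal_mul (by positivity)]
          congr 1
          field_simp
          ring
        rw [this]
        ring
    _ = ∫⁻ x in (fun r : ℝ => r ^ 2) '' Set.Ioi 0, ENNReal.ofReal (Real.exp (-x)) * f x := by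
        rw [lintegral_image_eq_lintegral_abs_deriv_mul measurableSet_Ioi (f' := fun r => 2 * r)]
        · intro r _
          simpa using (hasDerivAt_pow 2 r).hasDerivWithinAt
        · intro a ha b hb hab
          exact (pow_left_inj₀ (le_of_lt ha) (le_of_lt hb) two_ne_zero).1 hab
    _ = _ := by
        congr 2
        ext x
        constructor
        · rintro ⟨r, hr, rfl⟩
          exact pow_pos (Set.mem_Ioi.1 hr) 2
        · intro hx
          exact ⟨√x, Real.sqrt_pos.2 hx, Real.sq_sqrt (le_of_lt hx)⟩

theorem integral_exp_mul_normSq {γ : ℝ} (hγ : γ < 1) :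
    ∫ z, Real.exp (γ * ‖z‖ ^ 2) ∂complexGaussian = (1 - γ)⁻¹ := by
  have := integral_exp_neg_mul_sq_complexGaussian (-γ) 0 (by linarith)
  simpa [← sub_eq_add_neg] using this

theorem integrable_exp_mul_normSq {γ : ℝ} (hγ : γ < 1) :
    Integrable (fun z : ℂ => Real.exp (γ * ‖z‖ ^ 2)) complexGaussian := by
  by_contra hc
  have h := integral_exp_mul_normSq hγ
  rw [integral_undef hc] at h
  have : (0 : ℝ) < (1 - γ)⁻¹ := inv_pos.2 (by linarith)
  linarith

/-- `E ln (1 + L exp (-β |h|²))` for a fading coefficient `h`. -/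
noncomputable def logPartition (L β : ℝ) : ℝ :=
  ∫ z, Real.log (1 + L * Real.exp (-β * ‖z‖ ^ 2)) ∂complexGaussian

theorem logPartition_zero (L : ℝ) : logPartition L 0 = Real.log (1 + L) := by
  simp [logPartition]

theorem log_one_add_mul_exp_bounds {L β x : ℝ} (hL : 0 ≤ L) (hβ : 0 ≤ β) (hx : 0 ≤ x) :
    0 ≤ Real.log (1 + L * Real.exp (-β * x)) ∧
      Real.log (1 + L * Real.exp (-β * x)) ≤ Real.log (1 + L) := by
  have h1 : Real.exp (-β * x) ≤ 1 := Real.exp_le_one_iff.2 (by nlinarith [mul_nonneg hβ hx])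
  have h2 := Real.exp_pos (-β * x)
  refine ⟨Real.log_nonneg (by nlinarith [mul_nonneg hL h2.le]), Real.log_le_log ?_ ?_⟩
  · nlinarith [mul_nonneg hL h2.le]
  · nlinarith

theorem integrable_logPartition {L β : ℝ} (hL : 0 ≤ L) (hβ : 0 ≤ β) :
    Integrable (fun z : ℂ => Real.log (1 + L * Real.exp (-β * ‖z‖ ^ 2))) complexGaussian := by
  refine Integrable.of_bound (C := Real.log (1 + L)) (Measurable.aestronglyMeasurable
    (by fun_prop)) (ae_of_all _ fun z => ?_)
  have := log_one_add_mul_exp_bounds hL hβ (sq_nonneg ‖z‖)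
  rw [Real.norm_eq_abs, abs_of_nonneg this.1]
  exact this.2

theorem integrable_normSq : Integrable (fun z : ℂ => ‖z‖ ^ 2) complexGaussian := by
  have h := (integrable_exp_mul_normSq (γ := 1 / 2) (by norm_num)).const_mul 2
  refine h.mono' (Measurable.aestronglyMeasurable (by fun_prop)) (ae_of_all _ fun z => ?_)
  rw [Real.norm_eq_abs, abs_of_nonneg (by positivity)]
  have := Real.add_one_le_exp (1 / 2 * ‖z‖ ^ 2)
  linarith

/-- Only this half of the mean is needed, in `logPartition_le_of_tilt`. It follows from `1 - γ x ≤
exp (-γ x)` and the Laplace transform as `γ → 0`. -/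
theorem one_le_integral_normSq : 1 ≤ ∫ z, ‖z‖ ^ 2 ∂complexGaussian := by
  have key : ∀ γ : ℝ, 0 < γ → (1 + γ)⁻¹ ≤ ∫ z, ‖z‖ ^ 2 ∂complexGaussian := by
    intro γ hγ
    have h1 : ∫ z, (1 - γ * ‖z‖ ^ 2) ∂complexGaussian ≤
        ∫ z, Real.exp (-γ * ‖z‖ ^ 2) ∂complexGaussian := by
      refine integral_mono ((integrable_const _).sub (integrable_normSq.const_mul γ))
        (integrable_exp_mul_normSq (by linarith)) fun z => ?_
      have := Real.add_one_le_exp (-γ * ‖z‖ ^ 2)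
      simp only
      linarith
    rw [integral_exp_mul_normSq (by linarith), integral_sub (integrable_const _)
      (integrable_normSq.const_mul γ), integral_const_mul] at h1
    simp only [integral_const, probReal_univ, one_smul, sub_neg_eq_add] at h1
    have h2 : γ * (1 + γ)⁻¹ ≤ γ * ∫ z, ‖z‖ ^ 2 ∂complexGaussian := by
      have : γ * (1 + γ)⁻¹ = 1 - (1 + γ)⁻¹ := by field_simp; ring
      linarith
    exact le_of_mul_le_mul_left h2 hγ
  have ht : Tendsto (fun γ : ℝ => (1 + γ)⁻¹) (𝓝[>] 0) (𝓝 1) := by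
    have : ContinuousAt (fun γ : ℝ => (1 + γ)⁻¹) 0 := by
      refine ContinuousAt.inv₀ (by fun_prop) (by norm_num)
    simpa using this.tendsto.mono_left nhdsWithin_le_nhds
  exact le_of_tendsto ht (eventually_mem_nhdsWithin.mono fun γ hγ => key γ hγ)

/-! ### Typical fading and counting sets of users by energy -/

/-- Chebyshev with variance at most `B ^ 2 / 4` per summand. The slow rate `1 / A.card` is enough,
as only finitely many functions are ever controlled. -/
theorem measure_sum_ge_le {K : ℕ} {f : ℂ → ℝ} (hf : Measurable f) {B : ℝ}
    (hB : ∀ z, f z ∈ Set.Icc 0 B) {A : Finset (Fin K)} (hA : 0 < A.card) {η : ℝ} (hη : 0 < η) :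
    (Measure.pi fun _ : Fin K => complexGaussian)
      {h | A.card * (∫ z, f z ∂complexGaussian + η) < ∑ j ∈ A, f (h j)} ≤
      ENNReal.ofReal (B ^ 2 / (4 * η ^ 2) / A.card) := by
  set μ := Measure.pi fun _ : Fin K => complexGaussian
  have hA' : (0 : ℝ) < A.card := by exact_mod_cast hA
  let X : Fin K → (Fin K → ℂ) → ℝ := fun j h => f (h j)
  have hXm : ∀ j, Measurable (X j) := fun j => hf.comp (measurable_pi_apply j)
  have hXb : ∀ j h, X j h ∈ Set.Icc 0 B := fun j h => hB (h j)
  have hX2 : ∀ j, MemLp (X j) 2 μ := fun j => MemLp.of_bound (hXm j).aestronglyMeasurable B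
    (ae_of_all _ fun h => by
      rw [Real.norm_eq_abs, abs_of_nonneg (hXb j h).1]; exact (hXb j h).2)
  have hind : iIndepFun X μ := iIndepFun_pi (X := fun _ => f) fun _ => hf.aemeasurable
  have hint : ∀ j, ∫ h, X j h ∂μ = ∫ z, f z ∂complexGaussian := fun j => by
    have he := measurePreserving_eval (fun _ : Fin K => complexGaussian) j
    rw [← he.map_eq, integral_map he.measurable.aemeasurable hf.aestronglyMeasurable]
  have hmean : ∫ h, (∑ j ∈ A, X j) h ∂μ = A.card * ∫ z, f z ∂complexGaussian := by
    simp only [Finset.sum_apply]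
    rw [integral_finsetSum _ fun j _ => (hX2 j).integrable (by norm_num)]
    simp [hint]
  have hvar : variance (∑ j ∈ A, X j) μ ≤ A.card * (B / 2) ^ 2 := by
    rw [IndepFun.variance_sum (fun j _ => hX2 j) fun i _ j _ hij => hind.indepFun hij,
      ← nsmul_eq_mul]
    refine Finset.sum_le_card_nsmul _ _ _ fun j _ => ?_
    simpa using variance_le_sq_of_bounded (ae_of_all μ (hXb j)) (hXm j).aemeasurable
  have hcheb := meas_ge_le_variance_div_sq
    (memLp_finsetSum' A fun j _ => hX2 j : MemLp (∑ j ∈ A, X j) 2 μ)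
    (mul_pos hA' hη)
  refine (measure_mono fun h hh => ?_).trans (hcheb.trans (ENNReal.ofReal_le_ofReal ?_))
  · simp only [Set.mem_ofPred_eq] at hh ⊢
    rw [hmean, Finset.sum_apply]
    refine le_trans ?_ (le_abs_self _)
    simp only [X]
    linarith
  · rw [div_le_iff₀ (by positivity)]
    refine hvar.trans (le_of_eq ?_)
    field_simp
    ring

/-- The fading vectors whose empirical log-partition functions are close to their means. -/
def typicalFading {K : ℕ} (F : Finset (ℝ × ℝ)) (η : ℝ) (A : Finset (Fin K)) : Set (Fin K → ℂ) :=
  {h | ∀ q ∈ F, ∑ j ∈ A, Real.log (1 + q.1 * Real.exp (-q.2 * ‖h j‖ ^ 2)) ≤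
    A.card * (logPartition q.1 q.2 + η)}

theorem measurableSet_typicalFading {K : ℕ} (F : Finset (ℝ × ℝ)) (η : ℝ) (A : Finset (Fin K)) :
    MeasurableSet (typicalFading F η A) := by
  have : typicalFading F η A = ⋂ q ∈ F, {h : Fin K → ℂ |
      ∑ j ∈ A, Real.log (1 + q.1 * Real.exp (-q.2 * ‖h j‖ ^ 2)) ≤
        A.card * (logPartition q.1 q.2 + η)} := by
    ext h; simp [typicalFading]
  rw [this]
  exact Finset.measurableSet_biInter _ fun q _ =>
    measurableSet_le (Finset.measurable_sum _ fun j _ => by fun_prop) measurable_const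

theorem measure_compl_typicalFading_le (F : Finset (ℝ × ℝ)) (hF : ∀ q ∈ F, 0 ≤ q.1 ∧ 0 ≤ q.2)
    {η : ℝ} (hη : 0 < η) : ∃ C : ℝ, 0 ≤ C ∧ ∀ (K : ℕ) (A : Finset (Fin K)), 0 < A.card →
      (Measure.pi fun _ : Fin K => complexGaussian) (typicalFading F η A)ᶜ ≤
        ENNReal.ofReal (C / A.card) := by
  refine ⟨∑ q ∈ F, Real.log (1 + q.1) ^ 2 / (4 * η ^ 2), by positivity, fun K A hA => ?_⟩
  have : (typicalFading F η A)ᶜ = ⋃ q ∈ F, {h : Fin K → ℂ |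
      A.card * (logPartition q.1 q.2 + η) <
        ∑ j ∈ A, Real.log (1 + q.1 * Real.exp (-q.2 * ‖h j‖ ^ 2))} := by
    ext h; simp [typicalFading]
  rw [this, Finset.sum_div, ENNReal.ofReal_sum_of_nonneg fun q _ => by positivity]
  refine (measure_biUnion_finset_le _ _).trans (Finset.sum_le_sum fun q hq => ?_)
  exact measure_sum_ge_le (f := fun z => Real.log (1 + q.1 * Real.exp (-q.2 * ‖z‖ ^ 2)))
    (by fun_prop) (fun z => log_one_add_mul_exp_bounds (hF q hq).1 (hF q hq).2 (sq_nonneg _)) hA hη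

/-- Expanding `∏ (1 + L exp (-β |h_j|²))` gives a positive term for every subset of `A`; those of
size `t` are kept. This replaces the binomial coefficient by a count weighted with the energy. -/
theorem sum_exp_neg_le_of_typicalFading {K : ℕ} {F : Finset (ℝ × ℝ)} {η : ℝ} {A : Finset (Fin K)}
    {h : Fin K → ℂ} (hh : h ∈ typicalFading F η A) {q : ℝ × ℝ} (hq : q ∈ F) (hL : 0 < q.1) (t : ℕ) :
    ∑ S ∈ A.powersetCard t, Real.exp (-q.2 * ∑ j ∈ S, ‖h j‖ ^ 2) ≤
      Real.exp (A.card * (logPartition q.1 q.2 + η) - t * Real.log q.1) := by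
  have h1 : ∏ j ∈ A, (1 + q.1 * Real.exp (-q.2 * ‖h j‖ ^ 2)) ≤
      Real.exp (A.card * (logPartition q.1 q.2 + η)) := by
    have : ∏ j ∈ A, (1 + q.1 * Real.exp (-q.2 * ‖h j‖ ^ 2)) =
        Real.exp (∑ j ∈ A, Real.log (1 + q.1 * Real.exp (-q.2 * ‖h j‖ ^ 2))) := by
      rw [Real.exp_sum]
      exact Finset.prod_congr rfl fun j _ => (Real.exp_log (by positivity)).symm
    rw [this]
    exact Real.exp_le_exp.2 (hh q hq)
  rw [Finset.prod_one_add] at h1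
  have h2 : ∑ S ∈ A.powersetCard t, ∏ j ∈ S, (q.1 * Real.exp (-q.2 * ‖h j‖ ^ 2)) ≤
      ∑ S ∈ A.powerset, ∏ j ∈ S, (q.1 * Real.exp (-q.2 * ‖h j‖ ^ 2)) :=
    Finset.sum_le_sum_of_subset_of_nonneg
      (fun S hS => Finset.mem_powerset.2 (Finset.mem_powersetCard.1 hS).1) fun S _ _ => by positivity
  have h3 : ∑ S ∈ A.powersetCard t, ∏ j ∈ S, (q.1 * Real.exp (-q.2 * ‖h j‖ ^ 2)) =
      q.1 ^ t * ∑ S ∈ A.powersetCard t, Real.exp (-q.2 * ∑ j ∈ S, ‖h j‖ ^ 2) := by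
    rw [Finset.mul_sum]
    refine Finset.sum_congr rfl fun S hS => ?_
    rw [Finset.prod_mul_distrib, Finset.prod_const, (Finset.mem_powersetCard.1 hS).2, Finset.mul_sum,
      Real.exp_sum]
  have h4 : q.1 ^ t = Real.exp (t * Real.log q.1) := by
    rw [Real.exp_nat_mul, Real.exp_log hL]
  rw [Real.exp_sub, le_div_iff₀ (Real.exp_pos _), ← h4, mul_comm, ← h3]
  exact h2.trans h1

/-! ### Upper bounds for the log-partition function -/

theorem integral_normSq_complexGaussian {f : ℝ → ℝ} (hf : Measurable f) (hf0 : ∀ x, 0 ≤ f x) :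
    ∫ z, f (‖z‖ ^ 2) ∂complexGaussian = ∫ x in Set.Ioi 0, Real.exp (-x) * f x := by
  rw [integral_eq_lintegral_of_nonneg_ae (ae_of_all _ fun z => hf0 _)
    (hf.comp (by fun_prop)).aestronglyMeasurable,
    integral_eq_lintegral_of_nonneg_ae (ae_of_all _ fun x => mul_nonneg (Real.exp_pos _).le (hf0 x))
    (by fun_prop), lintegral_normSq_complexGaussian (f := fun x => ENNReal.ofReal (f x))
      (by fun_prop)]
  congr 1
  refine lintegral_congr fun x => ?_
  rw [ENNReal.ofReal_mul (Real.exp_pos _).le]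

/-- A bound for `ln (1 + exp (β (T - x)))` with a sharp kink at `x = T`. -/
noncomputable def kinkBound (T β x : ℝ) : ℝ :=
  if x ≤ T then β * (T - x) + Real.exp (-(β * (T - x))) else Real.exp (β * (T - x))

theorem log_one_add_exp_le_kinkBound (T β x : ℝ) :
    Real.log (1 + Real.exp (β * T) * Real.exp (-β * x)) ≤ kinkBound T β x := by
  have e1 : Real.exp (β * T) * Real.exp (-β * x) = Real.exp (β * (T - x)) := by
    rw [← Real.exp_add]; congr 1; ring
  rw [e1, kinkBound]
  split_ifs with h
  · have : 1 + Real.exp (β * (T - x)) =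
        Real.exp (β * (T - x)) * (1 + Real.exp (-(β * (T - x)))) := by
      rw [mul_add, ← Real.exp_add]; simp [add_comm]
    rw [this, Real.log_mul (by positivity) (by positivity), Real.log_exp]
    have := Real.log_le_sub_one_of_pos (show 0 < 1 + Real.exp (-(β * (T - x))) by positivity)
    linarith
  · have := Real.log_le_sub_one_of_pos (show 0 < 1 + Real.exp (β * (T - x)) by positivity)
    linarith

theorem integral_exp_neg_mul_kinkBound {T β : ℝ} (hT : 0 ≤ T) (hβ : 1 < β) :
    IntegrableOn (fun x => Real.exp (-x) * kinkBound T β x) (Set.Ioi 0) ∧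
    ∫ x in Set.Ioi 0, Real.exp (-x) * kinkBound T β x ≤
      β * (T - 1 + Real.exp (-T)) + Real.exp (-T) * (2 * β / (β ^ 2 - 1)) := by
  -- Antiderivative of the integrand on `[0, T]`; the tail beyond `T` is a pure exponential.
  let F : ℝ → ℝ := fun x => β * (Real.exp (-x) * (1 - (T - x))) +
    Real.exp (-(β * T)) * Real.exp ((β - 1) * x) / (β - 1)
  have hb1 : 0 < β - 1 := by linarith
  have hF : ∀ x ∈ Set.uIcc 0 T, HasDerivAt F
      (Real.exp (-x) * (β * (T - x) + Real.exp (-(β * (T - x))))) x := by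
    intro x _
    have d1 : HasDerivAt (fun x : ℝ => Real.exp (-x)) (Real.exp (-x) * -1) x :=
      (hasDerivAt_neg x).exp
    have d2 : HasDerivAt (fun x : ℝ => 1 - (T - x)) 1 x := by
      simpa using ((hasDerivAt_id x).const_sub T).const_sub 1
    have d3 : HasDerivAt (fun x : ℝ => Real.exp ((β - 1) * x)) (Real.exp ((β - 1) * x) * (β - 1)) x := by
      simpa using ((hasDerivAt_id x).const_mul (β - 1)).exp
    have := ((d1.mul d2).const_mul β).add ((d3.const_mul (Real.exp (-(β * T)))).div_const (β - 1))
    refine this.congr_deriv ?_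
    have e1 : Real.exp (-(β * T)) * Real.exp ((β - 1) * x) =
        Real.exp (-x) * Real.exp (-(β * (T - x))) := by
      rw [← Real.exp_add, ← Real.exp_add]; congr 1; ring
    rw [mul_div_assoc, mul_div_assoc, div_self hb1.ne', mul_one, mul_one, e1]
    ring
  have hc : Continuous fun x => Real.exp (-x) * (β * (T - x) + Real.exp (-(β * (T - x)))) := by
    fun_prop
  have i1 : ∫ x in (0 : ℝ)..T, Real.exp (-x) * (β * (T - x) + Real.exp (-(β * (T - x)))) =
      F T - F 0 := intervalIntegral.integral_eq_sub_of_hasDerivAt hF (hc.intervalIntegrable _ _)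
  rw [intervalIntegral.integral_of_le hT] at i1
  have c1 : Set.EqOn (fun x => Real.exp (-x) * (β * (T - x) + Real.exp (-(β * (T - x)))))
      (fun x => Real.exp (-x) * kinkBound T β x) (Set.Ioc 0 T) := by
    intro x hx
    simp [kinkBound, hx.2]
  have c2 : Set.EqOn (fun x => Real.exp (β * T) * Real.exp (-(1 + β) * x))
      (fun x => Real.exp (-x) * kinkBound T β x) (Set.Ioi T) := by
    intro x hx
    simp only [kinkBound, not_le.2 (Set.mem_Ioi.1 hx), if_false]
    rw [← Real.exp_add, ← Real.exp_add]; congr 1; ring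
  have I1 : IntegrableOn (fun x => Real.exp (-x) * kinkBound T β x) (Set.Ioc 0 T) :=
    ((hc.integrableOn_Icc).mono_set Set.Ioc_subset_Icc_self).congr_fun c1 measurableSet_Ioc
  have I2 : IntegrableOn (fun x => Real.exp (-x) * kinkBound T β x) (Set.Ioi T) :=
    IntegrableOn.congr_fun ((integrableOn_exp_mul_Ioi (by linarith : -(1 + β) < 0) T).const_mul
      (Real.exp (β * T))) c2 measurableSet_Ioi
  refine ⟨?_, ?_⟩
  · rw [← Set.Ioc_union_Ioi_eq_Ioi hT]
    exact I1.union I2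
  · rw [← Set.Ioc_union_Ioi_eq_Ioi hT, setIntegral_union Set.Ioc_disjoint_Ioi_same
      measurableSet_Ioi I1 I2, ← setIntegral_congr_fun measurableSet_Ioc c1,
      ← setIntegral_congr_fun measurableSet_Ioi c2, i1, integral_const_mul,
      integral_exp_mul_Ioi (by linarith : -(1 + β) < 0) T]
    simp only [F]
    have e1 : Real.exp (-(β * T)) * Real.exp ((β - 1) * T) = Real.exp (-T) := by
      rw [← Real.exp_add]; congr 1; ring
    have e2 : Real.exp (β * T) * (-Real.exp (-(1 + β) * T) / -(1 + β)) =
        Real.exp (-T) / (1 + β) := by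
      have : Real.exp (β * T) * Real.exp (-(1 + β) * T) = Real.exp (-T) := by
        rw [← Real.exp_add]; congr 1; ring
      rw [← this]
      field_simp
    rw [e1, e2]
    have e3 : Real.exp (-T) * (2 * β / (β ^ 2 - 1)) =
        Real.exp (-T) / (β - 1) + Real.exp (-T) / (1 + β) := by
      have : β ^ 2 - 1 = (β - 1) * (1 + β) := by ring
      rw [this]
      field_simp
      ring
    rw [e3]
    simp only [sub_self, sub_zero, mul_one, neg_zero, Real.exp_zero, one_mul, mul_zero]
    have : 0 ≤ Real.exp (-(β * T)) / (β - 1) := by positivity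
    linarith

/-- The main term is `β E (T - |h|²)₊`. It is sharp for large `β`, when the tilt selects the users
with energy below `T`. -/
theorem logPartition_le_of_kink {T β : ℝ} (hT : 0 ≤ T) (hβ : 1 < β) :
    logPartition (Real.exp (β * T)) β ≤
      β * (T - 1 + Real.exp (-T)) + Real.exp (-T) * (2 * β / (β ^ 2 - 1)) := by
  obtain ⟨h1, h2⟩ := integral_exp_neg_mul_kinkBound hT hβ
  refine le_trans ?_ h2
  have h0 : ∀ x, 0 ≤ Real.log (1 + Real.exp (β * T) * Real.exp (-β * x)) := fun x =>
    Real.log_nonneg (le_add_of_nonneg_right (by positivity))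
  rw [logPartition, integral_normSq_complexGaussian
    (f := fun x => Real.log (1 + Real.exp (β * T) * Real.exp (-β * x))) (by fun_prop) h0]
  refine integral_mono_of_nonneg (ae_of_all _ fun x => mul_nonneg (Real.exp_pos _).le (h0 x)) h1
    (ae_of_all _ fun x => ?_)
  exact mul_le_mul_of_nonneg_left (log_one_add_exp_le_kinkBound T β x) (Real.exp_pos _).le

/-- Jensen after splitting off `exp (-γ |h|²)`, carried out with the tangent line of the logarithm
at the mean `c`. The term `-γ` uses that the mean energy is at least 1. -/
theorem logPartition_le_of_tilt {L β γ : ℝ} (hL : 0 < L) (hβ : 0 ≤ β) (hγ0 : 0 ≤ γ) (hγ1 : γ < 1) :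
    logPartition L β ≤ -γ + Real.log ((1 - γ)⁻¹ + L * (1 - γ + β)⁻¹) := by
  set c := (1 - γ)⁻¹ + L * (1 - γ + β)⁻¹ with hc
  have hc0 : 0 < c := by
    have h1 : 0 < 1 - γ := by linarith
    have h2 : 0 < 1 - γ + β := by linarith
    positivity
  have i1 := integrable_exp_mul_normSq hγ1
  have i2 := integrable_exp_mul_normSq (γ := γ - β) (by linarith)
  have hu : ∫ z, (Real.exp (γ * ‖z‖ ^ 2) + L * Real.exp ((γ - β) * ‖z‖ ^ 2)) ∂complexGaussian = c := by
    rw [integral_add i1 (i2.const_mul L), integral_const_mul, integral_exp_mul_normSq hγ1,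
      integral_exp_mul_normSq (by linarith), hc]
    congr 3
    ring
  have hbd : ∀ z : ℂ, Real.log (1 + L * Real.exp (-β * ‖z‖ ^ 2)) ≤
      -γ * ‖z‖ ^ 2 + ((Real.log c - 1) +
        c⁻¹ * (Real.exp (γ * ‖z‖ ^ 2) + L * Real.exp ((γ - β) * ‖z‖ ^ 2))) := by
    intro z
    set u := Real.exp (γ * ‖z‖ ^ 2) + L * Real.exp ((γ - β) * ‖z‖ ^ 2) with hu
    have hu0 : 0 < u := by positivity
    have h1 : 1 + L * Real.exp (-β * ‖z‖ ^ 2) = Real.exp (-γ * ‖z‖ ^ 2) * u := by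
      rw [hu, mul_add, mul_left_comm, ← Real.exp_add, ← Real.exp_add]
      congr 1
      · rw [eq_comm, Real.exp_eq_one_iff]; ring
      · congr 2; ring
    rw [h1, Real.log_mul (Real.exp_pos _).ne' hu0.ne', Real.log_exp]
    have h2 := Real.log_le_sub_one_of_pos (div_pos hu0 hc0)
    rw [Real.log_div hu0.ne' hc0.ne', div_eq_inv_mul] at h2
    linarith
  have i3 : Integrable (fun z : ℂ => c⁻¹ * (Real.exp (γ * ‖z‖ ^ 2) +
      L * Real.exp ((γ - β) * ‖z‖ ^ 2))) complexGaussian := (i1.add (i2.const_mul L)).const_mul c⁻¹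
  have i4 : Integrable (fun z : ℂ => (Real.log c - 1) + c⁻¹ * (Real.exp (γ * ‖z‖ ^ 2) +
      L * Real.exp ((γ - β) * ‖z‖ ^ 2))) complexGaussian := (integrable_const _).add i3
  have i5 : Integrable (fun z : ℂ => -γ * ‖z‖ ^ 2) complexGaussian := integrable_normSq.const_mul _
  refine (integral_mono (integrable_logPartition hL.le hβ) (i5.add i4) hbd).trans ?_
  change ∫ z, (-γ * ‖z‖ ^ 2 + (_ + _)) ∂complexGaussian ≤ _
  rw [integral_add i5 i4, integral_add (integrable_const _) i3, integral_const_mul,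
    integral_const_mul, hu, inv_mul_cancel₀ hc0.ne']
  simp only [integral_const, probReal_univ, one_smul]
  nlinarith [one_le_integral_normSq]

/-! ### Lower bounds for the Chernoff exponent -/

/-- The Chernoff exponent of the event that the missed codewords of relative energy `w` do not
separate the channel output from the span of the detected ones. -/
noncomputable def chernoffExponent (r ω e σ w : ℝ) : ℝ :=
  (1 + r) * Real.log (1 + σ * (ω + e * w)) - Real.log (1 + σ * ω) + Real.log (1 - σ)

/-- The part of the exponent without the factor `r` vanishes at `σ = 0` and at `σ = (X - 1) / (X +
ω)`. At the second zero `1 + σ (ω + X) = X`, and exactly `r ln X` remains. -/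
theorem exists_chernoffExponent_eq (r : ℝ) {ω e w : ℝ} (hω : 0 < ω) (hX : 1 < e * w) :
    ∃ σ, 0 < σ ∧ σ < 1 ∧ chernoffExponent r ω e σ w = r * Real.log (e * w) := by
  obtain ⟨X, hXd⟩ : ∃ X, X = e * w := ⟨_, rfl⟩
  rw [← hXd] at hX
  have hd : 0 < X + ω := by linarith
  refine ⟨(X - 1) / (X + ω), div_pos (by linarith) hd, by rw [div_lt_one hd]; linarith, ?_⟩
  have h1 : 1 + (X - 1) / (X + ω) * (ω + X) = X := by field_simp; ring
  have h2 : 1 - (X - 1) / (X + ω) = (1 + ω) / (X + ω) := by field_simp; ring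
  have h3 : 1 + (X - 1) / (X + ω) * ω = X * ((1 + ω) / (X + ω)) := by field_simp; ring
  have hX0 : X ≠ 0 := by linarith
  have h4 := Real.log_mul hX0 (show (1 + ω) / (X + ω) ≠ 0 by positivity)
  rw [chernoffExponent, ← hXd, h1, h2, h3, h4]
  ring

section halfTilt

variable {r ω e g b w : ℝ}

/-- This `σ` is half of the nonzero root in `exists_chernoffExponent_eq` for `w = 1`. Midway between
the two zeros the part without `r` is positive, which is what is needed when `ln e` is small. The
variables `g` and `b` rationalize the square root in δ₂. -/
theorem le_chernoffExponent_half (hω : 0 < ω) (hg : 0 < g) (hb : 1 ≤ b)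
    (he : e = 1 + 2 * g * (b + g)) (hbω : b ^ 2 = 1 + 2 * ω * e) (hw : 1 ≤ w) :
    r * Real.log (1 + g * (b + g) + (w - 1) * ((e - 1) / (2 * (e + ω)) * e)) +
      Real.log (1 + (2 * w * g ^ 2 * (b + g) ^ 2 + 2 * (w - 1) * g * (b + g)) /
        ((b + g + g) ^ 2 + 1)) ≤
      chernoffExponent r ω e ((e - 1) / (2 * (e + ω))) w := by
  have hx : 0 < b + g := by linarith
  have he1 : 1 < e := by rw [he]; nlinarith [mul_pos hg hx]
  have hew : 0 < e + ω := by linarith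
  have hw0 : 0 ≤ w - 1 := by linarith
  set σ := (e - 1) / (2 * (e + ω)) with hσ
  have hσ0 : 0 < σ := div_pos (by linarith) (by linarith)
  have hA : 1 + σ * (ω + e * w) = 1 + g * (b + g) + (w - 1) * (σ * e) := by
    have : g * (b + g) = (e - 1) / 2 := by rw [he]; ring
    rw [this, hσ]; field_simp; ring
  have hC : 1 - σ = (e + 1 + 2 * ω) / (2 * (e + ω)) := by rw [hσ]; field_simp; ring
  have hB : 1 + σ * ω = (2 * e + ω * (e + 1)) / (2 * (e + ω)) := by rw [hσ]; field_simp; ring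
  have hD : (b + g + g) ^ 2 + 1 = 2 * e * (1 + ω) := by
    linear_combination hbω - 2 * he
  have hNum : 2 * w * g ^ 2 * (b + g) ^ 2 + 2 * (w - 1) * g * (b + g) =
      (e - 1) * (w * (e + 1) - 2) / 2 := by rw [he]; ring
  have hQ : (1 + (e - 1) * (w * (e + 1) - 2) / 2 / (2 * e * (1 + ω))) *
      ((2 * e + ω * (e + 1)) / (2 * (e + ω))) ≤
      (1 + σ * (ω + e * w)) * ((e + 1 + 2 * ω) / (2 * (e + ω))) := by
    have h1 : 1 + σ * (ω + e * w) =
        (2 * (e + ω) + (e - 1) * (ω + e * w)) / (2 * (e + ω)) := by rw [hσ]; field_simp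
    rw [one_add_div (by positivity), div_mul_div_comm, h1, div_mul_div_comm,
      div_le_div_iff₀ (by positivity) (by positivity)]
    have hd : 0 ≤ e - 1 := by linarith
    have k1 : (2 * e + ω * (e + 1)) * (e - 1) * (e + ω) ≤ 2 * e * (1 + ω) * ((e - 1) * (e + ω)) := by
      have := mul_nonneg (mul_nonneg hω.le hd) (mul_nonneg hd hew.le)
      linarith
    have k2 : (2 * e + ω * (e + 1)) * ((w - 1) * (e + 1) * (e + ω)) ≤
        2 * e * (1 + ω) * ((w - 1) * (e * (e + 1 + 2 * ω))) := by
      rw [show 2 * e * (1 + ω) * ((w - 1) * (e * (e + 1 + 2 * ω))) =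
        (2 * e * (1 + ω)) * (w - 1) * (e * (e + 1 + 2 * ω)) by ring,
        show (2 * e + ω * (e + 1)) * ((w - 1) * (e + 1) * (e + ω)) =
        (2 * e + ω * (e + 1)) * (w - 1) * ((e + 1) * (e + ω)) by ring]
      refine mul_le_mul (mul_le_mul_of_nonneg_right ?_ hw0) ?_ (by positivity) (by positivity)
      · linarith [mul_nonneg hω.le hd]
      · linarith [mul_nonneg hω.le hd]
    rw [← sub_nonneg] at k1 k2 ⊢
    have k3 := mul_nonneg (mul_nonneg (add_nonneg k1 k2) hew.le) hd
    linarith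
  rw [chernoffExponent, hC, ← hA, hD, hNum, hB, add_mul, one_mul]
  have hA0 : 0 < 1 + σ * (ω + e * w) := by positivity
  have hN0 : 0 < 1 + (e - 1) * (w * (e + 1) - 2) / 2 / (2 * e * (1 + ω)) := by
    have : 0 ≤ w * (e + 1) - 2 := by nlinarith
    have : 0 ≤ e - 1 := by linarith
    positivity
  have h := Real.log_le_log (by positivity) hQ
  rw [Real.log_mul hN0.ne' (by positivity), Real.log_mul hA0.ne' (by positivity)] at h
  linarith

/-- The two arguments of `min` are the value of the right side at `b = 1` and its limit as `b → ∞`.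
The threshold `V` enters through `b` only, so this removes it from the problem. -/
theorem min_le_of_quadratic (hg : 0 < g) (hb : 1 ≤ b) (hw : 1 ≤ w) :
    min ((w * (g + g ^ 2) ^ 2 + (w - 1) * (g + g ^ 2)) / (1 + 2 * (g + g ^ 2))) (2 * g ^ 2 * w) ≤
      (2 * w * g ^ 2 * (b + g) ^ 2 + 2 * (w - 1) * g * (b + g)) / ((b + g + g) ^ 2 + 1) := by
  set c := min ((w * (g + g ^ 2) ^ 2 + (w - 1) * (g + g ^ 2)) / (1 + 2 * (g + g ^ 2)))
    (2 * g ^ 2 * w) with hc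
  have h1 : c * (1 + 2 * (g + g ^ 2)) ≤ w * (g + g ^ 2) ^ 2 + (w - 1) * (g + g ^ 2) := by
    rw [← le_div_iff₀ (by positivity)]; exact min_le_left _ _
  have h2 : c ≤ 2 * g ^ 2 * w := min_le_right _ _
  have h3 : 0 ≤ c := by
    have : 0 ≤ w - 1 := by linarith
    rw [hc]; positivity
  rw [le_div_iff₀ (by positivity)]
  set x := b + g with hx
  set y := 1 + g with hy
  have hy0 : 0 < y := by positivity
  have hxy : y ≤ x := by linarith
  have hfy : 0 ≤ 2 * w * g ^ 2 * y ^ 2 + 2 * (w - 1) * g * y - c * ((y + g) ^ 2 + 1) := by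
    have : (y + g) ^ 2 + 1 = 2 * (1 + 2 * (g + g ^ 2)) := by rw [hy]; ring
    rw [this]
    have e2 : 2 * w * g ^ 2 * y ^ 2 + 2 * (w - 1) * g * y =
      2 * (w * (g + g ^ 2) ^ 2 + (w - 1) * (g + g ^ 2)) := by rw [hy]; ring
    linarith
  -- The quadratic at `x`, times `y`, is a nonnegative combination of its value at `y` and of `2 g²
  -- w - c ≥ 0`.
  have key : (2 * w * g ^ 2 * x ^ 2 + 2 * (w - 1) * g * x - c * ((x + g) ^ 2 + 1)) * y =
      (2 * w * g ^ 2 * y ^ 2 + 2 * (w - 1) * g * y - c * ((y + g) ^ 2 + 1)) * x +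
        (2 * g ^ 2 * w - c) * x * y * (x - y) + c * (g ^ 2 + 1) * (x - y) := by ring
  have hnn : 0 ≤ (2 * w * g ^ 2 * x ^ 2 + 2 * (w - 1) * g * x - c * ((x + g) ^ 2 + 1)) * y := by
    rw [key]
    have hx0 : 0 < x := by linarith
    have : 0 ≤ x - y := by linarith
    have : 0 ≤ 2 * g ^ 2 * w - c := by linarith
    positivity
  have := nonneg_of_mul_nonneg_left hnn hy0
  linarith

/-- The left side is the value of the right side at `b = 1`, that is, `ω = 0`; the difference has
the factor `b - 1`. -/
theorem one_add_le_half (hω : 0 < ω) (hg : 0 < g) (hb : 1 ≤ b)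
    (he : e = 1 + 2 * g * (b + g)) (hbω : b ^ 2 = 1 + 2 * ω * e) (hw : 1 ≤ w) (hw2 : w ≤ 2.2) :
    1 + (g + g ^ 2) * w ≤ 1 + g * (b + g) + (w - 1) * ((e - 1) / (2 * (e + ω)) * e) := by
  have hx : 0 < b + g := by linarith
  have he1 : 1 + 2 * g ≤ e := by rw [he]; nlinarith [mul_pos hg hg, mul_pos hg hx]
  have he0 : 0 < e := by linarith
  have hDn : 0 < 2 * e ^ 2 + b ^ 2 - 1 := by nlinarith
  have h1 : (e - 1) / (2 * (e + ω)) * e = g * ((b + g) * (2 * e ^ 2) / (2 * e ^ 2 + b ^ 2 - 1)) := by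
    have : 2 * e ^ 2 + b ^ 2 - 1 = 2 * e * (e + ω) := by linear_combination hbω
    rw [this]
    have h2 : e - 1 = 2 * g * (b + g) := by linarith
    rw [h2]
    field_simp
  rw [h1]
  obtain ⟨v, rfl⟩ : ∃ v, w = 1 + v := ⟨w - 1, by ring⟩
  have hv : 0 ≤ v := by linarith
  have hv2 : v ≤ 1.2 := by linarith
  have hpos : 0 ≤ 2 * e ^ 2 * (1 + v) + b ^ 2 - 1 - v * (1 + g) * (b + 1) := by
    have hee : (1 + g) ^ 2 ≤ e ^ 2 := by nlinarith
    have e1 : 0 ≤ 2 * e ^ 2 + b ^ 2 - 1 := hDn.le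
    have e2 : 0 ≤ 4.4 * e ^ 2 + b ^ 2 - 1 - 1.2 * (1 + g) * (b + 1) := by
      nlinarith [sq_nonneg (b - 0.6 * (1 + g)), mul_pos hg hg]
    nlinarith [mul_nonneg hv e2, mul_nonneg (sub_nonneg.2 hv2) e1]
  have h3 : 0 ≤ (b - 1) * (2 * e ^ 2 * (1 + v) + b ^ 2 - 1 - v * (1 + g) * (b + 1)) /
      (2 * e ^ 2 + b ^ 2 - 1) := div_nonneg (mul_nonneg (by linarith) hpos) hDn.le
  have h4 : (b + g) + v * ((b + g) * (2 * e ^ 2) / (2 * e ^ 2 + b ^ 2 - 1)) - (1 + g) * (1 + v) =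
      (b - 1) * (2 * e ^ 2 * (1 + v) + b ^ 2 - 1 - v * (1 + g) * (b + 1)) /
        (2 * e ^ 2 + b ^ 2 - 1) := by
    field_simp
    ring
  nlinarith [mul_nonneg hg.le (h4 ▸ h3)]

end halfTilt

/-- The inequality needed in `half_tilt_of_quarter_le` under the second alternative of
`min_le_of_quadratic`, with `r` eliminated. Logarithms are replaced by `2x / (x + 2) ≤ ln (1 + x)`.
For `g < 1 / 2` both summands are nonnegative; above that they have to be combined. -/
theorem confused_energy_bound_large {g w H : ℝ} (hg0 : 0 < g) (hg1 : g ≤ 0.6)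
    (hw : 1 + 0.3 * (0.69 + Real.log (1 + 2 * (g + g ^ 2))) * Real.log (1 + 2 * (g + g ^ 2)) ≤ w)
    (hw2 : 1 / 2 ≤ g → 1.8 ≤ w ∧ 1.669 ≤ H) (hH : 2 * g ^ 2 < H) :
    0 ≤ (H - 2 * g ^ 2) * (Real.log (1 + 2 * g ^ 2 * w) - 2 * g ^ 2) +
      2 * g ^ 2 * (Real.log (1 + (g + g ^ 2)) - 2 * g ^ 2) := by
  set p := g + g ^ 2 with hp
  have hp0 : 0 < p := by positivity
  have hw1 : 1 ≤ w := by
    have := Real.log_nonneg (show 1 ≤ 1 + 2 * p by linarith)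
    have : 0 ≤ 0.3 * (0.69 + Real.log (1 + 2 * p)) * Real.log (1 + 2 * p) := by positivity
    linarith
  have hq0 : 0 < 2 * g ^ 2 := by positivity
  have l1 := Real.le_log_one_add_of_nonneg (show 0 ≤ 2 * g ^ 2 * w by positivity)
  have l2 := Real.le_log_one_add_of_nonneg hp0.le
  rcases le_or_gt (1 / 2) g with hg | hg
  · obtain ⟨hw3, hH3⟩ := hw2 hg
    have a1 : 2 * (2 * g ^ 2 * 1.8) / (2 * g ^ 2 * 1.8 + 2) ≤
        2 * (2 * g ^ 2 * w) / (2 * g ^ 2 * w + 2) := by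
      rw [div_le_div_iff₀ (by positivity) (by positivity)]
      nlinarith [mul_nonneg hq0.le (sub_nonneg.2 hw3)]
    have a2 : 2 * (2 * g ^ 2 * 1.8) / (2 * g ^ 2 * 1.8 + 2) - 2 * g ^ 2 =
        2 * g ^ 2 * ((1.6 - 1.8 * (2 * g ^ 2)) / (2 * g ^ 2 * 1.8 + 2)) := by
      field_simp; ring
    have hg2 : g ^ 2 ≤ 0.36 := by nlinarith
    have a3 : 0 ≤ (1.6 - 1.8 * (2 * g ^ 2)) / (2 * g ^ 2 * 1.8 + 2) :=
      div_nonneg (by nlinarith) (by positivity)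
    have a4 : 0 ≤ (1.669 - 2 * g ^ 2) * ((1.6 - 1.8 * (2 * g ^ 2)) / (2 * g ^ 2 * 1.8 + 2)) +
        (2 * p / (p + 2) - 2 * g ^ 2) := by
      rw [hp]
      have : (1.669 - 2 * g ^ 2) * ((1.6 - 1.8 * (2 * g ^ 2)) / (2 * g ^ 2 * 1.8 + 2)) +
        (2 * (g + g ^ 2) / (g + g ^ 2 + 2) - 2 * g ^ 2) =
        ((1.669 - 2 * g ^ 2) * (1.6 - 1.8 * (2 * g ^ 2)) * (g + g ^ 2 + 2) +
          2 * (g + g ^ 2) * (2 * g ^ 2 * 1.8 + 2) -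
          2 * g ^ 2 * ((2 * g ^ 2 * 1.8 + 2) * (g + g ^ 2 + 2))) /
          ((2 * g ^ 2 * 1.8 + 2) * (g + g ^ 2 + 2)) := by
        field_simp
        ring
      rw [this]
      refine div_nonneg ?_ (by positivity)
      have hs : 0 ≤ 0.6 - g := by linarith
      have hs2 : 0 ≤ g - 1 / 2 := by linarith
      nlinarith [mul_nonneg hs hs2, mul_nonneg (mul_nonneg hs hs2) hg0.le,
        mul_nonneg (mul_nonneg hs hs2) (sq_nonneg g), mul_nonneg hs hg0.le,
        mul_nonneg hs (sq_nonneg g), mul_nonneg hs (pow_nonneg hg0.le 3),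
        mul_nonneg hs (pow_nonneg hg0.le 4), mul_nonneg hs (pow_nonneg hg0.le 5)]
    have b1 : 2 * g ^ 2 * ((1.6 - 1.8 * (2 * g ^ 2)) / (2 * g ^ 2 * 1.8 + 2)) ≤
        Real.log (1 + 2 * g ^ 2 * w) - 2 * g ^ 2 := by linarith
    have b2 : (1.669 - 2 * g ^ 2) * (2 * g ^ 2 * ((1.6 - 1.8 * (2 * g ^ 2)) /
        (2 * g ^ 2 * 1.8 + 2))) ≤
        (H - 2 * g ^ 2) * (Real.log (1 + 2 * g ^ 2 * w) - 2 * g ^ 2) :=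
      mul_le_mul (by linarith) b1 (by positivity) (by linarith)
    have b3 : 2 * g ^ 2 * (2 * p / (p + 2) - 2 * g ^ 2) ≤
        2 * g ^ 2 * (Real.log (1 + p) - 2 * g ^ 2) :=
      mul_le_mul_of_nonneg_left (by linarith) hq0.le
    nlinarith [mul_nonneg hq0.le a4]
  · have hl : 2 * g * 0.857 ≤ Real.log (1 + 2 * p) := by
      have := Real.le_log_one_add_of_nonneg (show 0 ≤ 2 * p by positivity)
      refine le_trans ?_ this
      rw [le_div_iff₀ (by positivity), hp]
      nlinarith [mul_pos hg0 hg0, mul_nonneg (mul_pos hg0 hg0).le (sub_nonneg.2 hg.le)]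
    have hlog : 0 ≤ Real.log (1 + 2 * g ^ 2 * w) - 2 * g ^ 2 := by
      have hwl : 1 + 0.3 * (0.69 + 2 * g * 0.857) * (2 * g * 0.857) ≤ w := by
        refine le_trans ?_ hw
        have : 0 ≤ 2 * g * 0.857 := by positivity
        have : 0 ≤ Real.log (1 + 2 * p) := by linarith
        gcongr
      have : 2 ≤ w * (2 - 2 * g ^ 2) := by
        have h2 : 0 ≤ 2 - 2 * g ^ 2 := by nlinarith
        refine le_trans ?_ (mul_le_mul_of_nonneg_right hwl h2)
        nlinarith [mul_pos hg0 hg0, mul_nonneg hg0.le (sub_nonneg.2 hg.le),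
          mul_nonneg (mul_pos hg0 hg0).le (sub_nonneg.2 hg.le),
          mul_nonneg (pow_pos hg0 3).le (sub_nonneg.2 hg.le)]
      refine sub_nonneg.2 (le_trans ?_ l1)
      rw [le_div_iff₀ (by positivity)]
      nlinarith [mul_nonneg hq0.le (sub_nonneg.2 this)]
    have hlog2 : 0 ≤ Real.log (1 + p) - 2 * g ^ 2 := by
      refine sub_nonneg.2 (le_trans ?_ l2)
      rw [le_div_iff₀ (by positivity), hp]
      nlinarith [mul_pos hg0 hg0, mul_nonneg (mul_pos hg0 hg0).le (sub_nonneg.2 hg.le),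
        mul_nonneg (pow_pos hg0 3).le (sub_nonneg.2 hg.le), mul_nonneg hg0.le (sub_nonneg.2 hg.le)]
    have : 0 ≤ H - 2 * g ^ 2 := by linarith
    positivity

/-- The companion for the first alternative of `min_le_of_quadratic`. After rational bounds on the
logarithms a quadratic form in `H` and `g` remains. -/
theorem confused_energy_bound_small {g w H : ℝ} (hg0 : 0 < g) (hg1 : g ≤ 0.6) (hH : 0 < H)
    (hw : 1 + 0.3 * (0.69 + Real.log (1 + 2 * (g + g ^ 2))) * H ≤ w) :
    0 ≤ H * (Real.log ((1 + (g + g ^ 2) * w) * (1 + (g + g ^ 2)) / (1 + 2 * (g + g ^ 2))) -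
        2 * g ^ 2) +
      2 * g ^ 2 * Real.log ((1 + 2 * (g + g ^ 2)) / (1 + (g + g ^ 2))) := by
  set p := g + g ^ 2 with hp
  have hp0 : 0 < p := by positivity
  set κ := p * (0.3 * (0.69 + 2.69 * p)) with hκ
  have hκ0 : 0 < κ := by positivity
  set D := 1 + 2 * p with hD
  have hD0 : 0 < D := by positivity
  set Z := (p ^ 2 + κ * H) / D with hZ
  have hZ0 : 0 < Z := by positivity
  have hlp : 2 * p / (1 + p) ≤ Real.log (1 + 2 * p) := by
    have := Real.le_log_one_add_of_nonneg (show 0 ≤ 2 * p by positivity)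
    refine le_trans (le_of_eq ?_) this
    field_simp
    ring
  have hZw : 1 + Z ≤ (1 + p * w) * (1 + p) / D := by
    have h1 : 1 + 0.3 * (0.69 + 2 * p / (1 + p)) * H ≤ w := by
      refine le_trans ?_ hw
      gcongr
    have h2 : κ = p * (1 + p) * (0.3 * (0.69 + 2 * p / (1 + p))) := by
      rw [hκ]; field_simp; ring
    rw [hZ, h2, one_add_div hD0.ne']
    refine div_le_div_of_nonneg_right ?_ hD0.le
    have h3 := mul_le_mul_of_nonneg_left h1 (show 0 ≤ p * (1 + p) by positivity)
    rw [hD]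
    nlinarith
  have l1 : 2 * (p ^ 2 + κ * H) / (2 * D + p ^ 2 + κ * H) ≤
      Real.log ((1 + p * w) * (1 + p) / D) := by
    refine le_trans ?_ (Real.log_le_log (by positivity) hZw)
    refine le_trans (le_of_eq ?_) (Real.le_log_one_add_of_nonneg hZ0.le)
    rw [hZ]
    field_simp
    ring
  have l2 : 2 * p / (2 + 3 * p) ≤ Real.log (D / (1 + p)) := by
    have h1 : D / (1 + p) = 1 + p / (1 + p) := by rw [hD]; field_simp; ring
    rw [h1]
    refine le_trans (le_of_eq ?_) (Real.le_log_one_add_of_nonneg (by positivity))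
    field_simp
    ring
  have hq0 : 0 < 2 * g ^ 2 := by positivity
  have hg2 : g ^ 2 ≤ 0.36 := by nlinarith
  have main : 0 ≤ H * (2 * (p ^ 2 + κ * H) / (2 * D + p ^ 2 + κ * H) - 2 * g ^ 2) +
      2 * g ^ 2 * (2 * p / (2 + 3 * p)) := by
    set a2 := (1 + g) * (0.3 * (0.69 + 2.69 * p)) * (1 - g ^ 2) with ha2
    have ha20 : 0 < a2 := by
      have : 0 < 1 - g ^ 2 := by linarith
      positivity
    set a1 := 1 + 2 * g + 3 * g ^ 2 + p ^ 2 with ha1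
    set a0 := 2 * (1 + g) * (2 + 4 * p + p ^ 2) / (2 + 3 * p) with ha0
    have ha00 : 0 < a0 := by positivity
    -- The discriminant of that quadratic is nonpositive: a polynomial inequality in `g` on `(0,
    -- 0.6]`.
    have hdisc : a1 ^ 2 ≤ 4 * a2 * a0 := by
      rw [ha0, mul_div_assoc', le_div_iff₀ (by positivity), ha1, ha2, hp]
      have hs : 0 ≤ 0.6 - g := by linarith
      have hk := fun k => mul_nonneg hs (pow_nonneg hg0.le k)
      linarith [hk 0, hk 1, hk 2, hk 3, hk 4, hk 5, hk 6, hk 7, hk 8, hk 9]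
    have hquad : 0 ≤ a2 * H ^ 2 - a1 * (g * H) + a0 * g ^ 2 := by
      nlinarith [sq_nonneg (2 * a2 * H - a1 * g), mul_nonneg (sub_nonneg.2 hdisc) (sq_nonneg g)]
    have hM : 0 < 2 * D + p ^ 2 + κ * H := by positivity
    have hid : H * (2 * (p ^ 2 + κ * H) / (2 * D + p ^ 2 + κ * H) - 2 * g ^ 2) +
        2 * g ^ 2 * (2 * p / (2 + 3 * p)) =
        2 * g * (a2 * H ^ 2 - a1 * (g * H) + a0 * g ^ 2 + g * (2 * p / (2 + 3 * p)) * (κ * H)) /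
          (2 * D + p ^ 2 + κ * H) := by
      rw [eq_div_iff hM.ne', ha0, ha1, ha2, hκ]
      field_simp
      rw [hD, hp]
      ring
    rw [hid]
    positivity
  refine main.trans (add_le_add ?_ ?_)
  · exact mul_le_mul_of_nonneg_left (by linarith) hH.le
  · exact mul_le_mul_of_nonneg_left l2 hq0.le

/-- The exponent of the union bound over the sets of `θ A` users out of `A` whose normalized fading
energy is at most `x`, obtained with the tilt `(L, β)`. -/
noncomputable def countExponent (L β θ x : ℝ) : ℝ := β * x - θ * Real.log L + logPartition L β

/-- For `θ < 1`, this is the integral of `x exp (-x)` up to the `θ`-quantile `-ln (1 - θ)` of the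
exponential law: the energy of the weakest fraction `θ` of the users. -/
theorem NoCSI.xi_one_sub (θ : ℝ) : NoCSI.xi (1 - θ) 1 = θ + (1 - θ) * Real.log (1 - θ) := by
  simp [NoCSI.xi]; ring

/-! ### Elementary bounds for the entropy and ξ -/

section entropy

variable {θ : ℝ}

theorem binEntropy_eq_log (θ : ℝ) :
    Real.binEntropy θ = -θ * Real.log θ - (1 - θ) * Real.log (1 - θ) := by
  simp [Real.binEntropy]; ring

theorem two_mul_div_le_neg_log (h0 : 0 ≤ θ) (h1 : θ < 1) :
    2 * θ / (2 - θ) ≤ -Real.log (1 - θ) := by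
  have h2 : 0 < 1 - θ := by linarith
  have h3 : 0 < 2 - θ := by linarith
  have := Real.le_log_one_add_of_nonneg (show 0 ≤ θ / (1 - θ) by positivity)
  rw [← Real.log_inv]
  refine le_trans (le_of_eq ?_) (this.trans (le_of_eq ?_))
  · field_simp; ring
  · congr 1; field_simp; ring

theorem xi_le (h0 : 0 ≤ θ) (h1 : θ < 1) : NoCSI.xi (1 - θ) 1 ≤ θ ^ 2 / (2 - θ) := by
  have h3 : 0 < 2 - θ := by linarith
  have h2 := mul_le_mul_of_nonneg_left (two_mul_div_le_neg_log h0 h1) (sub_nonneg.2 h1.le)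
  have h4 : (1 - θ) * (2 * θ / (2 - θ)) = θ - θ ^ 2 / (2 - θ) := by field_simp; ring
  rw [NoCSI.xi_one_sub]
  linarith

theorem xi_pos (h0 : 0 < θ) (h1 : θ ≤ 1) : 0 < NoCSI.xi (1 - θ) 1 := by
  rcases h1.eq_or_lt with rfl | h1
  · norm_num [NoCSI.xi]
  have h2 : 0 < 1 - θ := by linarith
  have := Real.log_lt_sub_one_of_pos (inv_pos.2 h2) (by
    intro h; rw [inv_eq_one] at h; linarith)
  rw [Real.log_inv] at this
  have h3 := mul_lt_mul_of_pos_left this h2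
  rw [mul_sub, mul_inv_cancel₀ h2.ne'] at h3
  rw [NoCSI.xi_one_sub]
  linarith

theorem xi_le_self (h0 : 0 ≤ θ) (h1 : θ ≤ 1) : NoCSI.xi (1 - θ) 1 ≤ θ := by
  rw [NoCSI.xi_one_sub]
  have := Real.log_nonpos (sub_nonneg.2 h1) (by linarith)
  nlinarith [mul_nonneg (sub_nonneg.2 h1) (neg_nonneg.2 this)]

theorem binEntropy_div (h0 : 0 < θ) :
    Real.binEntropy θ / θ = -Real.log θ + 1 - NoCSI.xi (1 - θ) 1 / θ := by
  rw [binEntropy_eq_log, NoCSI.xi_one_sub]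
  field_simp
  ring

theorem le_binEntropy_div (h0 : 0 < θ) (h1 : θ < 1) :
    -Real.log θ + 2 * (1 - θ) / (2 - θ) ≤ Real.binEntropy θ / θ := by
  have h3 : 0 < 2 - θ := by linarith
  rw [binEntropy_div h0]
  have := div_le_div_of_nonneg_right (xi_le h0.le h1) h0.le
  have h4 : θ ^ 2 / (2 - θ) / θ = 1 - 2 * (1 - θ) / (2 - θ) := by field_simp; ring
  linarith

theorem binEntropy_div_le (h0 : 1 / 4 ≤ θ) (h1 : θ < 1) : Real.binEntropy θ / θ ≤ 2.25 := by
  have hθ : 0 < θ := by linarith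
  have hτ : 0 < 1 - θ := by linarith
  -- Together the two bounds say that the entropy lies below its tangent at `1 / 4`.
  have a1 := Real.log_le_sub_one_of_pos (show 0 < 1 / 4 / θ by positivity)
  have a2 := Real.log_le_sub_one_of_pos (show 0 < 3 / 4 / (1 - θ) by positivity)
  rw [Real.log_div (by norm_num) hθ.ne'] at a1
  rw [Real.log_div (by norm_num) hτ.ne'] at a2
  have b1 := mul_le_mul_of_nonneg_left a1 hθ.le
  have b2 := mul_le_mul_of_nonneg_left a2 hτ.le
  rw [mul_sub, mul_sub, mul_div_cancel₀ _ hθ.ne'] at b1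
  rw [mul_sub, mul_sub, mul_div_cancel₀ _ hτ.ne'] at b2
  have l2 := Real.log_two_lt_d9
  have l2' := Real.log_two_gt_d9
  have l4 : Real.log 4 = 2 * Real.log 2 := by
    rw [show (4 : ℝ) = 2 ^ 2 by norm_num, Real.log_pow]; norm_num
  have l3 : 1.0985 ≤ Real.log 3 := by
    have h := Real.le_log_one_add_of_nonneg (show (0 : ℝ) ≤ 3 ^ 12 / 2 ^ 19 - 1 by norm_num)
    rw [add_sub_cancel, Real.log_div (by norm_num) (by norm_num), Real.log_pow, Real.log_pow] at h
    norm_num at h ⊢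
    linarith
  rw [Real.log_div (by norm_num) (by norm_num), Real.log_one, l4] at b1
  rw [Real.log_div (by norm_num) (by norm_num), l4] at b2
  rw [div_le_iff₀ hθ, binEntropy_eq_log]
  nlinarith

end entropy

/-! ### Three bounds for the count exponent -/

section counts

variable {θ x : ℝ}

/-- Without a tilt in the energy the optimal `L` is the odds ratio, and the plain binomial count
results. -/
theorem countExponent_uniform (h0 : 0 < θ) (h1 : θ < 1) :
    countExponent (θ / (1 - θ)) 0 θ x = Real.binEntropy θ := by
  have hτ : 0 < 1 - θ := by linarith
  have : 1 + θ / (1 - θ) = (1 - θ)⁻¹ := by field_simp; ring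
  rw [countExponent, logPartition_zero, this, Real.log_inv, Real.log_div h0.ne' hτ.ne',
    binEntropy_eq_log]
  ring

/-- The left side is the error term of `logPartition_le_of_kink` at `β = 2 / θ` and `T = -ln (1 -
θ)`. -/
theorem kink_error_le (h0 : 0 < θ) (h1 : θ < 1) :
    4 * θ * (1 - θ) / (4 - θ ^ 2) ≤ 0.4 * Real.binEntropy θ := by
  have hτ : 0 < 1 - θ := by linarith
  have h2 : 0 < 2 - θ := by linarith
  have h4 : 0 < 4 - θ ^ 2 := by nlinarith
  have hl : 2 * (1 - θ) / (1 + θ) ≤ -Real.log θ := by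
    have := two_mul_div_le_neg_log hτ.le (by linarith : 1 - θ < 1)
    rwa [show 2 - (1 - θ) = 1 + θ by ring, sub_sub_cancel] at this
  suffices h : 4 * θ / (4 - θ ^ 2) ≤ 0.4 * (2 * θ / (1 + θ) + -Real.log (1 - θ)) by
    have e1 := mul_le_mul_of_nonneg_left h hτ.le
    have e2 := mul_le_mul_of_nonneg_left hl h0.le
    rw [binEntropy_eq_log]
    have e3 : (1 - θ) * (2 * θ / (1 + θ)) = θ * (2 * (1 - θ) / (1 + θ)) := by ring
    have e4 : (1 - θ) * (4 * θ / (4 - θ ^ 2)) = 4 * θ * (1 - θ) / (4 - θ ^ 2) := by ring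
    linarith
  rcases le_or_gt θ (1 / 2) with hh | hh
  · have hT := two_mul_div_le_neg_log h0.le h1
    refine le_trans ?_ (mul_le_mul_of_nonneg_left (add_le_add_right hT _) (by norm_num))
    rw [div_add_div _ _ (by positivity) h2.ne', mul_div_assoc', div_le_div_iff₀ h4 (by positivity)]
    have : 0 ≤ θ * (2 - θ) * (1 / 2 - θ) := by
      have : 0 ≤ 1 / 2 - θ := by linarith
      positivity
    nlinarith
  · have h3 : 0 < 3 - 2 * θ := by linarith
    have hT : 0.693 + 2 * (2 * θ - 1) / (3 - 2 * θ) ≤ -Real.log (1 - θ) := by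
      have := two_mul_div_le_neg_log (show 0 ≤ 2 * θ - 1 by linarith) (by linarith)
      rw [show 2 - (2 * θ - 1) = 3 - 2 * θ by ring,
        show 1 - (2 * θ - 1) = 2 * (1 - θ) by ring, Real.log_mul (by norm_num) hτ.ne'] at this
      have := Real.log_two_gt_d9
      linarith
    refine le_trans ?_ (mul_le_mul_of_nonneg_left (add_le_add_right hT _) (by norm_num))
    rw [show 2 * θ / (1 + θ) + (0.693 + 2 * (2 * θ - 1) / (3 - 2 * θ)) =
      (2 * θ * (3 - 2 * θ) + 0.693 * ((1 + θ) * (3 - 2 * θ)) + 2 * (2 * θ - 1) * (1 + θ)) /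
        ((1 + θ) * (3 - 2 * θ)) by field_simp; ring, mul_div_assoc',
      div_le_div_iff₀ h4 (by positivity)]
    have u0 : 0 ≤ θ - 1 / 2 := by linarith
    nlinarith [mul_nonneg u0 hτ.le, mul_nonneg (mul_nonneg u0 hτ.le) u0,
      mul_nonneg (mul_nonneg u0 hτ.le) hτ.le, mul_nonneg (mul_nonneg u0 hτ.le) (mul_nonneg u0 hτ.le),
      sq_nonneg (θ - 0.7), sq_nonneg ((θ - 0.7) * θ)]

/-- The kink sits at the `θ`-quantile, so the leading terms combine to `β (x - ξ)`. At the least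
energy at most 0.4 of the full entropy is left, and the growth in `x / ξ` is affine, to be matched
with a concave Chernoff exponent. -/
theorem countExponent_kink_le (h0 : 0 < θ) (h1 : θ < 1) (hx : NoCSI.xi (1 - θ) 1 ≤ x) :
    countExponent (Real.exp (2 / θ * -Real.log (1 - θ))) (2 / θ) θ x ≤
      θ * (0.4 * (Real.binEntropy θ / θ) + 2 / (2 - θ) * (x / NoCSI.xi (1 - θ) 1 - 1)) := by
  have hτ : 0 < 1 - θ := by linarith
  have h2 : 0 < 2 - θ := by linarith
  have h4 : 0 < 4 - θ ^ 2 := by nlinarith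
  have hξ := xi_pos h0 h1.le
  have hT : 0 ≤ -Real.log (1 - θ) := by
    have := Real.log_nonpos hτ.le (by linarith); linarith
  have hk := logPartition_le_of_kink hT (show 1 < 2 / θ by rw [lt_div_iff₀ h0]; linarith)
  have hF := kink_error_le h0 h1
  rw [neg_neg, Real.exp_log hτ] at hk
  have hF' : (1 - θ) * (2 * (2 / θ) / ((2 / θ) ^ 2 - 1)) = 4 * θ * (1 - θ) / (4 - θ ^ 2) := by
    have : (2 / θ) ^ 2 - 1 = (4 - θ ^ 2) / θ ^ 2 := by field_simp; ring
    rw [this]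
    field_simp
    ring
  rw [hF'] at hk
  have hid : 2 / θ * x - θ * (2 / θ * -Real.log (1 - θ)) +
      2 / θ * (-Real.log (1 - θ) - 1 + (1 - θ)) = 2 / θ * (x - NoCSI.xi (1 - θ) 1) := by
    rw [NoCSI.xi_one_sub]; ring
  have hw : 0 ≤ x / NoCSI.xi (1 - θ) 1 - 1 := by rw [sub_nonneg, le_div_iff₀ hξ]; linarith
  have hid2 : 2 / θ * (x - NoCSI.xi (1 - θ) 1) =
      2 / θ * NoCSI.xi (1 - θ) 1 * (x / NoCSI.xi (1 - θ) 1 - 1) := by field_simp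
  have h5 : 2 / θ * NoCSI.xi (1 - θ) 1 ≤ θ * (2 / (2 - θ)) := by
    refine (mul_le_mul_of_nonneg_left (xi_le h0.le h1) (by positivity)).trans (le_of_eq ?_)
    field_simp
  have h6 := mul_le_mul_of_nonneg_right h5 hw
  have h7 : θ * (0.4 * (Real.binEntropy θ / θ)) = 0.4 * Real.binEntropy θ := by field_simp
  rw [countExponent, Real.log_exp, mul_add, h7]
  linarith

/-- The weight `L exp (-β y)` is the likelihood ratio of exponential laws with mean `x / θ` for
missed users and `(1 - x) / (1 - θ)` for the others, mixed with weights `θ` and `1 - θ`. The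
constant 1.31 rounds up `2 - ln 2`. -/
theorem countExponent_tilt_le (h0 : 0 < θ) (h1 : θ < 1) (hx : NoCSI.xi (1 - θ) 1 ≤ x)
    (hx' : x ≤ θ) :
    0 ≤ θ / x - (1 - θ) / (1 - x) ∧
    countExponent (θ ^ 2 * (1 - x) / ((1 - θ) ^ 2 * x)) (θ / x - (1 - θ) / (1 - x)) θ x ≤
      θ * (1.31 - θ + Real.log (x / NoCSI.xi (1 - θ) 1)) := by
  have hτ : 0 < 1 - θ := by linarith
  have h2 : 0 < 2 - θ := by linarith
  have hξ := xi_pos h0 h1.le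
  have hx0 : 0 < x := hξ.trans_le hx
  have hx1 : 0 < 1 - x := by linarith
  have hβ : 0 ≤ θ / x - (1 - θ) / (1 - x) := by
    rw [sub_nonneg, div_le_div_iff₀ hx1 hx0]; nlinarith
  refine ⟨hβ, ?_⟩
  have hγ0 : 0 ≤ 1 - (1 - θ) / (1 - x) := by rw [sub_nonneg, div_le_one hx1]; linarith
  have hγ1 : 1 - (1 - θ) / (1 - x) < 1 := by have : 0 < (1 - θ) / (1 - x) := by positivity
                                             linarith
  have hk := logPartition_le_of_tilt (show 0 < θ ^ 2 * (1 - x) / ((1 - θ) ^ 2 * x) by positivity)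
    hβ hγ0 hγ1
  have e1 : (1 - (1 - (1 - θ) / (1 - x)))⁻¹ + θ ^ 2 * (1 - x) / ((1 - θ) ^ 2 * x) *
      (1 - (1 - (1 - θ) / (1 - x)) + (θ / x - (1 - θ) / (1 - x)))⁻¹ = (1 - x) / (1 - θ) ^ 2 := by
    rw [show 1 - (1 - (1 - θ) / (1 - x)) + (θ / x - (1 - θ) / (1 - x)) = θ / x by ring,
      sub_sub_cancel]
    field_simp
    ring
  rw [e1, Real.log_div hx1.ne' (by positivity), Real.log_pow] at hk
  have e2 : (θ / x - (1 - θ) / (1 - x)) * x + -(1 - (1 - θ) / (1 - x)) = 0 := by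
    field_simp; ring
  have hl : Real.log (1 - x) ≤ -NoCSI.xi (1 - θ) 1 := by
    have := Real.log_le_sub_one_of_pos hx1; linarith
  have hG0 : 0 < NoCSI.xi (1 - θ) 1 / θ ^ 2 := by positivity
  have hG : (2 - θ) * (NoCSI.xi (1 - θ) 1 / θ ^ 2) ≤ 1 := by
    rw [mul_div_assoc', div_le_one (by positivity)]
    have := xi_le h0.le h1
    rw [le_div_iff₀ h2] at this
    linarith
  have hlG := Real.log_le_sub_one_of_pos (show 0 < 2 * (NoCSI.xi (1 - θ) 1 / θ ^ 2) by positivity)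
  rw [Real.log_mul (by norm_num) hG0.ne', Real.log_div hξ.ne' (by positivity), Real.log_pow] at hlG
  have hxi := NoCSI.xi_one_sub θ
  obtain ⟨G, hGd⟩ : ∃ G, G = NoCSI.xi (1 - θ) 1 / θ ^ 2 := ⟨_, rfl⟩
  have hGξ : NoCSI.xi (1 - θ) 1 = θ ^ 2 * G := by rw [hGd]; field_simp
  rw [← hGd] at hG0 hG hlG
  have l2 := Real.log_two_gt_d9
  rw [countExponent, Real.log_div (by positivity) (by positivity), Real.log_mul (by positivity)
    hx1.ne', Real.log_mul (by positivity) hx0.ne', Real.log_pow, Real.log_pow,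
    Real.log_div hx0.ne' hξ.ne']
  push_cast at hk hlG ⊢
  have hl' := mul_le_mul_of_nonneg_left hl hτ.le
  have hG' := mul_le_mul_of_nonneg_left hG (mul_pos h0 hτ).le
  have hlG' := mul_le_mul_of_nonneg_left hlG h0.le
  have l2' := mul_le_mul_of_nonneg_left l2.le h0.le
  rw [hGξ] at hl' hxi
  have hτlog : (1 - θ) * Real.log (1 - θ) = θ ^ 2 * G - θ := by linarith
  have : (0 : ℝ) ≤ θ := h0.le
  nlinarith [hk, e2, hl', hG', hlG', l2', hτlog]

end counts

/-! ### Dependence of the Chernoff exponent on the energy -/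

section chernoff

variable {r ω e σ w w₁ : ℝ}

theorem chernoffExponent_mono (hr : 0 ≤ r) (hω : 0 ≤ ω) (he : 0 ≤ e) (hσ : 0 ≤ σ) (hw : 0 ≤ w)
    (h : w ≤ w₁) : chernoffExponent r ω e σ w ≤ chernoffExponent r ω e σ w₁ := by
  have h1 : 1 + σ * (ω + e * w) ≤ 1 + σ * (ω + e * w₁) := by gcongr
  have := mul_le_mul_of_nonneg_left (Real.log_le_log (by positivity) h1)
    (by linarith : 0 ≤ 1 + r)
  rw [chernoffExponent, chernoffExponent]
  linarith

/-- Concavity of the logarithm along the segment `[1, w₁]`. -/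
theorem chernoffExponent_concave (hr : 0 ≤ r) (hω : 0 ≤ ω) (he : 0 ≤ e) (hσ : 0 ≤ σ)
    (hw₁ : 1 ≤ w₁) {t : ℝ} (ht : 0 ≤ t) (ht1 : t ≤ 1) :
    (1 - t) * chernoffExponent r ω e σ 1 + t * chernoffExponent r ω e σ w₁ ≤
      chernoffExponent r ω e σ ((1 - t) * 1 + t * w₁) := by
  have h := strictConcaveOn_log_Ioi.concaveOn.2 (x := 1 + σ * (ω + e * 1))
    (y := 1 + σ * (ω + e * w₁)) (by simp only [Set.mem_Ioi]; positivity)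
    (by simp only [Set.mem_Ioi]; positivity) (sub_nonneg.2 ht1) ht (by ring)
  simp only [smul_eq_mul] at h
  rw [show (1 - t) * (1 + σ * (ω + e * 1)) + t * (1 + σ * (ω + e * w₁)) =
    1 + σ * (ω + e * ((1 - t) * 1 + t * w₁)) by ring] at h
  have := mul_le_mul_of_nonneg_left h (by linarith : 0 ≤ 1 + r)
  simp only [chernoffExponent]
  linarith

/-- Concavity gives `ln (1 - l + l w) ≥ l ln w`, and the condition says `(1 + r) l ≥ r`. -/
theorem chernoffExponent_one_add_log_le (hr : 0 ≤ r) (hω : 0 ≤ ω) (he : 0 ≤ e) (hσ : 0 ≤ σ)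
    (hw : 1 ≤ w) (h : r * (1 + σ * ω) ≤ σ * e) :
    chernoffExponent r ω e σ 1 + r * Real.log w ≤ chernoffExponent r ω e σ w := by
  have hA : 0 < 1 + σ * ω := by positivity
  have hAB : 0 < 1 + σ * (ω + e * 1) := by positivity
  have hABw : 0 < 1 + σ * (ω + e * w) := by positivity
  set l := σ * e / (1 + σ * (ω + e * 1)) with hl
  have hl0 : 0 ≤ l := by positivity
  have hl1 : l ≤ 1 := by rw [hl, div_le_one hAB]; nlinarith
  have hc := strictConcaveOn_log_Ioi.concaveOn.2 (x := 1) (y := w) (by simp)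
    (by simp only [Set.mem_Ioi]; linarith) (sub_nonneg.2 hl1) hl0 (by ring)
  simp only [smul_eq_mul, Real.log_one, mul_zero, zero_add, mul_one] at hc
  have hid : 1 - l + l * w = (1 + σ * (ω + e * w)) / (1 + σ * (ω + e * 1)) := by
    rw [hl]; field_simp; ring
  rw [hid, Real.log_div hABw.ne' hAB.ne'] at hc
  have hlr : r ≤ (1 + r) * l := by
    rw [hl, mul_div_assoc', le_div_iff₀ hAB]; nlinarith
  have := mul_le_mul_of_nonneg_right hlr (Real.log_nonneg hw)
  have := mul_le_mul_of_nonneg_left hc (by linarith : 0 ≤ 1 + r)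
  simp only [chernoffExponent]
  linarith

end chernoff

/-! ### The half tilt against the count -/

section halfTilt

variable {r ω e g b w H θ : ℝ}

theorem half_tilt_mono_cond (hω : 0 < ω) (hg : 0 < g) (hg1 : g ≤ 0.77) (hb : 1 ≤ b)
    (he : e = 1 + 2 * g * (b + g)) (hbω : b ^ 2 = 1 + 2 * ω * e) (hH : 2.24 ≤ H)
    (hr : r * (H - 2 * g ^ 2) = 2 * g ^ 2) :
    r * (1 + (e - 1) / (2 * (e + ω)) * ω) ≤ (e - 1) / (2 * (e + ω)) * e := by
  have hX : 1 + g ≤ b + g := by linarith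
  have hX0 : 0 < b + g := by linarith
  have he1 : 1 < e := by rw [he]; nlinarith [mul_pos hg hX0]
  have hew : 0 < e + ω := by linarith
  have hg2 : g ^ 2 ≤ 0.5929 := by nlinarith
  have hHq : 1.05 ≤ H - 2 * g ^ 2 := by linarith
  have hD : (b + g + g) ^ 2 + 1 = 2 * e * (1 + ω) := by linear_combination hbω - 2 * he
  obtain ⟨X, hXd⟩ : ∃ X, X = b + g := ⟨_, rfl⟩
  rw [← hXd] at hX hX0 he hD
  have h1 : (X + g) * (1 + g) ≤ X * (1 + 2 * g) := by nlinarith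
  have h2 : (X + g) ^ 2 * (1 + g) ^ 2 ≤ X ^ 2 * (1 + 2 * g) ^ 2 := by
    have := pow_le_pow_left₀ (by positivity) h1 2
    linarith
  have h3 : (1 + 2 * g) ^ 2 ≤ 2 * (H - 2 * g ^ 2) * (1 + g) ^ 2 := by
    have := mul_nonneg (sq_nonneg (1 + g)) (sub_nonneg.2 hHq)
    have : (1 + 2 * g) ^ 2 ≤ 2.1 * (1 + g) ^ 2 := by
      nlinarith [mul_nonneg hg.le (sub_nonneg.2 hg1)]
    linarith
  have h4 : (X + g) ^ 2 ≤ 2 * (H - 2 * g ^ 2) * X ^ 2 := by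
    have h5 : (X + g) ^ 2 * (1 + g) ^ 2 ≤ (2 * (H - 2 * g ^ 2) * X ^ 2) * (1 + g) ^ 2 := by
      linarith [mul_le_mul_of_nonneg_left h3 (sq_nonneg X)]
    exact le_of_mul_le_mul_right h5 (by positivity)
  have h5 : g ≤ (H - 2 * g ^ 2) * X := by linarith [mul_le_mul hHq hX (by linarith) (by linarith)]
  have h6 : g * ((X + g) ^ 2 + 1) ≤ (H - 2 * g ^ 2) * X * e := by
    rw [he]
    linarith [mul_le_mul_of_nonneg_left h4 hg.le]
  have h7 : 2 * e + ω * (e + 1) ≤ (X + g) ^ 2 + 1 := by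
    rw [hD]; nlinarith [mul_nonneg hω.le (sub_nonneg.2 he1.le)]
  have h8 : 2 * g ^ 2 * (2 * e + ω * (e + 1)) ≤ (H - 2 * g ^ 2) * (e * (e - 1)) := by
    have h9 : e - 1 = 2 * g * X := by linarith
    rw [h9]
    linarith [mul_le_mul_of_nonneg_left h7 (sq_nonneg g), mul_le_mul_of_nonneg_left h6 hg.le]
  have h10 : r * (2 * e + ω * (e + 1)) ≤ e * (e - 1) := by
    have h11 : (H - 2 * g ^ 2) * (r * (2 * e + ω * (e + 1))) ≤ (H - 2 * g ^ 2) * (e * (e - 1)) := by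
      rw [← mul_assoc, mul_comm _ r, hr]; exact h8
    exact le_of_mul_le_mul_left h11 (by linarith)
  have e1 : 1 + (e - 1) / (2 * (e + ω)) * ω = (2 * e + ω * (e + 1)) / (2 * (e + ω)) := by
    field_simp; ring
  rw [e1, mul_div_assoc', div_mul_eq_mul_div]
  exact div_le_div_of_nonneg_right (by linarith) (by positivity)

/-- The exponent of the half tilt at relative energy `1`, in units of `r`. -/
theorem half_tilt_at_one (hr0 : 0 ≤ r) (hω : 0 < ω) (hg : 0 < g) (hb : 1 ≤ b)
    (he : e = 1 + 2 * g * (b + g)) (hbω : b ^ 2 = 1 + 2 * ω * e)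
    (hr : r * (H - 2 * g ^ 2) = 2 * g ^ 2) :
    r * (H * ((1 + g) ^ 2 / (2 + 4 * (g + g ^ 2) + (g + g ^ 2) ^ 2)) +
      2 * (g + g ^ 2) / (2 + 3 * (g + g ^ 2))) ≤
      chernoffExponent r ω e ((e - 1) / (2 * (e + ω))) 1 := by
  have h := le_chernoffExponent_half (r := r) hω hg hb he hbω le_rfl
  have hm := min_le_of_quadratic hg hb le_rfl
  refine le_trans ?_ h
  set p := g + g ^ 2 with hp
  have hp0 : 0 < p := by positivity
  simp only [sub_self, zero_mul, add_zero, mul_one, one_mul, mul_zero] at hm ⊢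
  have h1 : p ^ 2 / (1 + 2 * p) ≤ 2 * g ^ 2 := by
    rw [div_le_iff₀ (by positivity), hp]
    nlinarith [pow_pos hg 2, pow_pos hg 3, pow_pos hg 4]
  rw [min_eq_left h1] at hm
  have h2 : 1 + p ≤ 1 + g * (b + g) := by rw [hp]; nlinarith
  have l1 := mul_le_mul_of_nonneg_left (Real.log_le_log (by positivity) h2) hr0
  have l2 := Real.log_le_log (by positivity) (add_le_add_right hm 1)
  have a1 : Real.log (1 + p) = Real.log (1 + p ^ 2 / (1 + 2 * p)) +
      Real.log (1 + p / (1 + p)) := by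
    rw [← Real.log_mul (by positivity) (by positivity)]
    congr 1; field_simp; ring
  have a2 := Real.le_log_one_add_of_nonneg (show 0 ≤ p ^ 2 / (1 + 2 * p) by positivity)
  have a3 := Real.le_log_one_add_of_nonneg (show 0 ≤ p / (1 + p) by positivity)
  have a4 : 2 * (p / (1 + p)) / (p / (1 + p) + 2) = 2 * p / (2 + 3 * p) := by field_simp; ring
  have a5 : 2 * (p ^ 2 / (1 + 2 * p)) / (p ^ 2 / (1 + 2 * p) + 2) =
      2 * g ^ 2 * ((1 + g) ^ 2 / (2 + 4 * p + p ^ 2)) := by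
    have : p ^ 2 = g ^ 2 * (1 + g) ^ 2 := by rw [hp]; ring
    field_simp
    rw [this]
    ring
  rw [a4] at a3
  rw [a5, ← hr] at a2
  have a6 : r * (H * ((1 + g) ^ 2 / (2 + 4 * p + p ^ 2))) =
      r * (2 * g ^ 2 * ((1 + g) ^ 2 / (2 + 4 * p + p ^ 2))) +
        r * (H - 2 * g ^ 2) * ((1 + g) ^ 2 / (2 + 4 * p + p ^ 2)) := by ring
  have a7 := mul_le_mul_of_nonneg_left a3 hr0
  have a8 : r * (2 * g ^ 2 * ((1 + g) ^ 2 / (2 + 4 * p + p ^ 2))) ≤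
      r * Real.log (1 + p ^ 2 / (1 + 2 * p)) := by
    refine mul_le_mul_of_nonneg_left ?_ hr0
    rw [← a5]
    exact Real.le_log_one_add_of_nonneg (by positivity)
  rw [a1] at l1
  rw [mul_add, a6]
  linarith

/-- The exponent grows at least like `r ln w`, as does the Jensen bound on the count, so the
comparison reduces to `w = 1`. There the entropy per missed user is large because `θ` is small. -/
theorem half_tilt_of_le_quarter (h0 : 0 < θ) (h1 : θ ≤ 1 / 4) (hr0 : 0 < r) (hω : 0 < ω)
    (hg : 0 < g) (hb : 1 ≤ b) (he : e = 1 + 2 * g * (b + g)) (hbω : b ^ 2 = 1 + 2 * ω * e)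
    (hr : r * (Real.binEntropy θ / θ - 2 * g ^ 2) = 2 * g ^ 2) (hlog : Real.log e < 1.31 - θ)
    (hw : 1 ≤ w) :
    r * (1.31 - θ + Real.log w) ≤ chernoffExponent r ω e ((e - 1) / (2 * (e + ω))) w := by
  have he1 : 1 + 2 * (g + g ^ 2) ≤ e := by rw [he]; nlinarith
  have he0 : 1 < e := by nlinarith
  have hlog2 : 1.31 ≤ Real.log 3.72 := by
    have := Real.one_sub_inv_le_log_of_pos (show (0 : ℝ) < 3.72 / 2 ^ 2 by norm_num)
    rw [Real.log_div (by norm_num) (by norm_num), Real.log_pow] at this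
    have := Real.log_two_gt_d9
    norm_num at *
    linarith
  have he2 : e < 3.72 := by
    by_contra! h
    have := Real.log_le_log (by norm_num) h
    linarith
  have hg1 : g ≤ 0.77 := by nlinarith
  have hH : 2.24 + 4.5 * (1 / 4 - θ) ≤ Real.binEntropy θ / θ := by
    have h2 : 0 < 2 - θ := by linarith
    have a1 := le_binEntropy_div h0 (by linarith)
    have a2 := Real.log_le_sub_one_of_pos (show 0 < 2 ^ 2 * θ by positivity)
    rw [Real.log_mul (by norm_num) h0.ne', Real.log_pow] at a2
    have a3 : 0.855 + 0.5 * (1 / 4 - θ) ≤ 2 * (1 - θ) / (2 - θ) := by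
      rw [le_div_iff₀ h2]; nlinarith
    have := Real.log_two_gt_d9
    push_cast at a2
    linarith
  set H := Real.binEntropy θ / θ
  have hm := chernoffExponent_one_add_log_le hr0.le hω.le (by linarith)
    (div_nonneg (by linarith) (by linarith)) hw
    (half_tilt_mono_cond hω hg hg1 hb he hbω (by linarith) hr)
  have h1' := half_tilt_at_one hr0.le hω hg hb he hbω hr
  -- The slope 4.5 in `hH` is cancelled by the factor, which is at least `1 / 4.5`. What remains is
  -- the case `θ = 1 / 4`, where `1.31 - θ = 1.06`.
  have hfin : 1.31 - θ ≤ H * ((1 + g) ^ 2 / (2 + 4 * (g + g ^ 2) + (g + g ^ 2) ^ 2)) +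
      2 * (g + g ^ 2) / (2 + 3 * (g + g ^ 2)) := by
    set p := g + g ^ 2 with hp
    have hp0 : 0 < p := by positivity
    have hQ : 1 / 4.5 ≤ (1 + g) ^ 2 / (2 + 4 * p + p ^ 2) := by
      rw [div_le_div_iff₀ (by norm_num) (by positivity), hp]
      nlinarith [mul_nonneg hg.le (sub_nonneg.2 hg1), mul_nonneg (sq_nonneg g) (sub_nonneg.2 hg1),
        mul_nonneg (pow_pos hg 3).le (sub_nonneg.2 hg1)]
    have hP : 1.06 ≤ 2.24 * ((1 + g) ^ 2 / (2 + 4 * p + p ^ 2)) + 2 * p / (2 + 3 * p) := by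
      rw [mul_div_assoc', div_add_div _ _ (by positivity) (by positivity),
        le_div_iff₀ (by positivity), hp]
      have hk := fun k => mul_nonneg (sub_nonneg.2 hg1) (pow_nonneg hg.le k)
      nlinarith [hk 0, hk 1, hk 2, hk 3, hk 4, hk 5]
    have := mul_le_mul_of_nonneg_right hH (show 0 ≤ (1 + g) ^ 2 / (2 + 4 * p + p ^ 2) by positivity)
    have := mul_le_mul_of_nonneg_left hQ (show 0 ≤ 4.5 * (1 / 4 - θ) by linarith)
    linarith
  have := mul_le_mul_of_nonneg_left hfin hr0.le
  linarith

theorem le_log_five_halves : 0.9162 ≤ Real.log 2.5 := by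
  have l2 := Real.log_two_gt_d9
  have := Real.le_log_one_add_of_nonneg (show (0 : ℝ) ≤ (5 / 2) ^ 28 / 2 ^ 37 - 1 by norm_num)
  rw [add_sub_cancel, Real.log_div (by norm_num) (by norm_num), Real.log_pow,
    Real.log_pow] at this
  norm_num at this ⊢
  linarith

theorem le_binEntropy_div_of_le (h0 : 0 < θ) (h1 : θ ≤ 0.3938) :
    1.669 ≤ Real.binEntropy θ / θ := by
  have a1 := le_binEntropy_div h0 (by linarith)
  have a2 : Real.log 2.5 ≤ -Real.log θ := by
    rw [← Real.log_inv]
    refine Real.log_le_log (by norm_num) ?_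
    rw [le_inv_comm₀ (by norm_num) h0]
    norm_num at h1 ⊢
    linarith
  have a3 : 0.754 ≤ 2 * (1 - θ) / (2 - θ) := by
    rw [le_div_iff₀ (by linarith)]; linarith
  have := le_log_five_halves
  linarith

set_option maxHeartbeats 600000 in
-- These are the end points of a chord: at `w = 1` the exponent covers what the kink bound leaves of
-- the entropy, and at the second point it covers the full entropy.
theorem half_tilt_of_quarter_le (h0 : 1 / 4 ≤ θ) (h1 : θ < 1) (hr0 : 0 < r) (hω : 0 < ω)
    (hg : 0 < g) (hb : 1 ≤ b) (he : e = 1 + 2 * g * (b + g)) (hbω : b ^ 2 = 1 + 2 * ω * e)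
    (hr : r * (H - 2 * g ^ 2) = 2 * g ^ 2) (hH : H = Real.binEntropy θ / θ)
    (hlog : Real.log e < 1.31 - θ) (hlogH : Real.log e < H) :
    0.4 * (r * H) ≤ chernoffExponent r ω e ((e - 1) / (2 * (e + ω))) 1 ∧
      r * H ≤ chernoffExponent r ω e ((e - 1) / (2 * (e + ω))) (1 + 0.3 * (2 - θ) * H) := by
  have he1 : 1 + 2 * (g + g ^ 2) ≤ e := by rw [he]; nlinarith
  have he0 : 1 < e := by nlinarith
  have l2 := Real.log_two_gt_d9
  have hlog2 : 1.06 ≤ Real.log 2.9 := by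
    have := Real.le_log_one_add_of_nonneg (show (0 : ℝ) ≤ 2.9 / 2 - 1 by norm_num)
    rw [add_sub_cancel, Real.log_div (by norm_num) (by norm_num)] at this
    norm_num at *
    linarith
  have he2 : e < 2.9 := by
    by_contra! h
    have := Real.log_le_log (by norm_num) h
    linarith
  have hg1 : g ≤ 0.6 := by nlinarith
  have hH2 : H ≤ 2.25 := hH ▸ binEntropy_div_le h0 h1
  have hHq : 0 < H - 2 * g ^ 2 := by
    by_contra! h
    nlinarith [mul_nonneg hr0.le (neg_nonneg.2 h), pow_pos hg 2]
  have hH0 : 0 < H := by nlinarith [pow_pos hg 2]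
  have hlp : Real.log (1 + 2 * (g + g ^ 2)) ≤ Real.log e := Real.log_le_log (by positivity) he1
  have hlp0 : 0 ≤ Real.log (1 + 2 * (g + g ^ 2)) := Real.log_nonneg (by nlinarith)
  constructor
  · refine le_trans ?_ (half_tilt_at_one hr0.le hω hg hb he hbω hr)
    rw [mul_left_comm]
    refine mul_le_mul_of_nonneg_left ?_ hr0.le
    set p := g + g ^ 2 with hp
    have hp0 : 0 < p := by positivity
    have hP : 0.9 ≤ 2.25 * ((1 + g) ^ 2 / (2 + 4 * p + p ^ 2)) + 2 * p / (2 + 3 * p) := by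
      rw [mul_div_assoc', div_add_div _ _ (by positivity) (by positivity),
        le_div_iff₀ (by positivity), hp]
      have hk := fun k => mul_nonneg (sub_nonneg.2 hg1) (pow_nonneg hg.le k)
      nlinarith [hk 0, hk 1, hk 2, hk 3, hk 4, hk 5]
    have hR : 0 < 2 * p / (2 + 3 * p) := by positivity
    rcases le_total 0.4 ((1 + g) ^ 2 / (2 + 4 * p + p ^ 2)) with h | h
    · have := mul_le_mul_of_nonneg_left h hH0.le
      linarith
    · have := mul_le_mul_of_nonneg_right hH2 (sub_nonneg.2 h)
      linarith
  · set w := 1 + 0.3 * (2 - θ) * H with hw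
    have hc : 0.3 * (0.69 + Real.log (1 + 2 * (g + g ^ 2))) ≤ 0.3 * (2 - θ) := by linarith
    have hw1 : 1 ≤ w := by
      have : 0 ≤ 0.3 * (2 - θ) * H := mul_nonneg (by linarith) hH0.le
      linarith
    have hw2 : w ≤ 2.2 := by
      have : 0.3 * (2 - θ) * H ≤ 0.3 * (2 - 1 / 4) * 2.25 := by
        refine mul_le_mul (by linarith) hH2 hH0.le (by norm_num)
      rw [hw]; norm_num at this ⊢; linarith
    have h := le_chernoffExponent_half (r := r) hω hg hb he hbω hw1
    have hm := min_le_of_quadratic hg hb hw1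
    have hone := one_add_le_half hω hg hb he hbω hw1 hw2
    refine le_trans ?_ h
    set N := (2 * w * g ^ 2 * (b + g) ^ 2 + 2 * (w - 1) * g * (b + g)) / ((b + g + g) ^ 2 + 1)
    have hp0 : 0 < g + g ^ 2 := by positivity
    have l1 := mul_le_mul_of_nonneg_left (Real.log_le_log (by positivity) hone) hr0.le
    suffices hs : r * H ≤ r * Real.log (1 + (g + g ^ 2) * w) + Real.log (1 + N) by linarith
    -- Multiplying by `H - 2 g²` turns `r` into `2 g²` by `hr`, so that only `g`, `w` and `H`
    -- remain.
    suffices hs : (H - 2 * g ^ 2) * (r * H) ≤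
        (H - 2 * g ^ 2) * (r * Real.log (1 + (g + g ^ 2) * w) + Real.log (1 + N)) from
      le_of_mul_le_mul_left hs hHq
    have hrw : ∀ y, (H - 2 * g ^ 2) * (r * y) = 2 * g ^ 2 * y := fun y => by linear_combination y * hr
    rw [mul_add, hrw, hrw]
    rcases min_le_iff.1 hm with hN | hN
    · have hN' : (1 + (g + g ^ 2) * w) * (1 + (g + g ^ 2)) / (1 + 2 * (g + g ^ 2)) ≤ 1 + N := by
        refine le_trans (le_of_eq ?_) (add_le_add_right hN 1)
        field_simp
        ring
      have hA := confused_energy_bound_small hg hg1 hH0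
        (show 1 + 0.3 * (0.69 + Real.log (1 + 2 * (g + g ^ 2))) * H ≤ w from
          add_le_add_right (mul_le_mul_of_nonneg_right hc hH0.le) 1)
      have l3 := Real.log_le_log (by positivity) hN'
      have l4 := mul_le_mul_of_nonneg_left l3 hHq.le
      have l5 : Real.log ((1 + (g + g ^ 2) * w) * (1 + (g + g ^ 2)) / (1 + 2 * (g + g ^ 2))) +
          Real.log ((1 + 2 * (g + g ^ 2)) / (1 + (g + g ^ 2))) =
          Real.log (1 + (g + g ^ 2) * w) := by
        rw [← Real.log_mul (by positivity) (by positivity)]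
        congr 1; field_simp
      rw [← l5]
      linarith
    · have hlarge : 1 / 2 ≤ g → 1.8 ≤ w ∧ 1.669 ≤ H := by
        intro hg5
        have h5 : 2.5 ≤ 1 + 2 * (g + g ^ 2) := by nlinarith
        have h6 := le_log_five_halves
        have h7 := Real.log_le_log (by norm_num) h5
        have h8 : θ ≤ 0.3938 := by linarith
        have h9 : 1.669 ≤ H := hH ▸ le_binEntropy_div_of_le (by linarith) h8
        refine ⟨?_, h9⟩
        have : 0.48 * 1.669 ≤ 0.3 * (2 - θ) * H :=
          mul_le_mul (by linarith) h9 (by norm_num) (by linarith)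
        linarith
      have hwl : 1 + 0.3 * (0.69 + Real.log (1 + 2 * (g + g ^ 2))) *
          Real.log (1 + 2 * (g + g ^ 2)) ≤ w := by
        have := mul_le_mul hc (hlp.trans hlogH.le) hlp0 (by linarith)
        linarith
      have hA := confused_energy_bound_large hg hg1 hwl hlarge (by linarith)
      have l3 := Real.log_le_log (by positivity) (add_le_add_right hN 1)
      have l4 := mul_le_mul_of_nonneg_left l3 hHq.le
      have l5 : Real.log (1 + (g + g ^ 2)) ≤ Real.log (1 + (g + g ^ 2) * w) :=
        Real.log_le_log (by positivity) (by nlinarith)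
      have l6 := mul_le_mul_of_nonneg_left l5 (show 0 ≤ 2 * g ^ 2 by positivity)
      linarith

end halfTilt

/-! ### Comparison of the count and Chernoff exponents -/

/-- At `x = θ` the relative energy is already past the chord, so the kink tilt, whose `β` is
nonzero, is not used there. -/
theorem one_add_entropy_le_div_xi {θ : ℝ} (h0 : 0 < θ) (h1 : θ < 1) :
    1 + 0.3 * (2 - θ) * (Real.binEntropy θ / θ) ≤ θ / NoCSI.xi (1 - θ) 1 := by
  have hτ : 0 < 1 - θ := by linarith
  have h2 : 0 < 2 - θ := by linarith
  have hξ := xi_pos h0 h1.le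
  obtain ⟨T, hT⟩ : ∃ T, T = -Real.log (1 - θ) := ⟨_, rfl⟩
  have hT0 : θ ≤ T := by have := Real.log_le_sub_one_of_pos hτ; linarith
  have hl : -Real.log θ ≤ (1 - θ) / θ := by
    have := Real.log_le_sub_one_of_pos (inv_pos.2 h0)
    rw [Real.log_inv] at this
    refine this.trans (le_of_eq ?_)
    field_simp
  have hxi : NoCSI.xi (1 - θ) 1 = θ - (1 - θ) * T := by rw [NoCSI.xi_one_sub, hT]; ring
  have hH : Real.binEntropy θ / θ ≤ (1 - θ) / θ * (1 + T) := by
    rw [binEntropy_div h0, hxi]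
    have : (θ - (1 - θ) * T) / θ = 1 - (1 - θ) / θ * T := by field_simp
    linarith
  have hxi2 := xi_le h0.le h1
  have hc : (2 - θ) * NoCSI.xi (1 - θ) 1 ≤ θ ^ 2 := by
    rw [le_div_iff₀ h2] at hxi2; linarith
  rw [le_div_iff₀ hξ]
  have hT1 : 0.3 * θ * (1 + T) ≤ T := by nlinarith
  have hmain : 0.3 * (2 - θ) * (Real.binEntropy θ / θ) * NoCSI.xi (1 - θ) 1 ≤ (1 - θ) * T := by
    calc 0.3 * (2 - θ) * (Real.binEntropy θ / θ) * NoCSI.xi (1 - θ) 1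
        = 0.3 * (Real.binEntropy θ / θ) * ((2 - θ) * NoCSI.xi (1 - θ) 1) := by ring
      _ ≤ 0.3 * ((1 - θ) / θ * (1 + T)) * θ ^ 2 := by
        have : 0 ≤ (1 - θ) / θ * (1 + T) := mul_nonneg (by positivity) (by linarith)
        gcongr
      _ = (1 - θ) * (0.3 * θ * (1 + T)) := by field_simp
      _ ≤ (1 - θ) * T := mul_le_mul_of_nonneg_left hT1 hτ.le
  rw [add_mul, one_mul]
  linarith

/-- If `ln e` is at least the entropy per missed user or at least `1.31 - θ`, the value `r ln (e w)`
beats the uniform or the Jensen count. Otherwise the half tilt is used: against the Jensen count for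
`θ ≤ 1 / 4`; else against the uniform count at high energy and the kink count at low energy. The
clause on `x = θ` serves the clipping of energies in `exists_sum_badBound_le`. -/
theorem exists_countExponent_le_chernoffExponent {r ω e g b θ x : ℝ} (h0 : 0 < θ) (h1 : θ < 1)
    (hr0 : 0 < r) (hω : 0 < ω) (hg : 0 < g) (hb : 1 ≤ b) (he : e = 1 + 2 * g * (b + g))
    (hbω : b ^ 2 = 1 + 2 * ω * e) (hr : r * (Real.binEntropy θ / θ - 2 * g ^ 2) = 2 * g ^ 2)
    (hx : NoCSI.xi (1 - θ) 1 ≤ x) (hx' : x ≤ θ) :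
    ∃ σ β L, 0 < σ ∧ σ < 1 ∧ 0 ≤ β ∧ 0 < L ∧ (x = θ → β = 0) ∧
      r / θ * countExponent L β θ x ≤ chernoffExponent r ω e σ (x / NoCSI.xi (1 - θ) 1) := by
  have hτ : 0 < 1 - θ := by linarith
  have hξ := xi_pos h0 h1.le
  have hx0 : 0 < x := hξ.trans_le hx
  have he1 : 1 < e := by rw [he]; nlinarith
  have hw : 1 ≤ x / NoCSI.xi (1 - θ) 1 := by rwa [le_div_iff₀ hξ, one_mul]
  have hew : 1 < e * (x / NoCSI.xi (1 - θ) 1) := by nlinarith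
  have hlw := Real.log_nonneg hw
  have hlew : Real.log (e * (x / NoCSI.xi (1 - θ) 1)) =
    Real.log e + Real.log (x / NoCSI.xi (1 - θ) 1) := Real.log_mul (by linarith) (by linarith)
  obtain ⟨hβ, hD⟩ := countExponent_tilt_le h0 h1 hx hx'
  have hβ0 : x = θ → θ / x - (1 - θ) / (1 - x) = 0 := by
    rintro rfl; rw [div_self h0.ne', div_self hτ.ne', sub_self]
  have hrθ : ∀ y, r / θ * (θ * y) = r * y := fun y => by field_simp
  have hD' := mul_le_mul_of_nonneg_left hD (div_pos hr0 h0).le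
  have hLD : 0 < θ ^ 2 * (1 - x) / ((1 - θ) ^ 2 * x) := by
    have : 0 < 1 - x := by linarith
    positivity
  have hN : r / θ * countExponent (θ / (1 - θ)) 0 θ x = r * (Real.binEntropy θ / θ) := by
    rw [countExponent_uniform h0 h1]; ring
  have hLN : 0 < θ / (1 - θ) := by positivity
  rw [hrθ] at hD'
  rcases le_or_gt (Real.binEntropy θ / θ) (Real.log e) with hc1 | hc1
  · obtain ⟨σ, hσ0, hσ1, hE⟩ := exists_chernoffExponent_eq r hω hew
    refine ⟨σ, 0, _, hσ0, hσ1, le_rfl, hLN, fun _ => rfl, ?_⟩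
    rw [hN, hE, hlew]
    exact mul_le_mul_of_nonneg_left (by linarith) hr0.le
  rcases le_or_gt (1.31 - θ) (Real.log e) with hc2 | hc2
  · obtain ⟨σ, hσ0, hσ1, hE⟩ := exists_chernoffExponent_eq r hω hew
    refine ⟨σ, _, _, hσ0, hσ1, hβ, hLD, hβ0, hD'.trans ?_⟩
    rw [hE, hlew]
    exact mul_le_mul_of_nonneg_left (by linarith) hr0.le
  have hσ0 : 0 < (e - 1) / (2 * (e + ω)) := div_pos (by linarith) (by linarith)
  have hσ1 : (e - 1) / (2 * (e + ω)) < 1 := by rw [div_lt_one (by linarith)]; linarith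
  rcases le_or_gt θ (1 / 4) with hθ | hθ
  · exact ⟨_, _, _, hσ0, hσ1, hβ, hLD, hβ0,
      hD'.trans (half_tilt_of_le_quarter h0 hθ hr0 hω hg hb he hbω hr hc2 hw)⟩
  obtain ⟨hE1, hEw⟩ := half_tilt_of_quarter_le hθ.le h1 hr0 hω hg hb he hbω hr rfl hc2 hc1
  have hH0 : 0 < Real.binEntropy θ / θ := (Real.log_pos he1).trans hc1
  set w₁ := 1 + 0.3 * (2 - θ) * (Real.binEntropy θ / θ) with hw₁d
  have hcc : 0 < 0.3 * (2 - θ) * (Real.binEntropy θ / θ) :=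
    mul_pos (by linarith) hH0
  rcases le_or_gt w₁ (x / NoCSI.xi (1 - θ) 1) with hc3 | hc3
  · refine ⟨_, 0, _, hσ0, hσ1, le_rfl, hLN, fun _ => rfl, ?_⟩
    rw [hN]
    exact hEw.trans (chernoffExponent_mono hr0.le hω.le (by linarith) hσ0.le (by linarith) hc3)
  -- The affine bound on the count is exactly the chord: the rise `0.6 H` over the length `0.3 (2 -
  -- θ) H` gives the slope `2 / (2 - θ)`.
  · have hT := mul_le_mul_of_nonneg_left (countExponent_kink_le h0 h1 hx) (div_pos hr0 h0).le
    rw [hrθ] at hT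
    refine ⟨_, 2 / θ, _, hσ0, hσ1, by positivity, Real.exp_pos _, ?_, hT.trans ?_⟩
    · rintro rfl
      exact absurd (one_add_entropy_le_div_xi h0 h1) (not_le.2 hc3)
    · set w := x / NoCSI.xi (1 - θ) 1
      have h2 : 0 < 2 - θ := by linarith
      have hcv := chernoffExponent_concave (w₁ := w₁) hr0.le hω.le (show 0 ≤ e by linarith) hσ0.le
        (by linarith) (t := (w - 1) / (w₁ - 1)) (div_nonneg (by linarith) (by linarith))
        (by rw [div_le_one (by linarith)]; linarith)
      have hid : (1 - (w - 1) / (w₁ - 1)) * 1 + (w - 1) / (w₁ - 1) * w₁ = w := by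
        have : w₁ - 1 ≠ 0 := by linarith
        field_simp
        ring
      rw [hid] at hcv
      refine le_trans ?_ hcv
      have ht0 : 0 ≤ (w - 1) / (w₁ - 1) := div_nonneg (by linarith) (by linarith)
      have ht1 : 0 ≤ 1 - (w - 1) / (w₁ - 1) := by
        rw [sub_nonneg, div_le_one (by linarith)]; linarith
      refine le_trans (le_of_eq ?_) (add_le_add (mul_le_mul_of_nonneg_left hE1 ht1)
        (mul_le_mul_of_nonneg_left hEw ht0))
      have : w₁ - 1 = 0.3 * (2 - θ) * (Real.binEntropy θ / θ) := by rw [hw₁d]; ring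
      rw [this]
      generalize Real.binEntropy θ / θ = H at hH0 ⊢
      field_simp
      ring

/-! ### A suitable tilt above the energy threshold -/

/-- The exponent of `badBound` per dimension, where `y` is the energy of the missed codewords. -/
noncomputable def badExponent (r V s y : ℝ) : ℝ :=
  (1 + r) * Real.log (1 + s * V * (1 + y)) - Real.log (1 + s * V) + Real.log (1 - s * (1 - V))

theorem exists_badExponent_pos {r V y : ℝ} (hr : 0 ≤ r) (hV0 : 0 < V) (hV1 : V < 1)
    (hy : (1 - V) / V < y) : ∃ s, 0 < s ∧ s * (1 - V) < 1 ∧ 0 < badExponent r V s y := by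
  have hv : 0 < 1 - V := by linarith
  have hy0 : 0 < y := (div_pos hv hV0).trans hy
  rw [div_lt_iff₀ hV0] at hy
  have hd : 0 < 2 * (1 - V) * (V * (1 + y)) := by positivity
  have hn : 0 < y * V - (1 - V) := by linarith
  -- Half of the nonzero root of `(1 + s V (1 + y)) (1 - s (1 - V)) = 1 + s V`; in between the left
  -- side is larger.
  set s := (y * V - (1 - V)) / (2 * (1 - V) * (V * (1 + y))) with hs
  have hs0 : 0 < s := div_pos hn hd
  have hsd : s * (1 - V) * (V * (1 + y)) * 2 = y * V - (1 - V) := by rw [hs]; field_simp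
  have hs1 : s * (1 - V) < 1 := by
    by_contra! h
    have := mul_le_mul_of_nonneg_right h (show 0 ≤ V * (1 + y) by positivity)
    nlinarith
  have hs2 : 0 < 1 - s * (1 - V) := by linarith
  refine ⟨s, hs0, hs1, ?_⟩
  have h1 : 1 + s * V < (1 + s * V * (1 + y)) * (1 - s * (1 - V)) := by nlinarith
  have h2 := Real.log_lt_log (by positivity) h1
  rw [Real.log_mul (by positivity) hs2.ne'] at h2
  have h3 : 0 ≤ Real.log (1 + s * V * (1 + y)) := Real.log_nonneg (by
    have : 0 ≤ s * V * (1 + y) := by positivity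
    linarith)
  have := mul_nonneg hr h3
  rw [badExponent]
  linarith

/-- Normalization by the least energy `(1 - V) / V` that separates the distances: `e = 1 + δ₂`
becomes the excess over it and `w` the energy relative to ξ. -/
theorem badExponent_eq_chernoffExponent (r : ℝ) {V e σ w : ℝ} (hV0 : 0 < V) (hV1 : V < 1) :
    badExponent r V (σ / (1 - V)) ((1 - V) / V * e * w) =
      chernoffExponent r (V / (1 - V)) e σ w := by
  have hv : 1 - V ≠ 0 := by linarith
  have h1 : σ / (1 - V) * V * (1 + (1 - V) / V * e * w) = σ * (V / (1 - V) + e * w) := by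
    field_simp
  have h2 : σ / (1 - V) * V = σ * (V / (1 - V)) := by field_simp
  have h3 : σ / (1 - V) * (1 - V) = σ := by field_simp
  rw [badExponent, chernoffExponent, h1, h2, h3]

theorem badExponent_mono {r V s y y' : ℝ} (hr : 0 ≤ r) (hV : 0 ≤ V) (hs : 0 ≤ s) (hy : 0 ≤ y)
    (h : y ≤ y') : badExponent r V s y ≤ badExponent r V s y' := by
  have h1 : 1 + s * V * (1 + y) ≤ 1 + s * V * (1 + y') := by gcongr
  have := mul_le_mul_of_nonneg_left (Real.log_le_log (by positivity) h1)
    (by linarith : 0 ≤ 1 + r)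
  rw [badExponent, badExponent]
  linarith

theorem badExponent_strictMono {r V s y y' : ℝ} (hr : 0 ≤ r) (hV : 0 < V) (hs : 0 < s)
    (hy : 0 ≤ y) (h : y < y') : badExponent r V s y < badExponent r V s y' := by
  have h1 : 1 + s * V * (1 + y) < 1 + s * V * (1 + y') := by gcongr
  have := mul_lt_mul_of_pos_left (Real.log_lt_log (by positivity) h1)
    (by linarith : 0 < 1 + r)
  rw [badExponent, badExponent]
  linarith

theorem badExponent_zero (r V y : ℝ) : badExponent r V 0 y = 0 := by simp [badExponent]

/-- A fraction `θ` of the users cannot carry less energy than the weakest fraction `θ`. In the kink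
bound the term `-β (ξ - x)` wins for large `β`. -/
theorem exists_countExponent_neg {θ x : ℝ} (h0 : 0 < θ) (h1 : θ ≤ 1)
    (hx : x < NoCSI.xi (1 - θ) 1) : ∃ β L, 0 ≤ β ∧ 0 < L ∧ countExponent L β θ x < 0 := by
  rcases h1.eq_or_lt with rfl | h1
  · have hξ : NoCSI.xi (1 - 1) 1 = 1 := by norm_num [NoCSI.xi]
    rw [hξ] at hx
    have hd : 0 < (1 - x) := by linarith
    -- For `θ = 1` the quantile is infinite, so a finite `T` with small `exp (-T) = E` takes its
    -- place.
    set E := min 1 ((1 - x) / 4) with hE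
    have hE0 : 0 < E := lt_min one_pos (by positivity)
    have hT : 0 ≤ -Real.log E := by
      have := Real.log_nonpos hE0.le (min_le_left _ _); linarith
    have hk := logPartition_le_of_kink hT (show (1 : ℝ) < 2 by norm_num)
    rw [neg_neg, Real.exp_log hE0] at hk
    refine ⟨2, _, by norm_num, Real.exp_pos (2 * -Real.log E), ?_⟩
    rw [countExponent, Real.log_exp]
    have := min_le_right 1 ((1 - x) / 4)
    rw [show 2 * 2 / ((2 : ℝ) ^ 2 - 1) = 4 / 3 by norm_num] at hk
    linarith
  · have hτ : 0 < 1 - θ := by linarith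
    have hd : 0 < NoCSI.xi (1 - θ) 1 - x := by linarith
    set d := NoCSI.xi (1 - θ) 1 - x with hdd
    set β := 1 + 2 / d with hβ
    have h2d : 0 < 2 / d := by positivity
    have hβ1 : 1 < β := by linarith
    have hT : 0 ≤ -Real.log (1 - θ) := by
      have := Real.log_nonpos hτ.le (by linarith); linarith
    have hk := logPartition_le_of_kink hT hβ1
    rw [neg_neg, Real.exp_log hτ] at hk
    refine ⟨β, _, by linarith, Real.exp_pos (β * -Real.log (1 - θ)), ?_⟩
    have hb2 : 0 < β ^ 2 - 1 := by nlinarith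
    have hbd : 2 < d * (β ^ 2 - 1) := by
      have : d * (β ^ 2 - 1) = 4 + 4 / d := by rw [hβ]; field_simp; ring
      rw [this]; have : 0 < 4 / d := by positivity
      linarith
    have h3 : (1 - θ) * (2 * β / (β ^ 2 - 1)) < β * d := by
      rw [mul_div_assoc', div_lt_iff₀ hb2]
      nlinarith
    rw [countExponent, Real.log_exp]
    have hid : β * x - θ * (β * -Real.log (1 - θ)) + β * (-Real.log (1 - θ) - 1 + (1 - θ)) =
        -(β * d) := by rw [hdd, NoCSI.xi_one_sub]; ring
    linarith

namespace NoCSI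

variable {μ p θ : ℝ} {k : ℕ}

theorem V_pos (μ p : ℝ) (k : ℕ) (θ : ℝ) : 0 < V μ p k θ := Real.exp_pos _

theorem V_lt_one (hk : 1 ≤ k) (hμ0 : 0 < μ) (hμ1 : μ < 1) (hp0 : 0 < p) (hp1 : p ≤ 1)
    (h0 : 0 < θ) (h1 : θ ≤ 1) : V μ p k θ < 1 := by
  have ha : p * μ < 1 := by nlinarith
  have ha' : 0 < 1 - p * μ := by linarith
  have hpp : 0 ≤ 1 - p := by linarith
  have hθ : 0 < θ * p * μ := by positivity
  have hlog : 0 < Real.log ((2 : ℝ) ^ k) := Real.log_pos (one_lt_pow₀ (by norm_num) (by omega))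
  have e1 := Real.binEntropy_nonneg h0.le h1
  have e2 := Real.binEntropy_nonneg (p := θ * p * μ / (1 - p * μ + θ * p * μ)) (by positivity)
    (by rw [div_le_one (by positivity)]; linarith)
  have e3 := Real.binEntropy_nonneg (p := θ * p / (1 - p + θ * p)) (by positivity)
    (by rw [div_le_one (by positivity)]; linarith)
  rw [V, Real.exp_lt_one_iff, neg_lt_zero, delta1]
  positivity

/-- Above the threshold every pair of a fraction `θ` of missed users and a fading energy `x` has a
Chernoff exponent that beats the exponent of the number of sets of users with these parameters. -/
theorem exists_tilt {G x : ℝ} (hk : 1 ≤ k) (hμ0 : 0 < μ) (hμ1 : μ < 1) (hp0 : 0 < p)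
    (hp1 : p ≤ 1) (h0 : 0 < θ) (h1 : θ ≤ 1) (hx0 : 0 ≤ x) (hx : x ≤ θ)
    (hG : W μ p k θ / xi (1 - θ) 1 < G) :
    ∃ s β L, 0 ≤ s ∧ s * (1 - V μ p k θ) < 1 ∧ 0 ≤ β ∧ 0 < L ∧ (x = θ → β = 0) ∧
      p * μ / (1 - p * μ) * countExponent L β θ x <
        badExponent (θ * (p * μ / (1 - p * μ))) (V μ p k θ) s (G * x) := by
  have ha0 : 0 < p * μ := by positivity
  have ha1 : 0 < 1 - p * μ := by nlinarith
  have hal : 0 < p * μ / (1 - p * μ) := by positivity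
  have hV0 := V_pos μ p k θ
  have hV1 := V_lt_one hk hμ0 hμ1 hp0 hp1 h0 h1
  have hξ := xi_pos h0 h1
  set v := V μ p k θ with hv
  have hv1 : 0 < 1 - v := by linarith
  rcases lt_or_ge x (xi (1 - θ) 1) with hxξ | hxξ
  · obtain ⟨β, L, hβ, hL, hneg⟩ := exists_countExponent_neg h0 h1 hxξ
    refine ⟨0, β, L, le_rfl, by simp, hβ, hL, ?_, ?_⟩
    · rintro rfl
      exact absurd (xi_le_self h0.le h1) (not_le.2 hxξ)
    · rw [badExponent_zero]
      exact mul_neg_of_pos_of_neg hal hneg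
  have hq : q μ p θ = p * μ / (1 - p * μ + θ * p * μ) * Real.binEntropy θ := rfl
  rcases h1.eq_or_lt with rfl | h1
  · have hξ1 : xi (1 - 1) 1 = 1 := by norm_num [xi]
    rw [hξ1] at hxξ hG
    obtain rfl : x = 1 := le_antisymm hx hxξ
    have hW : W μ p k 1 = (1 - v) / v := by
      simp [W, delta2, hq, ← hv]
    rw [hW, div_one] at hG
    obtain ⟨s, hs0, hs1, hpos⟩ := exists_badExponent_pos (r := 1 * (p * μ / (1 - p * μ)))
      (by positivity) hV0 hV1 (show (1 - v) / v < G * 1 by rwa [mul_one])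
    -- All users are missed: there is a single set and δ₂ vanishes. A large `L` makes its count
    -- exponent smaller than any positive Chernoff exponent.
    set E := badExponent (1 * (p * μ / (1 - p * μ))) v s (G * 1)
    set L := (p * μ / (1 - p * μ) + 1) / E with hL
    have hL0 : 0 < L := by positivity
    refine ⟨s, 0, L, hs0.le, hs1, le_rfl, hL0, fun _ => rfl, ?_⟩
    have hc : countExponent L 0 1 1 ≤ 1 / L := by
      rw [countExponent, logPartition_zero]
      have := Real.log_le_sub_one_of_pos (show 0 < (1 + L) / L by positivity)
      rw [Real.log_div (by positivity) hL0.ne'] at this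
      have h3 : (1 + L) / L - 1 = 1 / L := by field_simp; ring
      linarith
    refine (mul_le_mul_of_nonneg_left hc hal.le).trans_lt ?_
    rw [hL, one_div_div, mul_div_assoc', div_lt_iff₀ (by positivity)]
    linarith
  · have hτ : 0 < 1 - θ := by linarith
    have hh := Real.binEntropy_pos h0 h1
    have hq0 : 0 < q μ p θ := by rw [hq]; positivity
    set Q := q μ p θ with hQ
    set c' := c μ p k θ with hc
    have hcω : c' = 2 * (v / (1 - v)) := by rw [hc, c, ← hv]; ring
    have hω : 0 < v / (1 - v) := by positivity
    set e := 1 + delta2 μ p k θ with he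
    set R := √(Q ^ 2 * c' * (2 + c') + 2 * Q * (1 + c')) with hR
    have heR : e = 1 + (Q * (1 + c') + R) := rfl
    have hc0 : 0 < c' := by rw [hcω]; positivity
    have hRsq : R ^ 2 = Q ^ 2 * c' * (2 + c') + 2 * Q * (1 + c') := Real.sq_sqrt (by positivity)
    have hR0 : 0 ≤ R := Real.sqrt_nonneg _
    -- With `Q = 2 g²` the formula for δ₂ says `e = 1 + 2 g (b + g)` and `b² = 1 + 2 ω e`, a
    -- quadratic equation for `e`.
    set g := √(Q / 2) with hg
    have hg0 : 0 < g := Real.sqrt_pos.2 (by positivity)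
    have hg2 : 2 * g ^ 2 = Q := by rw [hg, Real.sq_sqrt (by positivity)]; ring
    set b := (Q * c' + R) / (2 * g) with hb
    have hb0 : 0 ≤ b := by positivity
    have hgb : 2 * g * b = Q * c' + R := by rw [hb]; field_simp
    have hbω : b ^ 2 = 1 + 2 * (v / (1 - v)) * e := by
      have h3 : (2 * Q) * b ^ 2 = (2 * Q) * (1 + 2 * (v / (1 - v)) * e) := by
        rw [← hcω, heR]
        calc 2 * Q * b ^ 2 = (2 * g * b) ^ 2 := by rw [← hg2]; ring
          _ = _ := by rw [hgb]; linear_combination hRsq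
      exact mul_left_cancel₀ (by positivity) h3
    have he0 : 0 < e := by rw [heR]; positivity
    have hb1 : 1 ≤ b := by
      have : 0 < 2 * (v / (1 - v)) * e := by positivity
      nlinarith
    have heb : e = 1 + 2 * g * (b + g) := by
      rw [heR]; linear_combination -hgb - hg2
    have hr : θ * (p * μ / (1 - p * μ)) * (Real.binEntropy θ / θ - 2 * g ^ 2) = 2 * g ^ 2 := by
      rw [hg2, hq]
      have : 0 < 1 - p * μ + θ * p * μ := by positivity
      field_simp
      ring
    obtain ⟨σ, β, L, hσ0, hσ1, hβ, hL, hxθ, hle⟩ :=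
      exists_countExponent_le_chernoffExponent h0 h1 (by positivity) hω hg0 hb1 heb hbω hr hxξ hx
    refine ⟨σ / (1 - v), β, L, by positivity, ?_, hβ, hL, hxθ, ?_⟩
    · rwa [div_mul_cancel₀ _ hv1.ne']
    · rw [mul_div_cancel_left₀ _ h0.ne'] at hle
      refine hle.trans_lt ?_
      rw [← badExponent_eq_chernoffExponent _ hV0 hV1]
      have hxpos : 0 < x := hξ.trans_le hxξ
      refine badExponent_strictMono (by positivity) hV0 (by positivity) (by positivity) ?_
      have : (1 - v) / v * e * (x / xi (1 - θ) 1) = W μ p k θ / xi (1 - θ) 1 * x := by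
        rw [W, ← hv]; ring
      rw [this]
      exact mul_lt_mul_of_pos_right hG hxpos

end NoCSI

/-! ### The decoding threshold and compactness of the set of tilts -/

/-- The exponent, per channel use, of the number of ways to confuse a fraction `θ` of the active
users when there are `κ` users and `a` active users per channel use and `M` messages. -/
noncomputable def confusionRate (M θ a κ : ℝ) : ℝ :=
  a * Real.binEntropy θ + (1 - a + a * θ) * Real.binEntropy (a * θ / (1 - a + a * θ)) +
    a * θ * Real.log M + (κ - a + a * θ) * Real.binEntropy (a * θ / (κ - a + a * θ))

/-- The decoding threshold with slack `η`. -/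
noncomputable def decodingThreshold (M θ a κ η : ℝ) : ℝ :=
  Real.exp (-((confusionRate M θ a κ + η) / (1 - a)))

theorem decodingThreshold_pos (M θ a κ η : ℝ) : 0 < decodingThreshold M θ a κ η := Real.exp_pos _

theorem confusionRate_nonneg {M θ a κ : ℝ} (hM : 1 ≤ M) (h0 : 0 ≤ θ) (h1 : θ ≤ 1) (ha : 0 < a)
    (ha1 : a < 1) (hκ : a ≤ κ) : 0 ≤ confusionRate M θ a κ := by
  have haθ : 0 ≤ a * θ := by positivity
  have e2 := Real.binEntropy_nonneg (p := a * θ / (1 - a + a * θ))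
    (div_nonneg haθ (by linarith)) (div_le_one_of_le₀ (by linarith) (by linarith))
  have e3 := Real.binEntropy_nonneg (p := a * θ / (κ - a + a * θ))
    (div_nonneg haθ (by linarith)) (div_le_one_of_le₀ (by linarith) (by linarith))
  have := Real.log_nonneg hM
  have := Real.binEntropy_nonneg h0 h1
  have : 0 ≤ 1 - a + a * θ := by linarith
  have : 0 ≤ κ - a + a * θ := by linarith
  rw [confusionRate]
  positivity

theorem decodingThreshold_lt_one {M θ a κ η : ℝ} (hM : 1 ≤ M) (h0 : 0 ≤ θ) (h1 : θ ≤ 1)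
    (ha : 0 < a) (ha1 : a < 1) (hκ : a ≤ κ) (hη : 0 < η) : decodingThreshold M θ a κ η < 1 := by
  have := confusionRate_nonneg hM h0 h1 ha ha1 hκ
  rw [decodingThreshold, Real.exp_lt_one_iff, neg_lt_zero]
  exact div_pos (by linarith) (by linarith)

theorem decodingThreshold_eq_V {μ p θ : ℝ} (k : ℕ) (hμ0 : 0 < μ) :
    decodingThreshold (2 ^ k) θ (p * μ) μ 0 = NoCSI.V μ p k θ := by
  have e1 : p * μ * θ / (μ - p * μ + p * μ * θ) = θ * p / (1 - p + θ * p) := by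
    rw [show p * μ * θ = μ * (θ * p) by ring,
      show μ - p * μ + μ * (θ * p) = μ * (1 - p + θ * p) by ring,
      mul_div_mul_left _ _ hμ0.ne']
  have e2 : p * μ * θ / (1 - p * μ + p * μ * θ) = θ * p * μ / (1 - p * μ + θ * p * μ) := by
    rw [show p * μ * θ = θ * p * μ by ring]
  rw [decodingThreshold, confusionRate, NoCSI.V, NoCSI.delta1, e1, e2]
  congr 2
  ring

theorem continuousAt_decodingThreshold {M θ a κ η : ℝ} (h1 : 1 - a ≠ 0)
    (h2 : 1 - a + a * θ ≠ 0) (h3 : κ - a + a * θ ≠ 0) :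
    ContinuousAt (fun y : ℝ × ℝ × ℝ × ℝ => decodingThreshold M y.1 y.2.1 y.2.2.1 y.2.2.2)
      (θ, a, κ, η) := by
  unfold decodingThreshold confusionRate
  have hb := Real.binEntropy_continuous
  refine Real.continuous_exp.continuousAt.comp (ContinuousAt.neg (ContinuousAt.div ?_ ?_ h1))
  · refine ContinuousAt.add (ContinuousAt.add (ContinuousAt.add (ContinuousAt.add ?_ ?_) ?_) ?_) ?_
    · exact Continuous.continuousAt (by fun_prop)
    · refine ContinuousAt.mul (Continuous.continuousAt (by fun_prop)) ?_
      exact hb.continuousAt.comp (ContinuousAt.div (Continuous.continuousAt (by fun_prop))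
        (Continuous.continuousAt (by fun_prop)) h2)
    · exact Continuous.continuousAt (by fun_prop)
    · refine ContinuousAt.mul (Continuous.continuousAt (by fun_prop)) ?_
      exact hb.continuousAt.comp (ContinuousAt.div (Continuous.continuousAt (by fun_prop))
        (Continuous.continuousAt (by fun_prop)) h3)
    · exact Continuous.continuousAt (by fun_prop)
  · exact Continuous.continuousAt (by fun_prop)

/-- The tilt `i = (s, L, β)` controls, with margin `δ`, the sets of a fraction `z.1` of the active
users with normalized fading energy `z.2`, for the parameters `π = (a, κ, η, G)`. -/
def TiltControls (M δ : ℝ) (i : ℝ × ℝ × ℝ) (z : ℝ × ℝ) (π : ℝ × ℝ × ℝ × ℝ) : Prop :=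
  i.1 * (1 - decodingThreshold M z.1 π.1 π.2.1 π.2.2.1) < 1 ∧
    π.1 / (1 - π.1) * countExponent i.2.1 i.2.2 z.1 z.2 + δ <
      badExponent (z.1 * (π.1 / (1 - π.1))) (decodingThreshold M z.1 π.1 π.2.1 π.2.2.1) i.1
        (π.2.2.2 * z.2)

theorem eventually_tiltControls {M δ : ℝ} {i : ℝ × ℝ × ℝ} {z : ℝ × ℝ} {π : ℝ × ℝ × ℝ × ℝ}
    (hs : 0 ≤ i.1) (hz : 0 ≤ z.2) (hG : 0 ≤ π.2.2.2) (h1 : 1 - π.1 ≠ 0)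
    (h2 : 1 - π.1 + π.1 * z.1 ≠ 0) (h3 : π.2.1 - π.1 + π.1 * z.1 ≠ 0)
    (h : TiltControls M δ i z π) : ∀ᶠ y in 𝓝 (z, π), TiltControls M δ i y.1 y.2 := by
  obtain ⟨s, L, β⟩ := i
  obtain ⟨θ, x⟩ := z
  obtain ⟨a, κ, η, G⟩ := π
  simp only at hs hz hG h1 h2 h3
  have hV : ContinuousAt (fun y : (ℝ × ℝ) × ℝ × ℝ × ℝ × ℝ =>
      decodingThreshold M y.1.1 y.2.1 y.2.2.1 y.2.2.2.1) ((θ, x), a, κ, η, G) :=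
    ContinuousAt.comp (g := fun y : ℝ × ℝ × ℝ × ℝ => decodingThreshold M y.1 y.2.1 y.2.2.1 y.2.2.2)
      (f := fun y : (ℝ × ℝ) × ℝ × ℝ × ℝ × ℝ => (y.1.1, y.2.1, y.2.2.1, y.2.2.2.1))
      (continuousAt_decodingThreshold h1 h2 h3) (Continuous.continuousAt (by fun_prop))
  have hV0 := decodingThreshold_pos M θ a κ η
  have hal : ContinuousAt (fun y : (ℝ × ℝ) × ℝ × ℝ × ℝ × ℝ => y.2.1 / (1 - y.2.1))
      ((θ, x), a, κ, η, G) :=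
    ContinuousAt.div (Continuous.continuousAt (by fun_prop)) (Continuous.continuousAt (by fun_prop))
      h1
  have hs1 : s * (1 - decodingThreshold M θ a κ η) < 1 := h.1
  refine Filter.Eventually.and ?_ ?_
  · exact ContinuousAt.eventually_lt (continuousAt_const.mul (continuousAt_const.sub hV))
      continuousAt_const h.1
  · refine ContinuousAt.eventually_lt ?_ ?_ h.2
    · unfold countExponent
      exact (hal.mul (Continuous.continuousAt (by fun_prop))).add continuousAt_const
    · unfold badExponent
      refine ContinuousAt.add (ContinuousAt.sub (ContinuousAt.mul ?_ (ContinuousAt.log ?_ ?_))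
        (ContinuousAt.log ?_ ?_)) (ContinuousAt.log ?_ ?_)
      · exact continuousAt_const.add ((Continuous.continuousAt (by fun_prop)).mul hal)
      · exact continuousAt_const.add ((continuousAt_const.mul hV).mul
          (Continuous.continuousAt (by fun_prop)))
      · exact (show 0 < 1 + s * decodingThreshold M θ a κ η * (1 + G * x) by positivity).ne'
      · exact continuousAt_const.add (continuousAt_const.mul hV)
      · exact (show 0 < 1 + s * decodingThreshold M θ a κ η by positivity).ne'
      · exact continuousAt_const.sub (continuousAt_const.mul (continuousAt_const.sub hV))
      · exact (show 0 < 1 - s * (1 - decodingThreshold M θ a κ η) by linarith).ne'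

theorem TiltControls.mono {M δ δ' : ℝ} {i : ℝ × ℝ × ℝ} {z : ℝ × ℝ} {π : ℝ × ℝ × ℝ × ℝ}
    (h : TiltControls M δ i z π) (hδ : δ' ≤ δ) : TiltControls M δ' i z π :=
  ⟨h.1, lt_of_le_of_lt (by linarith) h.2⟩

/-- A fixed tilt works on a neighbourhood of each point and of the parameters jointly, with part of
its strict gap as margin. Compactness leaves finitely many tilts and the smallest margin. -/
theorem exists_finset_tiltControls_of_isCompact {M : ℝ} {C : Set (ℝ × ℝ)} (hC : IsCompact C)
    {D : Set (ℝ × ℝ × ℝ)} {π : ℝ × ℝ × ℝ × ℝ} (hD : ∀ i ∈ D, 0 ≤ i.1) (hG : 0 ≤ π.2.2.2)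
    (h1 : 1 - π.1 ≠ 0)
    (hCz : ∀ z ∈ C, 0 ≤ z.2 ∧ 1 - π.1 + π.1 * z.1 ≠ 0 ∧ π.2.1 - π.1 + π.1 * z.1 ≠ 0)
    (h : ∀ z ∈ C, ∃ i ∈ D, TiltControls M 0 i z π) :
    ∃ F : Finset (ℝ × ℝ × ℝ), (∀ i ∈ F, i ∈ D) ∧ ∃ δ > 0,
      ∀ᶠ π' in 𝓝 π, ∀ z ∈ C, ∃ i ∈ F, TiltControls M δ i z π' := by
  classical
  refine hC.induction_on (p := fun S => ∃ F : Finset (ℝ × ℝ × ℝ), (∀ i ∈ F, i ∈ D) ∧ ∃ δ > 0,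
      ∀ᶠ π' in 𝓝 π, ∀ z ∈ S, ∃ i ∈ F, TiltControls M δ i z π') ?_ ?_ ?_ ?_
  · exact ⟨∅, by simp, 1, one_pos, by simp⟩
  · rintro S T hST ⟨F, hF, δ, hδ, hev⟩
    exact ⟨F, hF, δ, hδ, hev.mono fun π' hπ z hz => hπ z (hST hz)⟩
  · rintro S T ⟨F, hF, δ, hδ, hev⟩ ⟨F', hF', δ', hδ', hev'⟩
    refine ⟨F ∪ F', fun i hi => ?_, min δ δ', lt_min hδ hδ', ?_⟩
    · rcases Finset.mem_union.1 hi with hi | hi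
      · exact hF i hi
      · exact hF' i hi
    · filter_upwards [hev, hev'] with π' hπ hπ' z hz
      rcases hz with hz | hz
      · obtain ⟨i, hi, hic⟩ := hπ z hz
        exact ⟨i, Finset.mem_union_left _ hi, hic.mono (min_le_left _ _)⟩
      · obtain ⟨i, hi, hic⟩ := hπ' z hz
        exact ⟨i, Finset.mem_union_right _ hi, hic.mono (min_le_right _ _)⟩
  · intro z hz
    obtain ⟨i, hi, hic⟩ := h z hz
    obtain ⟨hz0, hz1, hz2⟩ := hCz z hz
    obtain ⟨δ, hδ0, hδ⟩ := exists_between hic.2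
    have hδ' : TiltControls M (δ - π.1 / (1 - π.1) * countExponent i.2.1 i.2.2 z.1 z.2) i z π :=
      ⟨hic.1, by rw [add_sub_cancel]; exact hδ⟩
    have hev := eventually_tiltControls (hD i hi) hz0 hG h1 hz1 hz2 hδ'
    rw [nhds_prod_eq] at hev
    obtain ⟨t, ht, u, hu, htu⟩ := Filter.eventually_prod_iff.1 hev
    refine ⟨{z | t z}, mem_nhdsWithin_of_mem_nhds ht, {i}, by simpa using hi,
      δ - π.1 / (1 - π.1) * countExponent i.2.1 i.2.2 z.1 z.2, by linarith, ?_⟩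
    filter_upwards [hu] with π' hπ z' hz'
    exact ⟨i, Finset.mem_singleton_self i, htu hz' hπ⟩

/-- Finitely many tilts control all sets of users, uniformly near the limiting parameters. -/
theorem exists_finset_tiltControls {k : ℕ} {μ p ε G : ℝ} (hk : 1 ≤ k) (hμ0 : 0 < μ) (hμ1 : μ < 1)
    (hp0 : 0 < p) (hp1 : p ≤ 1) (hε : 0 < ε) (hG0 : 0 ≤ G)
    (hG : ∀ θ, ε ≤ θ → θ ≤ 1 → NoCSI.W μ p k θ / NoCSI.xi (1 - θ) 1 < G) :
    ∃ F : Finset (ℝ × ℝ × ℝ), (∀ i ∈ F, 0 ≤ i.1 ∧ 0 < i.2.1 ∧ 0 ≤ i.2.2) ∧ ∃ δ > 0,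
      ∀ᶠ π in 𝓝 (p * μ, μ, (0 : ℝ), G), ∀ θ x, ε ≤ θ → θ ≤ 1 → 0 ≤ x → x ≤ θ →
        ∃ i ∈ F, (x = θ → i.2.2 = 0) ∧ TiltControls (2 ^ k) δ i (θ, x) π := by
  classical
  have ha0 : 0 < p * μ := by positivity
  have ha1 : 0 < 1 - p * μ := by nlinarith
  have haμ : p * μ ≤ μ := by nlinarith
  have key : ∀ θ x, ε ≤ θ → θ ≤ 1 → 0 ≤ x → x ≤ θ → ∃ i : ℝ × ℝ × ℝ,
      (0 ≤ i.1 ∧ 0 < i.2.1 ∧ 0 ≤ i.2.2) ∧ (x = θ → i.2.2 = 0) ∧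
        TiltControls (2 ^ k) 0 i (θ, x) (p * μ, μ, (0 : ℝ), G) := by
    intro θ x hθ hθ1 hx0 hx
    obtain ⟨s, β, L, hs0, hs1, hβ, hL, hxθ, hlt⟩ :=
      NoCSI.exists_tilt hk hμ0 hμ1 hp0 hp1 (hε.trans_le hθ) hθ1 hx0 hx (hG θ hθ hθ1)
    refine ⟨(s, L, β), ⟨hs0, hL, hβ⟩, hxθ, ?_, ?_⟩
    · simpa only [decodingThreshold_eq_V k hμ0] using hs1
    · simpa only [decodingThreshold_eq_V k hμ0, add_zero] using hlt
  have hnz : ∀ θ, ε ≤ θ → 1 - p * μ + p * μ * θ ≠ 0 ∧ μ - p * μ + p * μ * θ ≠ 0 := by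
    intro θ hθ
    have : 0 < p * μ * θ := mul_pos ha0 (hε.trans_le hθ)
    exact ⟨by linarith, by linarith⟩
  -- The diagonal is covered separately: the requirement `β = 0` there does not pass to nearby
  -- tilts.
  have hC2 : IsCompact ((fun θ : ℝ => (θ, θ)) '' Set.Icc ε 1) :=
    isCompact_Icc.image (by fun_prop)
  have hC1 : IsCompact ((fun q : ℝ × ℝ => (q.1, q.1 * q.2)) '' (Set.Icc ε 1 ×ˢ Set.Icc 0 1)) :=
    (isCompact_Icc.prod isCompact_Icc).image (by fun_prop)
  obtain ⟨F₁, hF₁, δ₁, hδ₁, hev₁⟩ := exists_finset_tiltControls_of_isCompact (M := 2 ^ k)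
    (D := {i | 0 ≤ i.1 ∧ 0 < i.2.1 ∧ 0 ≤ i.2.2}) (π := (p * μ, μ, (0 : ℝ), G)) hC1
    (fun i hi => hi.1) hG0 ha1.ne'
    (by
      rintro _ ⟨⟨θ, y⟩, ⟨hθ, hy⟩, rfl⟩
      exact ⟨mul_nonneg (hε.le.trans hθ.1) hy.1, hnz θ hθ.1⟩)
    (by
      rintro _ ⟨⟨θ, y⟩, ⟨hθ, hy⟩, rfl⟩
      have hθ0 := hε.trans_le hθ.1
      obtain ⟨i, hi, -, hic⟩ := key θ (θ * y) hθ.1 hθ.2 (mul_nonneg hθ0.le hy.1)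
        (mul_le_of_le_one_right hθ0.le hy.2)
      exact ⟨i, hi, hic⟩)
  obtain ⟨F₂, hF₂, δ₂, hδ₂, hev₂⟩ := exists_finset_tiltControls_of_isCompact (M := 2 ^ k)
    (D := {i | (0 ≤ i.1 ∧ 0 < i.2.1 ∧ 0 ≤ i.2.2) ∧ i.2.2 = 0})
    (π := (p * μ, μ, (0 : ℝ), G)) hC2
    (fun i hi => hi.1.1) hG0 ha1.ne'
    (by
      rintro _ ⟨θ, hθ, rfl⟩
      exact ⟨hε.le.trans hθ.1, hnz θ hθ.1⟩)
    (by
      rintro _ ⟨θ, hθ, rfl⟩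
      obtain ⟨i, hi, hi0, hic⟩ := key θ θ hθ.1 hθ.2 (hε.le.trans hθ.1) le_rfl
      exact ⟨i, ⟨hi, hi0 rfl⟩, hic⟩)
  refine ⟨F₁ ∪ F₂, fun i hi => ?_, min δ₁ δ₂, lt_min hδ₁ hδ₂, ?_⟩
  · rcases Finset.mem_union.1 hi with hi | hi
    · exact hF₁ i hi
    · exact (hF₂ i hi).1
  · filter_upwards [hev₁, hev₂] with π h₁ h₂ θ x hθ hθ1 hx0 hx
    rcases hx.eq_or_lt with rfl | hlt
    · obtain ⟨i, hi, hic⟩ := h₂ (x, x) ⟨x, ⟨hθ, hθ1⟩, rfl⟩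
      exact ⟨i, Finset.mem_union_right _ hi, fun _ => (hF₂ i hi).2, hic.mono (min_le_right _ _)⟩
    · have hθ0 := hε.trans_le hθ
      obtain ⟨i, hi, hic⟩ := h₁ (θ, x) ⟨(θ, x / θ), ⟨⟨hθ, hθ1⟩, by positivity,
        (div_le_one hθ0).2 hx⟩, by simp only [mul_div_cancel₀ _ hθ0.ne']⟩
      exact ⟨i, Finset.mem_union_left _ hi, fun h => absurd h hlt.ne,
        hic.mono (min_le_left _ _)⟩

/-! ### The two sums at finite blocklength -/

/-- A single term of the binomial expansion of `(q + (1 - q)) ^ N` with `q = t / N` is at most 1. -/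
theorem choose_le_exp_binEntropy {N t : ℕ} (ht : t ≤ N) :
    (N.choose t : ℝ) ≤ Real.exp (N * Real.binEntropy (t / N)) := by
  rcases Nat.eq_zero_or_pos t with rfl | ht0
  · simp
  rcases ht.eq_or_lt with rfl | htN
  · have : (t : ℝ) / t = 1 := div_self (by positivity)
    simp [this]
  have hN : (0 : ℝ) < N := by exact_mod_cast ht0.trans htN
  have ht0' : (0 : ℝ) < t := by exact_mod_cast ht0
  have htN' : (t : ℝ) < N := by exact_mod_cast htN
  set q : ℝ := t / N with hq
  have hq0 : 0 < q := by positivity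
  have hq1 : 0 < 1 - q := by rw [sub_pos, hq, div_lt_one hN]; exact htN'
  have h1 : q ^ t * (1 - q) ^ (N - t) * (N.choose t : ℝ) ≤ 1 := by
    have := add_pow q (1 - q) N
    rw [add_sub_cancel, one_pow] at this
    refine le_trans ?_ this.ge
    exact Finset.single_le_sum (f := fun i => q ^ i * (1 - q) ^ (N - i) * (N.choose i : ℝ))
      (fun i _ => by positivity) (Finset.mem_range.2 (by omega))
  have h2 : q ^ t * (1 - q) ^ (N - t) = Real.exp (-(N * Real.binEntropy q)) := by
    rw [← Real.exp_log (pow_pos hq0 t), ← Real.exp_log (pow_pos hq1 (N - t)), ← Real.exp_add,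
      Real.log_pow, Real.log_pow, binEntropy_eq_log, Nat.cast_sub ht]
    congr 1
    have : (t : ℝ) = N * q := by rw [hq]; field_simp
    rw [this]
    ring
  rw [h2, Real.exp_neg] at h1
  have := Real.exp_pos (N * Real.binEntropy q)
  rwa [inv_mul_le_iff₀ this, mul_one] at h1

theorem confusionBound_eq {m t : ℕ} (hm : 0 < m) (ht : 0 < t) (V : ℝ) :
    confusionBound m t V = V ^ m * Real.exp ((m + t) * Real.binEntropy (t / (m + t))) := by
  have hm' : (0 : ℝ) < m := by exact_mod_cast hm
  have ht' : (0 : ℝ) < t := by exact_mod_cast ht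
  have h1 : 1 - (t : ℝ) / (m + t) = m / (m + t) := by field_simp; ring
  have h2 : ((m : ℝ) + t) / m = ((m : ℝ) / (m + t))⁻¹ := by rw [inv_div]
  have h3 : ((m : ℝ) + t) / t = ((t : ℝ) / (m + t))⁻¹ := by rw [inv_div]
  have hA : (0 : ℝ) < m / (m + t) := by positivity
  have hB : (0 : ℝ) < t / (m + t) := by positivity
  rw [confusionBound, binEntropy_eq_log, h1, mul_pow, mul_assoc]
  congr 1
  rw [← Real.exp_log (pow_pos (show 0 < ((m : ℝ) + t) / m by positivity) m),
    ← Real.exp_log (pow_pos (show 0 < ((m : ℝ) + t) / t by positivity) t), ← Real.exp_add,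
    Real.log_pow, Real.log_pow, h2, h3, Real.log_inv, Real.log_inv]
  congr 1
  field_simp
  ring

theorem badBound_eq {m t : ℕ} (hm : 0 < m) {V s y : ℝ} (hV : 0 < V) (hs : 0 ≤ s) (hy : 0 ≤ y)
    (hsV : s * (1 - V) < 1) :
    badBound m t V s y = Real.exp (-(m * badExponent (t / m) V s y)) := by
  have hm' : (0 : ℝ) < m := by exact_mod_cast hm
  have hA : 0 < 1 - s * (1 - V) := by linarith
  have hB : 0 < 1 + s * V := by positivity
  have hC : 0 < 1 + s * V * (1 + y) := by positivity
  have h1 : 1 + s * V / (1 + s * V) * y = (1 + s * V * (1 + y)) / (1 + s * V) := by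
    field_simp; ring
  rw [badBound, h1, ← Real.exp_log (pow_pos (inv_pos.2 hA) m),
    ← Real.exp_log (pow_pos (inv_pos.2 hB) t),
    ← Real.exp_log (pow_pos (inv_pos.2 (div_pos hC hB)) (m + t)), ← Real.exp_add, ← Real.exp_add,
    Real.log_pow, Real.log_pow, Real.log_pow, Real.log_inv, Real.log_inv, Real.log_inv,
    Real.log_div hC.ne' hB.ne', badExponent]
  congr 1
  push_cast
  field_simp
  ring

/-- The threshold is defined so that `V ^ m` cancels the exponents of all counting factors. Each of
the at most `Ka + 1` sizes then contributes only the slack. -/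
theorem sum_confusion_le {n m K Ka : ℕ} {M u ε : ℝ} (hM : 1 ≤ M) (hKaK : Ka ≤ K) (hKa : 0 < Ka)
    (hm : 0 < m) (hn : Ka + m = n) (hε : 0 < ε) {V : ℕ → ℝ}
    (hV : ∀ t ≤ Ka, V t = decodingThreshold M (t / Ka) (Ka / n) (K / n) u)
    (A : Finset (Fin K)) (hA : A.card = Ka) :
    ∑ S ∈ A.powerset.filter (fun S => ε * Ka ≤ S.card),
      M ^ S.card * ((K - Ka + S.card).choose S.card : ℝ) * confusionBound m S.card (V S.card) ≤
      (Ka + 1) * Real.exp (-(u * n)) := by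
  have hKa' : (0 : ℝ) < Ka := by exact_mod_cast hKa
  have hm' : (0 : ℝ) < m := by exact_mod_cast hm
  have hn' : (n : ℝ) = Ka + m := by rw [← hn]; push_cast; ring
  have hn0 : (0 : ℝ) < n := by rw [hn']; positivity
  have hKK : (Ka : ℝ) ≤ K := by exact_mod_cast hKaK
  rw [Finset.sum_filter, Finset.sum_powerset_apply_card (fun t : ℕ => if ε * Ka ≤ t then
    M ^ t * ((K - Ka + t).choose t : ℝ) * confusionBound m t (V t) else 0), hA]
  have hterm : ∀ t ∈ Finset.range (Ka + 1), (Ka.choose t) • (if ε * Ka ≤ t then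
      M ^ t * ((K - Ka + t).choose t : ℝ) * confusionBound m t (V t) else 0) ≤
      Real.exp (-(u * n)) := by
    intro t ht
    have htKa : t ≤ Ka := by have := Finset.mem_range.1 ht; omega
    split_ifs with hεt
    swap
    · simpa using (Real.exp_pos _).le
    have ht0' : (0 : ℝ) < t := lt_of_lt_of_le (by positivity) hεt
    have ht0 : 0 < t := by exact_mod_cast ht0'
    have c1 := choose_le_exp_binEntropy htKa
    have c2 := choose_le_exp_binEntropy (show t ≤ K - Ka + t by omega)
    push_cast [Nat.cast_sub hKaK] at c2
    have hVm : V t ^ m = Real.exp (-(n * (confusionRate M (t / Ka) (Ka / n) (K / n) + u))) := by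
      rw [hV t htKa, decodingThreshold, ← Real.exp_nat_mul]
      congr 1
      have : 1 - (Ka : ℝ) / n = m / n := by rw [hn']; field_simp; ring
      rw [this]
      field_simp
    have hMt : M ^ t = Real.exp (t * Real.log M) := by
      rw [← Real.log_pow, Real.exp_log (by positivity)]
    have hrate : (n : ℝ) * confusionRate M (t / Ka) (Ka / n) (K / n) =
        Ka * Real.binEntropy (t / Ka) + (m + t) * Real.binEntropy (t / (m + t)) +
          t * Real.log M + (K - Ka + t) * Real.binEntropy (t / (K - Ka + t)) := by
      have a1 : (Ka : ℝ) / n * (t / Ka) = t / n := by field_simp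
      have a2 : 1 - (Ka : ℝ) / n + t / n = (m + t) / n := by rw [hn']; field_simp; ring
      have a3 : (K : ℝ) / n - Ka / n + t / n = (K - Ka + t) / n := by ring
      have a4 : (t : ℝ) / n / ((m + t) / n) = t / (m + t) := by field_simp
      have a5 : (t : ℝ) / n / ((K - Ka + t) / n) = t / (K - Ka + t) :=
        div_div_div_cancel_right₀ hn0.ne' _ _
      rw [confusionRate, a1, a2, a3, a4, a5]
      field_simp
    rw [nsmul_eq_mul, confusionBound_eq hm ht0, hVm, hMt]
    calc (Ka.choose t : ℝ) * (Real.exp (t * Real.log M) * ((K - Ka + t).choose t : ℝ) *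
          (Real.exp (-(n * (confusionRate M (t / Ka) (Ka / n) (K / n) + u))) *
            Real.exp ((m + t) * Real.binEntropy (t / (m + t)))))
        ≤ Real.exp (Ka * Real.binEntropy (t / Ka)) * (Real.exp (t * Real.log M) *
          Real.exp ((K - Ka + t) * Real.binEntropy (t / (K - Ka + t))) *
          (Real.exp (-(n * (confusionRate M (t / Ka) (Ka / n) (K / n) + u))) *
            Real.exp ((m + t) * Real.binEntropy (t / (m + t))))) := by gcongr
      _ = Real.exp (-(u * n)) := by
        rw [← Real.exp_add, ← Real.exp_add, ← Real.exp_add, ← Real.exp_add]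
        congr 1
        rw [mul_add, hrate]
        ring
  refine (Finset.sum_le_sum hterm).trans (le_of_eq ?_)
  rw [Finset.sum_const, Finset.card_range, nsmul_eq_mul]
  push_cast
  ring

/-- For typical fading, the Chernoff bounds summed over all sets of missed users are small. -/
theorem exists_sum_badBound_le {n m K Ka : ℕ} {M u ε δ η B : ℝ} (hKa : 0 < Ka) (hm : 0 < m)
    (hn : Ka + m = n) (hB : 0 ≤ B) {V : ℕ → ℝ}
    (hV : ∀ t ≤ Ka, V t = decodingThreshold M (t / Ka) (Ka / n) (K / n) u)
    {F : Finset (ℝ × ℝ × ℝ)} (hF : ∀ i ∈ F, 0 ≤ i.1 ∧ 0 < i.2.1 ∧ 0 ≤ i.2.2)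
    (hcov : ∀ θ x, ε ≤ θ → θ ≤ 1 → 0 ≤ x → x ≤ θ → ∃ i ∈ F, (x = θ → i.2.2 = 0) ∧
      TiltControls M δ i (θ, x) (Ka / n, K / n, u, B * Ka))
    {A : Finset (Fin K)} (hA : A.card = Ka) {h : Fin K → ℂ}
    (hh : h ∈ typicalFading (F.image Prod.snd) η A) :
    ∃ σ : Finset (Fin K) → ℝ, (∀ S, 0 ≤ σ S ∧ σ S * (1 - V S.card) < 1) ∧
      ∑ S ∈ A.powerset.filter (fun S => ε * Ka ≤ S.card),
        badBound m S.card (V S.card) (σ S) (B * ∑ j ∈ S, ‖h j‖ ^ 2) ≤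
      F.card * ((Ka + 1) * Real.exp (Ka * η - m * δ)) := by
  classical
  have hKa' : (0 : ℝ) < Ka := by exact_mod_cast hKa
  have hm' : (0 : ℝ) < m := by exact_mod_cast hm
  have hn' : (n : ℝ) = Ka + m := by rw [← hn]; push_cast; ring
  have hn0 : (0 : ℝ) < n := by rw [hn']; positivity
  have hal : (Ka : ℝ) / n / (1 - Ka / n) = Ka / m := by
    have : 1 - (Ka : ℝ) / n = m / n := by rw [hn']; field_simp; ring
    rw [this]; field_simp
  set b : ℝ × ℝ × ℝ → Finset (Fin K) → ℝ := fun i S =>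
    Real.exp (-i.2.2 * ∑ j ∈ S, ‖h j‖ ^ 2) *
      Real.exp (S.card * Real.log i.2.1 - Ka * logPartition i.2.1 i.2.2 - m * δ) with hb
  have key : ∀ S : Finset (Fin K), ∃ s, (0 ≤ s ∧ s * (1 - V S.card) < 1) ∧
      (S ∈ A.powerset.filter (fun S => ε * Ka ≤ S.card) → ∃ i ∈ F,
        badBound m S.card (V S.card) s (B * ∑ j ∈ S, ‖h j‖ ^ 2) ≤ b i S) := by
    intro S
    by_cases hS : S ∈ A.powerset.filter (fun S => ε * Ka ≤ S.card)
    swap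
    · exact ⟨0, by simp, fun h => absurd h hS⟩
    obtain ⟨hSA, hεS⟩ := Finset.mem_filter.1 hS
    have hcard : S.card ≤ Ka := hA ▸ Finset.card_le_card (Finset.mem_powerset.1 hSA)
    have hcard' : (S.card : ℝ) ≤ Ka := by exact_mod_cast hcard
    set E := ∑ j ∈ S, ‖h j‖ ^ 2 with hE
    have hE0 : 0 ≤ E := by positivity
    set θ : ℝ := S.card / Ka with hθ
    -- Energies above `θ Ka` are clipped to a compact range. The Chernoff exponent can only lose by
    -- this, and the count does not notice since `β = 0` at `x = θ`.
    set x := min (E / Ka) θ with hx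
    have hx0 : 0 ≤ x := le_min (by positivity) (by positivity)
    obtain ⟨i, hi, hxθ, h1, h2⟩ := hcov θ x (by rw [hθ, le_div_iff₀ hKa']; exact hεS)
      (by rw [hθ, div_le_one hKa']; exact hcard') hx0 (min_le_right _ _)
    obtain ⟨hs0, hL, hβ⟩ := hF i hi
    have hVS : V S.card = decodingThreshold M θ (Ka / n) (K / n) u := hV _ hcard
    have hV0 : 0 < V S.card := hVS ▸ decodingThreshold_pos _ _ _ _ _
    simp only [← hVS] at h1 h2
    refine ⟨i.1, ⟨hs0, h1⟩, fun _ => ⟨i, hi, ?_⟩⟩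
    rw [badBound_eq hm hV0 hs0 (by positivity) h1, hb]
    simp only
    rw [← Real.exp_add, Real.exp_le_exp]
    have hr : θ * ((Ka : ℝ) / n / (1 - Ka / n)) = S.card / m := by rw [hal, hθ]; field_simp
    rw [hr, hal] at h2
    have hmono : badExponent (S.card / m) (V S.card) i.1 (B * Ka * x) ≤
        badExponent (S.card / m) (V S.card) i.1 (B * E) := by
      refine badExponent_mono (by positivity) hV0.le hs0 (by positivity) ?_
      have : Ka * x ≤ E := by
        have := mul_le_mul_of_nonneg_left (min_le_left (E / Ka) θ) hKa'.le
        rwa [mul_div_cancel₀ _ hKa'.ne'] at this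
      rw [mul_assoc]
      exact mul_le_mul_of_nonneg_left this hB
    have h3 := mul_lt_mul_of_pos_left (h2.trans_le hmono) hm'
    have h4 : (m : ℝ) * (Ka / m * countExponent i.2.1 i.2.2 θ x + δ) =
        i.2.2 * (Ka * x) - S.card * Real.log i.2.1 + Ka * logPartition i.2.1 i.2.2 + m * δ := by
      rw [countExponent, hθ]; field_simp
    have h5 : i.2.2 * (Ka * x) = i.2.2 * E := by
      rcases le_total (E / Ka) θ with hle | hle
      · rw [hx, min_eq_left hle, mul_div_cancel₀ _ hKa'.ne']
      · rw [hxθ (min_eq_right hle), zero_mul, zero_mul]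
    rw [h4, h5] at h3
    linarith
  choose σ hσ hσb using key
  refine ⟨σ, hσ, ?_⟩
  calc ∑ S ∈ A.powerset.filter (fun S => ε * Ka ≤ S.card),
        badBound m S.card (V S.card) (σ S) (B * ∑ j ∈ S, ‖h j‖ ^ 2)
      ≤ ∑ S ∈ A.powerset.filter (fun S => ε * Ka ≤ S.card), ∑ i ∈ F, b i S := by
        refine Finset.sum_le_sum fun S hS => ?_
        obtain ⟨i, hi, hle⟩ := hσb S hS
        exact hle.trans (Finset.single_le_sum (f := fun i => b i S)
          (fun i _ => by positivity) hi)
    -- Each set used its own tilt. Summing over all of `F` decouples the two, and each tilt is then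
    -- handled by the generating function.
    _ ≤ ∑ S ∈ A.powerset, ∑ i ∈ F, b i S :=
        Finset.sum_le_sum_of_subset_of_nonneg (Finset.filter_subset _ _)
          fun S _ _ => Finset.sum_nonneg fun i _ => by positivity
    _ = ∑ i ∈ F, ∑ S ∈ A.powerset, b i S := Finset.sum_comm
    _ ≤ ∑ _i ∈ F, (Ka + 1) * Real.exp (Ka * η - m * δ) := by
        refine Finset.sum_le_sum fun i hi => ?_
        rw [Finset.sum_powerset, hA]
        have : ∀ t ∈ Finset.range (Ka + 1), ∑ S ∈ A.powersetCard t, b i S ≤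
            Real.exp (Ka * η - m * δ) := by
          intro t _
          have h1 := sum_exp_neg_le_of_typicalFading hh (Finset.mem_image_of_mem Prod.snd hi)
            (hF i hi).2.1 t
          rw [hA] at h1
          calc ∑ S ∈ A.powersetCard t, b i S
              = (∑ S ∈ A.powersetCard t, Real.exp (-i.2.2 * ∑ j ∈ S, ‖h j‖ ^ 2)) *
                  Real.exp (t * Real.log i.2.1 - Ka * logPartition i.2.1 i.2.2 - m * δ) := by
                rw [Finset.sum_mul]
                refine Finset.sum_congr rfl fun S hS => ?_
                simp only [hb, (Finset.mem_powersetCard.1 hS).2]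
            _ ≤ Real.exp (Ka * (logPartition i.2.1 i.2.2 + η) - t * Real.log i.2.1) *
                  Real.exp (t * Real.log i.2.1 - Ka * logPartition i.2.1 i.2.2 - m * δ) :=
                mul_le_mul_of_nonneg_right h1 (Real.exp_pos _).le
            _ = Real.exp (Ka * η - m * δ) := by
                rw [← Real.exp_add]; congr 1; ring
        refine (Finset.sum_le_sum this).trans (le_of_eq ?_)
        rw [Finset.sum_const, Finset.card_range, nsmul_eq_mul]
        push_cast
        ring
    _ = F.card * ((Ka + 1) * Real.exp (Ka * η - m * δ)) := by
        rw [Finset.sum_const, nsmul_eq_mul]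

/-- The one slack `u` serves three times: in the decoding threshold, as the power back-off `P' = (1
- u) P`, and as the Chernoff parameter for a violation of the power constraint. -/
theorem exists_code_of_tiltControls {n m k K Ka : ℕ} {e u ε δ η C : ℝ} (hKaK : Ka ≤ K)
    (hKa : 0 < Ka) (hm : 0 < m) (hn : Ka + m = n) (hk : 1 ≤ k) (he : 0 < e) (hu0 : 0 < u)
    (hu1 : u < 1) (hε : 0 < ε) (hC : 0 ≤ C)
    {F : Finset (ℝ × ℝ × ℝ)} (hF : ∀ i ∈ F, 0 ≤ i.1 ∧ 0 < i.2.1 ∧ 0 ≤ i.2.2)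
    (hcov : ∀ θ x, ε ≤ θ → θ ≤ 1 → 0 ≤ x → x ≤ θ → ∃ i ∈ F, (x = θ → i.2.2 = 0) ∧
      TiltControls (2 ^ k) δ i (θ, x) (Ka / n, K / n, u, (1 - u) * (k * e / n) * Ka))
    (htyp : ∀ A : Finset (Fin K), A.card = Ka → (Measure.pi fun _ : Fin K => complexGaussian)
      (typicalFading (F.image Prod.snd) η A)ᶜ ≤ ENNReal.ofReal (C / Ka)) :
    ∃ c : RandomAccessCode n (2 ^ k) K Ka (k * e / n), ∀ A : Finset (Fin K), A.card = Ka →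
      c.pupe A ≤ ε + (K * 2 ^ k * ((1 - u)⁻¹ * Real.exp (-(u / (1 - u)))) ^ n + C / Ka +
        (F.card * ((Ka + 1) * Real.exp (Ka * η - m * δ)) + (Ka + 1) * Real.exp (-(u * n)))) := by
  have hKa' : (0 : ℝ) < Ka := by exact_mod_cast hKa
  have hm' : (0 : ℝ) < m := by exact_mod_cast hm
  have hn' : (n : ℝ) = Ka + m := by rw [← hn]; push_cast; ring
  have hn0 : (0 : ℝ) < n := by rw [hn']; positivity
  have hk0 : (0 : ℝ) < k := by exact_mod_cast hk
  have hKK : (Ka : ℝ) ≤ K := by exact_mod_cast hKaK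
  have hM1 : (1 : ℝ) ≤ 2 ^ k := one_le_pow₀ (by norm_num)
  have hP : 0 < k * e / n := by positivity
  have hP' : 0 < (1 - u) * (k * e / n) := mul_pos (by linarith) hP
  -- Sizes above `Ka` do not occur; `1 / 2` only keeps `V` inside `(0, 1)`.
  set V : ℕ → ℝ := fun t => if t ≤ Ka then
    decodingThreshold (2 ^ k) (t / Ka) (Ka / n) (K / n) u else 1 / 2 with hVd
  have hV : ∀ t ≤ Ka, V t = decodingThreshold (2 ^ k) (t / Ka) (Ka / n) (K / n) u := by
    intro t ht; simp [hVd, ht]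
  have hV01 : ∀ t, 0 < V t ∧ V t < 1 := by
    intro t
    by_cases ht : t ≤ Ka
    · rw [hV t ht]
      refine ⟨decodingThreshold_pos _ _ _ _ _, decodingThreshold_lt_one hM1 (by positivity) ?_
        (by positivity) ?_ ?_ hu0⟩
      · rw [div_le_one hKa']; exact_mod_cast ht
      · rw [div_lt_one hn0]; linarith
      · gcongr
    · simp only [hVd, if_neg ht]; norm_num
  refine exists_code_pupe_le hKaK (by positivity) hP.le hP' hm hn hKa hε hV01 hu0.le hu1 ?_
    (by positivity) (by positivity) (fun A hA => ⟨typicalFading (F.image Prod.snd) η A,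
      measurableSet_typicalFading _ _ _, htyp A hA, fun h hh =>
      exists_sum_badBound_le hKa hm hn hP'.le hV hF hcov hA hh⟩)
    (fun A hA => ?_)
  · refine le_of_eq ?_
    rw [mul_pow, ← Real.exp_nat_mul]
    push_cast
    congr 3
    have : 1 - u ≠ 0 := by linarith
    field_simp
  · push_cast
    exact sum_confusion_le hM1 hKaK hKa hm hn hε hV A hA

theorem tendsto_succ_mul_pow {r : ℝ} (h0 : 0 ≤ r) (h1 : r < 1) :
    Tendsto (fun n : ℕ => ((n : ℝ) + 1) * r ^ n) atTop (𝓝 0) := by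
  have := (tendsto_self_mul_const_pow_of_lt_one h0 h1).add
    (tendsto_pow_atTop_nhds_zero_of_lt_one h0 h1)
  simpa [add_mul] using this

/-! ### Large blocklength -/

section asymptotics

variable {k : ℕ} {μ p : ℝ} {K Ka : ℕ → ℕ}

theorem tendsto_active_density (hKaK : ∀ n, Ka n ≤ K n)
    (hK : Tendsto (fun n : ℕ => (K n : ℝ) / n) atTop (𝓝 μ))
    (hKa : Tendsto (fun n : ℕ => (Ka n : ℝ) / K n) atTop (𝓝 p)) :
    Tendsto (fun n : ℕ => (Ka n : ℝ) / n) atTop (𝓝 (p * μ)) := by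
  refine (hKa.mul hK).congr fun n => ?_
  rcases Nat.eq_zero_or_pos (K n) with h | h
  · have : Ka n = 0 := by have := hKaK n; omega
    simp [this]
  · have : (K n : ℝ) ≠ 0 := by positivity
    rw [div_mul_div_cancel₀ this]

/-- If `W / ξ` stays below the received energy for all fractions at least `ε'`, then codes of error
slightly more than `ε'` exist at large blocklengths. -/
theorem eventually_hasCode (hk : 1 ≤ k) (hμ0 : 0 < μ) (hμ1 : μ < 1) (hp0 : 0 < p) (hp1 : p ≤ 1)
    (hKaK : ∀ n, Ka n ≤ K n) (hK : Tendsto (fun n : ℕ => (K n : ℝ) / n) atTop (𝓝 μ))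
    (hKa : Tendsto (fun n : ℕ => (Ka n : ℝ) / K n) atTop (𝓝 p)) {ε ε' e : ℝ} (hε'0 : 0 < ε')
    (hε' : ε' < ε) (he : 0 < e)
    (hW : ∀ θ, ε' ≤ θ → θ ≤ 1 → NoCSI.W μ p k θ / NoCSI.xi (1 - θ) 1 < e * (p * μ * k)) :
    ∀ᶠ n in atTop, HasCode n k (K n) (Ka n) ε e := by
  have ha0 : 0 < p * μ := by positivity
  have ha1 : 0 < 1 - p * μ := by nlinarith
  have hk0 : (0 : ℝ) < k := by exact_mod_cast hk
  obtain ⟨F, hF, δ, hδ, hev⟩ := exists_finset_tiltControls hk hμ0 hμ1 hp0 hp1 hε'0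
    (show 0 ≤ e * (p * μ * k) by positivity) hW
  -- A small positive `u` keeps the parameters in the interior of the good set, where those at
  -- blocklength `n` eventually lie as well.
  have hcurve : Tendsto (fun u : ℝ => (p * μ, μ, u, (1 - u) * (e * (p * μ * k)))) (𝓝[>] 0)
      (𝓝 (p * μ, μ, (0 : ℝ), e * (p * μ * k))) := by
    refine tendsto_nhdsWithin_of_tendsto_nhds ?_
    have : Continuous fun u : ℝ => (p * μ, μ, u, (1 - u) * (e * (p * μ * k))) := by fun_prop
    simpa using this.tendsto 0
  obtain ⟨u, hu, hu0, hu1⟩ := ((hcurve.eventually hev.eventually_nhds).and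
    (Ioo_mem_nhdsGT (zero_lt_one' ℝ))).exists
  have ha := tendsto_active_density hKaK hK hKa
  have hπ : Tendsto (fun n : ℕ => ((Ka n : ℝ) / n, (K n : ℝ) / n, u,
      (1 - u) * (k * e / n) * Ka n)) atTop
      (𝓝 (p * μ, μ, u, (1 - u) * (e * (p * μ * k)))) := by
    refine ha.prodMk_nhds (hK.prodMk_nhds (tendsto_const_nhds.prodMk_nhds ?_))
    have := ha.const_mul ((1 - u) * (k * e))
    refine (this.congr fun n => by ring).trans (le_of_eq ?_)
    congr 1; ring
  -- The typicality slack costs `Ka η ≤ n η` in the exponent, against a gain `m δ` of about `2 n η`.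
  set η := (1 - p * μ) * δ / 2 with hη
  have hη0 : 0 < η := by positivity
  obtain ⟨C, hC, htyp⟩ := measure_compl_typicalFading_le (F.image Prod.snd) (fun q hq => by
    obtain ⟨i, hi, rfl⟩ := Finset.mem_image.1 hq
    exact ⟨(hF i hi).2.1.le, (hF i hi).2.2⟩) hη0
  have hKan : ∀ᶠ n : ℕ in atTop, (Ka n : ℝ) / n < 1 := ha.eventually_lt_const (by linarith)
  have hKan0 : ∀ᶠ n : ℕ in atTop, p * μ / 2 < (Ka n : ℝ) / n :=
    ha.eventually_const_lt (by linarith)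
  have hexp : ∀ᶠ n : ℕ in atTop, (Ka n : ℝ) / n * η - (1 - Ka n / n) * δ < -(η / 2) := by
    have : Tendsto (fun n : ℕ => (Ka n : ℝ) / n * η - (1 - Ka n / n) * δ) atTop
        (𝓝 (p * μ * η - (1 - p * μ) * δ)) :=
      (ha.mul_const η).sub ((tendsto_const_nhds.sub ha).mul_const δ)
    refine this.eventually_lt_const ?_
    have : (1 - p * μ) * δ = 2 * η := by rw [hη]; ring
    nlinarith
  have hρ0 : 0 ≤ (1 - u)⁻¹ * Real.exp (-(u / (1 - u))) := by
    have : 0 < 1 - u := by linarith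
    positivity
  have hρ1 : (1 - u)⁻¹ * Real.exp (-(u / (1 - u))) < 1 := by
    have h1 : 0 < 1 - u := by linarith
    rw [Real.exp_neg, ← mul_inv, inv_lt_one₀ (by positivity)]
    have h2 := Real.add_one_lt_exp (show u / (1 - u) ≠ 0 by positivity)
    have h3 : u / (1 - u) + 1 = (1 - u)⁻¹ := by field_simp; ring
    rw [h3, inv_lt_iff_one_lt_mul₀ h1] at h2
    linarith
  set ρ := (1 - u)⁻¹ * Real.exp (-(u / (1 - u)))
  have hlim : Tendsto (fun n : ℕ => (K n : ℝ) / n * (2 ^ k * (n * ρ ^ n)) +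
      C * (2 / (p * μ)) / n + (F.card * (((n : ℝ) + 1) * Real.exp (-(η / 2)) ^ n) +
        ((n : ℝ) + 1) * Real.exp (-u) ^ n)) atTop (𝓝 0) := by
    have t1 := hK.mul ((tendsto_self_mul_const_pow_of_lt_one hρ0 hρ1).const_mul (2 ^ k))
    have t2 := tendsto_const_div_atTop_nhds_zero_nat (C * (2 / (p * μ)))
    have t3 := (tendsto_succ_mul_pow (Real.exp_pos (-(η / 2))).le
      (Real.exp_lt_one_iff.2 (by linarith))).const_mul (F.card : ℝ)
    have t4 := tendsto_succ_mul_pow (Real.exp_pos (-u)).le (Real.exp_lt_one_iff.2 (by linarith))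
    simpa using (t1.add t2).add (t3.add t4)
  filter_upwards [hπ.eventually hu, hKan, hKan0, hexp, hlim.eventually_lt_const (sub_pos.2 hε'),
    eventually_gt_atTop 0] with n hcov hn1 hn2 hn3 hn4 hn0
  have hn0' : (0 : ℝ) < n := by exact_mod_cast hn0
  rw [div_lt_one hn0'] at hn1
  have hKa0 : 0 < (Ka n : ℝ) := by
    have : 0 < (Ka n : ℝ) / n := lt_trans (by positivity) hn2
    exact (div_pos_iff_of_pos_right hn0').1 this
  have hlt : Ka n < n := by exact_mod_cast hn1
  obtain ⟨c, hc⟩ := exists_code_of_tiltControls (m := n - Ka n) (hKaK n) (by exact_mod_cast hKa0)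
    (by omega) (by omega) hk he hu0 hu1 hε'0 hC hF hcov
    (fun A hA => hA ▸ htyp (K n) A (by rw [hA]; exact_mod_cast hKa0))
  refine ⟨c, fun A hA => (hc A hA).trans ?_⟩
  have b1 : (K n : ℝ) * 2 ^ k * ρ ^ n = K n / n * (2 ^ k * (n * ρ ^ n)) := by field_simp
  have b2 : C / Ka n ≤ C * (2 / (p * μ)) / n := by
    rw [lt_div_iff₀ hn0'] at hn2
    rw [mul_div_assoc, div_eq_mul_inv]
    refine mul_le_mul_of_nonneg_left ?_ hC
    rw [div_div, inv_eq_one_div, div_le_div_iff₀ hKa0 (by positivity)]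
    linarith
  have b3 : Real.exp (Ka n * η - ((n - Ka n : ℕ) : ℝ) * δ) ≤ Real.exp (-(η / 2)) ^ n := by
    rw [← Real.exp_nat_mul, Real.exp_le_exp, Nat.cast_sub hlt.le]
    have := mul_le_mul_of_nonneg_left hn3.le hn0'.le
    refine le_trans (le_of_eq ?_) this
    field_simp
  have b4 : Real.exp (-(u * n)) = Real.exp (-u) ^ n := by
    rw [← Real.exp_nat_mul]; congr 1; ring
  have b5 : ((Ka n : ℝ) + 1) * Real.exp (Ka n * η - ((n - Ka n : ℕ) : ℝ) * δ) ≤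
      ((n : ℝ) + 1) * Real.exp (-(η / 2)) ^ n := by gcongr
  have b6 : ((Ka n : ℝ) + 1) * Real.exp (-u) ^ n ≤ ((n : ℝ) + 1) * Real.exp (-u) ^ n := by gcongr
  have b7 := mul_le_mul_of_nonneg_left b5 (Nat.cast_nonneg (α := ℝ) F.card)
  rw [b1, b4]
  linarith

end asymptotics

/-! ### The energy threshold and the conclusion -/

namespace NoCSI

/-- The strict inequality `-ln (1 - x) > x` holds on all of `(0, 1)`, so the infimum is over the
whole interval. -/
theorem delta3_eq_zero : delta3 = 0 := by
  have : {x : ℝ | 0 < x ∧ x < 1 ∧ -Real.log (1 - x) - x > 0} = Set.Ioo 0 1 := by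
    ext x
    simp only [Set.mem_ofPred_eq, Set.mem_Ioo]
    refine ⟨fun h => ⟨h.1, h.2.1⟩, fun h => ⟨h.1, h.2, ?_⟩⟩
    have := Real.log_lt_sub_one_of_pos (show 0 < 1 - x by linarith [h.2]) (by linarith [h.1])
    linarith
  rw [delta3, this, csInf_Ioo one_pos]

theorem Ptot_eq (μ p : ℝ) (k : ℕ) (θ : ℝ) : Ptot μ p k θ = W μ p k θ / xi (1 - θ) 1 := by
  rw [Ptot, delta3_eq_zero, sub_zero, one_mul]

theorem continuousAt_Ptot {μ p θ : ℝ} {k : ℕ} (hk : 1 ≤ k) (hμ0 : 0 < μ) (hμ1 : μ < 1)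
    (hp0 : 0 < p) (hp1 : p ≤ 1) (h0 : 0 < θ) (h1 : θ < 1) :
    ContinuousAt (fun θ => Ptot μ p k θ) θ := by
  have ha0 : 0 < p * μ := by positivity
  have ha1 : 0 < 1 - p * μ := by nlinarith
  have haμ : p * μ ≤ μ := by nlinarith
  have hpos : 0 < p * μ * θ := by positivity
  have hV : ContinuousAt (fun θ => V μ p k θ) θ := by
    have := ContinuousAt.comp (f := fun θ : ℝ => (θ, p * μ, μ, (0 : ℝ)))
      (continuousAt_decodingThreshold (M := 2 ^ k) (θ := θ) (a := p * μ) (κ := μ) (η := 0)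
        ha1.ne' (by linarith) (by linarith)) (Continuous.continuousAt (by fun_prop))
    refine this.congr (Eventually.of_forall fun y => ?_)
    exact decodingThreshold_eq_V k hμ0
  have hV0 := V_pos μ p k θ
  have hV1 := V_lt_one hk hμ0 hμ1 hp0 hp1 h0 h1.le
  have hξ := xi_pos h0 h1.le
  have hb := Real.binEntropy_continuous
  have hc : ContinuousAt (fun θ => c μ p k θ) θ := by
    unfold c
    exact (continuousAt_const.mul hV).div (continuousAt_const.sub hV) (by linarith)
  have hq : ContinuousAt (fun θ => q μ p θ) θ := by
    unfold q
    refine ContinuousAt.mul (ContinuousAt.div continuousAt_const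
      (Continuous.continuousAt (by fun_prop)) ?_) hb.continuousAt
    have : 0 < θ * p * μ := by positivity
    linarith
  have hd : ContinuousAt (fun θ => delta2 μ p k θ) θ := by
    unfold delta2
    exact (hq.mul (continuousAt_const.add hc)).add
      (((((hq.pow 2).mul hc).mul (continuousAt_const.add hc)).add
        ((continuousAt_const.mul hq).mul (continuousAt_const.add hc))).sqrt)
  simp only [Ptot_eq, xi_one_sub]
  rw [xi_one_sub] at hξ
  refine ContinuousAt.div ?_ ?_ hξ.ne'
  · unfold W
    exact ((continuousAt_const.sub hV).div hV hV0.ne').mul (continuousAt_const.add hd)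
  · exact continuousAt_id.add ((continuousAt_const.sub continuousAt_id).mul
      ((continuousAt_const.sub continuousAt_id).log (sub_pos.2 h1).ne'))

/-- The supremum bounds the value at `ε` by continuity, and the strict gap survives slightly to the
left of `ε`. The difference `ε - ε'` later absorbs the vanishing error terms. -/
theorem exists_lt_of_energyThreshold_lt {μ p ε e : ℝ} {k : ℕ} (hk : 1 ≤ k) (hμ0 : 0 < μ)
    (hμ1 : μ < 1) (hp0 : 0 < p) (hp1 : p ≤ 1) (hε0 : 0 < ε) (hε1 : ε < 1)
    (he : energyThreshold μ p k ε < (e : EReal)) :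
    ∃ ε', 0 < ε' ∧ ε' < ε ∧
      ∀ θ, ε' ≤ θ → θ ≤ 1 → W μ p k θ / xi (1 - θ) 1 < e * (p * μ * k) := by
  have hk0 : (0 : ℝ) < k := by exact_mod_cast hk
  have hS : 0 < p * μ * k := by positivity
  obtain ⟨e', he1, he2⟩ := EReal.lt_iff_exists_real_btwn.1 he
  have he2' : e' < e := by exact_mod_cast he2
  have hle : ∀ θ ∈ Set.Ioc ε 1, Ptot μ p k θ ≤ e' * (p * μ * k) := by
    intro θ hθ
    rw [← div_le_iff₀ hS]
    have := (le_iSup₂ (f := fun θ (_ : θ ∈ Set.Ioc ε 1) =>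
      ((Ptot μ p k θ / (p * μ * k) : ℝ) : EReal)) θ hθ).trans he1.le
    exact_mod_cast this
  have hlt : e' * (p * μ * k) < e * (p * μ * k) := mul_lt_mul_of_pos_right he2' hS
  have hcont := continuousAt_Ptot hk hμ0 hμ1 hp0 hp1 hε0 hε1
  have hε : Ptot μ p k ε ≤ e' * (p * μ * k) := by
    refine le_of_tendsto (hcont.tendsto.mono_left (nhdsWithin_le_nhds (s := Set.Ioi ε))) ?_
    filter_upwards [Ioc_mem_nhdsGT hε1] with θ hθ using hle θ hθ
  have hev := hcont.tendsto.eventually_lt_const (hε.trans_lt hlt)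
  obtain ⟨r, hr, hball⟩ := Metric.eventually_nhds_iff.1 hev
  refine ⟨max (ε / 2) (ε - r / 2), lt_max_of_lt_left (by linarith),
    max_lt (by linarith) (by linarith), fun θ hθ hθ1 => ?_⟩
  rw [← Ptot_eq]
  rcases le_or_gt θ ε with h | h
  · refine hball ?_
    rw [Real.dist_eq, abs_sub_lt_iff]
    have := (le_max_right _ _).trans hθ
    constructor <;> linarith
  · exact (hle θ ⟨h, hθ1⟩).trans_lt hlt

theorem W_one_pos {μ p : ℝ} {k : ℕ} (hk : 1 ≤ k) (hμ0 : 0 < μ) (hμ1 : μ < 1) (hp0 : 0 < p)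
    (hp1 : p ≤ 1) : 0 < W μ p k 1 := by
  have hV0 := V_pos μ p k 1
  have hV1 := V_lt_one hk hμ0 hμ1 hp0 hp1 one_pos le_rfl
  have : W μ p k 1 = (1 - V μ p k 1) / V μ p k 1 := by simp [W, delta2, q]
  rw [this]
  exact div_pos (by linarith) hV0

end NoCSI

/-- The code that always declares the first `Ka` users active. -/
theorem hasCode_one {n k K Ka : ℕ} {e : ℝ} (hKaK : Ka ≤ K) (he : 0 ≤ e) :
    HasCode n k K Ka 1 e := by
  have hM : 0 < 2 ^ k := by positivity
  let c : RandomAccessCode n (2 ^ k) K Ka (k * e / n) :=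
    { Seed := Unit
      law := Measure.dirac ()
      enc := fun _ _ _ _ => 0
      dec := fun _ _ j => if (j : ℕ) < Ka then some ⟨0, hM⟩ else none
      enc_meas := fun _ _ _ => measurable_const
      dec_meas := fun _ _ => MeasurableSet.const _
      power := fun _ _ _ => by
        simp only [norm_zero, ne_eq, OfNat.ofNat_ne_zero, not_false_eq_true, zero_pow,
          Finset.sum_const_zero]
        positivity
      card_dec := fun _ _ => by
        have : (Finset.univ.filter fun j : Fin K => (if (j : ℕ) < Ka then
            some (⟨0, hM⟩ : Fin (2 ^ k)) else none).isSome) =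
            (Finset.univ.filter fun j : Fin K => (j : ℕ) < Ka) := by
          refine Finset.filter_congr fun j _ => ?_
          split_ifs with h <;> simp [h]
        rw [this, Fin.card_filter_val_lt, min_eq_right hKaK] }
  exact ⟨c, fun A hA => c.pupe_le_one hA hM⟩

theorem minEnergyPerBit_le {Code : ℕ → ℕ → ℕ → ℕ → ℝ → ℝ → Prop} {k : ℕ} {K Ka : ℕ → ℕ} {ε : ℝ}
    {T : EReal} (h : ∀ e : ℝ, T < (e : EReal) → ∀ᶠ n in atTop, Code n k (K n) (Ka n) ε e) :
    minEnergyPerBit Code k K Ka ε ≤ T := by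
  refine EReal.le_of_forall_lt_iff_le.1 fun e he => ?_
  refine limsup_le_of_le (by isBoundedDefault) ?_
  filter_upwards [h e he] with n hn
  exact iInf₂_le e hn

theorem proposition2 (k : ℕ) (hk : 1 ≤ k) (μ p ε : ℝ) (hμ0 : 0 < μ) (hμ1 : μ < 1)
    (hp0 : 0 < p) (hp1 : p ≤ 1) (hε0 : 0 < ε) (hε1 : ε < 1)
    (K Ka : ℕ → ℕ) (hKaK : ∀ n, Ka n ≤ K n)
    (hK : Tendsto (fun n : ℕ => (K n : ℝ) / n) atTop (𝓝 μ))
    (hKa : Tendsto (fun n : ℕ => (Ka n : ℝ) / K n) atTop (𝓝 p)) :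
    (∀ e : ℝ, NoCSI.energyThreshold μ p k ε < (e : EReal) →
      ∃ εs : ℕ → ℝ, limsup (fun n => (εs n : EReal)) atTop ≤ (ε : EReal) ∧
        ∀ n, HasCode n k (K n) (Ka n) (εs n) e ∧ HasDetCode n k (K n) (Ka n) (εs n) e) ∧
    minEnergyPerBit HasCode k K Ka ε ≤ NoCSI.energyThreshold μ p k ε ∧
    minEnergyPerBit HasDetCode k K Ka ε ≤ NoCSI.energyThreshold μ p k ε := by
  classical
  have main : ∀ e : ℝ, NoCSI.energyThreshold μ p k ε < (e : EReal) →
      0 ≤ e ∧ ∀ᶠ n in atTop, HasCode n k (K n) (Ka n) ε e := by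
    intro e he
    obtain ⟨ε', hε'0, hε', hW⟩ :=
      NoCSI.exists_lt_of_energyThreshold_lt hk hμ0 hμ1 hp0 hp1 hε0 hε1 he
    have he0 : 0 < e := by
      have h1 := hW 1 (by linarith) le_rfl
      have h2 := div_pos (NoCSI.W_one_pos hk hμ0 hμ1 hp0 hp1) (xi_pos one_pos le_rfl)
      have hk0 : (0 : ℝ) < k := by exact_mod_cast hk
      exact (pos_iff_pos_of_mul_pos (h2.trans h1)).2 (by positivity)
    exact ⟨he0.le, eventually_hasCode hk hμ0 hμ1 hp0 hp1 hKaK hK hKa hε'0 hε' he0 hW⟩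
  refine ⟨fun e he => ?_, minEnergyPerBit_le fun e he => (main e he).2,
    minEnergyPerBit_le fun e he => (main e he).2.mono fun n hn => hn.hasDetCode (hKaK n)⟩
  obtain ⟨he0, hev⟩ := main e he
  -- The target `ε` fails for finitely many blocklengths at most; there the trivial code with error
  -- 1 is used.
  refine ⟨fun n => if HasCode n k (K n) (Ka n) ε e then ε else 1, ?_, fun n => ?_⟩
  · refine limsup_le_of_le (by isBoundedDefault) ?_
    filter_upwards [hev] with n hn
    rw [if_pos hn]
  · have : HasCode n k (K n) (Ka n) (if HasCode n k (K n) (Ka n) ε e then ε else 1) e := by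
      split_ifs with h
      · exact h
      · exact hasCode_one (hKaK n) he0
    exact ⟨this, this.hasDetCode (hKaK n)⟩
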